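/- **Conventions.** A Polish ultrametric space is a complete separable metric space $(U,d)$ with $d(x,z)\le\max\{d(x,y),d(y,z)\}$; $\mathrm{Iso}(U)$ has the topology of pointwise convergence. The homogeneous component $[x]$ of $x\in U$ is its $\mathrm{Iso}(U)$-orbit; $U$ is *exact* if for all $x,y\in U$ the infimum $\inf\{d(x',y') : x'\in[x],\,y'\in[y]\}$ is attained. $U$ is uniformly discrete if there is $r>0$ such that all open balls of radius $r$ are singletons. $\cong$ denotes isomorphism of topological groups. *Trees.* For a linear order $L$, an *$L$-tree* is a partial order $T$ with a surjection $\lambda\colon T\to L$ such that: $t<t'$ implies $\lambda(t)<\lambda(t')$; for all $t$ and $\ell\ge\lambda(t)$ there is a unique $t|_\ell\ge t$ with $\lambda(t|_\ell)=\ell$; any $t,t'$ have $t|_\ell=t'|_\ell$ for some $\ell\ge\max\{\lambda(t),\lambda(t')\}$; and if $t,t'$ are incomparable, then $\{\ell\ge\max\{\lambda(t),\lambda(t')\} : t|_\ell\ne t'|_\ell\}$ has a maximum. It is *pruned* if for every $t\in T$ there is an order-preserving $b\colon L\to T$ with $\lambda(b(\ell))=\ell$ for all $\ell$ and $b(\lambda(t))=t$.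 $\mathrm{Aut}(T)$ is the group of $\lambda$-preserving order automorphisms, with pointwise convergence on the discrete set $T$. The condensed tree $\Delta(T)$ is the set of $\mathrm{Aut}(T)$-orbits $[t]$, with $[t]\le[t']$ iff some elements of $[t]$, $[t']$ are so related, and the induced level map; $T$ is *special* if $\Delta(T)$ is an $L$-tree. $T$ has property $(\star)$ if, whenever $C\subseteq T$ is an upward closed chain that has a strict lower bound in $T$ (i.e. some $s$ with $s<c$ for all $c\in C$), and $t\in T$ satisfies $[t]\le[c]$ for all $c\in C$, there is $\bar t\in[t]$ with $\bar t\le c$ for all $c\in C$. *Skeletons.* A countable treeable skeleton $\langle\Delta,N\rangle$ is a nonempty countable partial order $\Delta$ that is a pruned $L$-tree for some linear order $L$ and some level map, with labels $1\le N_\delta\le\omega$ ($\delta\in\Delta$), each $N_\delta$ being identified with the set of natural numbers below it. For $x\in\prod_\delta N_\delta$ let $x|_\delta$ be the restriction of $x$ to $\{\gamma:\gamma\ge\delta\}$ and $\mathrm{supp}(x)=\{\delta:x(\delta)\ne0\}$. $\mathrm{Max}$ is the family of all $A\subseteq\Delta$ without infinite strictly increasing sequences, $\mathrm{Wsp}$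 the family of those $A\in\mathrm{Max}$ in which no infinite strictly decreasing sequence has a lower bound in $\Delta$, and $\mathrm{LF}$ the family of all $A$ such that $\{\gamma\in A:\gamma\ge\delta\}$ is finite for all $\delta$. *Global domains.* A domain is a set $S\subseteq\prod_\delta N_\delta$ such that for all $x\in S$, $\delta\in\Delta$, $i\in N_\delta$ there is $x^\delta_i\in S$ with $x^\delta_i(\delta)=i$ and $x^\delta_i(\gamma)=x(\gamma)$ for $\gamma>\delta$. $\mathrm{Wr}^S_{\delta\in\Delta}\mathrm{Sym}(N_\delta)$ is the group of all $g\in\mathrm{Sym}(S)$ such that for all $x,y\in S$, $\delta\in\Delta$: $x|_\delta=y|_\delta$ iff $g(x)|_\delta=g(y)|_\delta$, and $i\mapsto g(x^\delta_i)(\delta)$ is a permutation of $N_\delta$. The product $\prod_\delta N_\delta$ has the topology $\tau_\Delta$ generated by the sets $\{y:y|_\gamma=x|_\gamma\}$, and $\mathrm{Wr}^S$ has the topology of pointwise convergence on $S\subseteq(\prod_\delta N_\delta,\tau_\Delta)$. For $\mathscr A\in\{\mathrm{LF},\mathrm{Wsp}\}$ put $S^{\mathscr A}=\{x:\mathrm{supp}(x)\in\mathscr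 A\}$ and $\mathrm{Wr}^{\mathscr A}=\mathrm{Wr}^{S^{\mathscr A}}$. $S$ is *approximately homogeneous* if for all $x,y\in S$ and $\delta$ there is $g\in\mathrm{Wr}^S_{\delta\in\Delta}\mathrm{Sym}(N_\delta)$ with $g(x)|_\delta=y|_\delta$, and *locally determined* if every $x\in\prod_\delta N_\delta$ such that for each $\gamma$ there is $y\in S$ with $x|_\gamma=y|_\gamma$ belongs to $S$. *Local domains and projections.* A system of projections $\langle\mathbf S,\boldsymbol\pi\rangle$ consists of nonempty sets $\mathbf S_\delta\subseteq\prod_{\gamma\ge\delta}N_\gamma$ (with union $\mathbf S$), closed under replacing the value at $\delta$ by any $i\in N_\delta$ ($z\mapsto z^\delta_i$), and surjections $\pi_{\delta\gamma}\colon\mathbf S_\delta\to\mathbf S_\gamma$ ($\delta\le\gamma$) such that $\pi_{\delta\gamma}(z)=\pi_{\delta\gamma}(z')$ iff $z|_\gamma=z'|_\gamma$, and $\pi_{\gamma\beta}\circ\pi_{\delta\gamma}=\pi_{\delta\beta}$. $\mathrm{Wr}^{\mathbf S,\boldsymbol\pi}_{\delta\in\Delta}\mathrm{Sym}(N_\delta)$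 is the group of all $g\in\mathrm{Sym}(\mathbf S)$ with $g(\mathbf S_\delta)=\mathbf S_\delta$, $g\circ\pi_{\delta\gamma}=\pi_{\delta\gamma}\circ g$ on $\mathbf S_\delta$, and $i\mapsto g(z^\delta_i)(\delta)$ a permutation of $N_\delta$ for every $z\in\mathbf S_\delta$, with pointwise convergence on the discrete set $\mathbf S$. The system is *locally homogeneous* if this group is transitive on each $\mathbf S_\delta$, *full* if every $z\in\mathbf S_{\bar\delta}$ is $z_{\bar\delta}$ for some $(z_\delta)_\delta\in\prod_\delta\mathbf S_\delta$ with $\pi_{\delta\gamma}(z_\delta)=z_\gamma$ for all $\delta\le\gamma$, and *countable* if $\mathbf S$ is countable. A *family of local domains* $\mathbf S$ is a system of projections whose projections are the restrictions $z\mapsto z|_\gamma$; its group is written $\mathrm{Wr}^{\mathbf S}$. $\mathbf S\subseteq\mathbf S^{\mathrm{Max}}$ means that each $z\in\mathbf S_\delta$ is $x|_\delta$ for some $x$ with $\mathrm{supp}(x)\in\mathrm{Max}$. **Theorem.** For every topological group $G$ the following are equivalent: 1. $G\cong\mathrm{Iso}(U)$ for some exact Polish ultrametric space $U$; 2. $G\cong\mathrm{Iso}(U)$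 for some exact perfect locally compact Polish ultrametric space $U$; 3. $G\cong\mathrm{Iso}(U)$ for some exact uniformly discrete Polish ultrametric space $U$; 4. $G\cong\mathrm{Aut}(T)$ for some linear order $L$ and some countable pruned $L$-tree $T$ with property $(\star)$; 5. $G\cong\mathrm{Aut}(T)$ for some linear order $L$ with a minimum and some countable pruned special $L$-tree $T$ with property $(\star)$; 6. $G\cong\mathrm{Aut}(T)$ for some countable pruned special $\mathbb Q$-tree $T$ with property $(\star)$; 7. $G\cong\mathrm{Wr}^{\mathrm{LF}}_{\delta\in\Delta}\mathrm{Sym}(N_\delta)$ for some countable treeable skeleton $\langle\Delta,N\rangle$; 8. $G\cong\mathrm{Wr}^{\mathrm{Wsp}}_{\delta\in\Delta}\mathrm{Sym}(N_\delta)$ for some countable treeable skeleton $\langle\Delta,N\rangle$; 9. $G\cong\mathrm{Wr}^{S}_{\delta\in\Delta}\mathrm{Sym}(N_\delta)$ for some countable treeable skeleton $\langle\Delta,N\rangle$ and some approximately homogeneous, closed, locally determined, separable domain $S\subseteq\prod_{\delta}N_\delta$ (closed and separable with respect to $\tau_\Delta$); 10. $G\cong\mathrm{Wr}^{\mathbf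 S}_{\delta\in\Delta}\mathrm{Sym}(N_\delta)$ for some countable treeable skeleton $\langle\Delta,N\rangle$ and some countable locally homogeneous full family of local domains $\mathbf S\subseteq\mathbf S^{\mathrm{Max}}$; 11. $G\cong\mathrm{Wr}^{\mathbf S,\boldsymbol\pi}_{\delta\in\Delta}\mathrm{Sym}(N_\delta)$ for some countable treeable skeleton $\langle\Delta,N\rangle$ and some countable locally homogeneous full system of projections $\langle\mathbf S,\boldsymbol\pi\rangle$ with $\mathbf S\subseteq\mathbf S^{\mathrm{Max}}$. Moreover, $S^{\mathrm{LF}}=S^{\mathrm{Wsp}}$ for every countable treeable skeleton, so that the groups in 7 and 8 coincide. -/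

import Mathlib

namespace UltraIso

theorem perm_apply_inv {X : Type} (f : Equiv.Perm X) (x : X) : f (f⁻¹ x) = x :=
  f.apply_symm_apply x

/-! ### Ultrametric spaces and their isometry groups -/

section Spaces

/-- The isometry group carries the topology of pointwise convergence. -/
instance isoTopology (U : Type) [MetricSpace U] : TopologicalSpace (U ≃ᵢ U) :=
  TopologicalSpace.induced (fun (φ : U ≃ᵢ U) (x : U) => φ x) inferInstance

/-- `U` is a Polish ultrametric space: the metric is complete, second-countable and an
ultrametric. -/
structure IsPolishUltrametric (U : Type) [MetricSpace U] : Prop where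
  ultrametric : IsUltrametricDist U
  complete : CompleteSpace U
  secondCountable : SecondCountableTopology U

/-- The homogeneous component of `x`: its orbit under the isometry group. -/
def component {U : Type} [MetricSpace U] (x : U) : Set U :=
  {y | ∃ φ : U ≃ᵢ U, φ x = y}

/-- Every two homogeneous components have exact distance: the infimum of the distances between
their points is attained. -/
def IsExact (U : Type) [MetricSpace U] : Prop :=
  ∀ x y : U, ∃ x' ∈ component x, ∃ y' ∈ component y,
    dist x' y' = sInf (Set.image2 dist (component x) (component y))

/-- Uniform discreteness: some positive radius makes all open balls singletons. -/
def IsUniformlyDiscrete (U : Type) [MetricSpace U] : Prop :=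
  ∃ r : ℝ, 0 < r ∧ ∀ x : U, Metric.ball x r = {x}

end Spaces

/-! ### `L`-trees -/

section Trees

variable {T L : Type} [LE T] [LinearOrder L]

/-- `t|_ℓ = t'|_ℓ`: the nodes `t` and `t'` have the same node of level `ℓ` above them. -/
def AgreeAt (lev : T → L) (t t' : T) (ℓ : L) : Prop :=
  ∃ s, t ≤ s ∧ t' ≤ s ∧ lev s = ℓ

/-- `(T, ≤, lev)` is a weak `L`-tree. -/
structure IsWeakLTree (lev : T → L) : Prop where
  le_refl : ∀ t : T, t ≤ t
  le_trans : ∀ t t' t'' : T, t ≤ t' → t' ≤ t'' → t ≤ t''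
  le_antisymm : ∀ t t' : T, t ≤ t' → t' ≤ t → t = t'
  lev_surjective : Function.Surjective lev
  lev_lt : ∀ t t' : T, t ≤ t' → t ≠ t' → lev t < lev t'
  existsUnique_above : ∀ (t : T) (ℓ : L), lev t ≤ ℓ → ∃! t'' : T, t ≤ t'' ∧ lev t'' = ℓ
  exists_agree : ∀ t t' : T, ∃ ℓ, max (lev t) (lev t') ≤ ℓ ∧ AgreeAt lev t t' ℓ

/-- `(T, ≤, lev)` is an `L`-tree: for incomparable nodes there is a largest level at which they
still differ. -/
structure IsLTree (lev : T → L) : Prop extends IsWeakLTree lev where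
  exists_split : ∀ t t' : T, ¬ t ≤ t' → ¬ t' ≤ t →
    ∃ ℓ, IsGreatest {ℓ | max (lev t) (lev t') ≤ ℓ ∧ ¬ AgreeAt lev t t' ℓ} ℓ

/-- Every node lies on a branch, a branch being a monotone choice of one node in each level. -/
def IsPruned (lev : T → L) : Prop :=
  ∀ t : T, ∃ b : L → T,
    (∀ ℓ, lev (b ℓ) = ℓ) ∧ (∀ ℓ ℓ', ℓ ≤ ℓ' → b ℓ ≤ b ℓ') ∧ b (lev t) = t

/-- The automorphism group of `(T, ≤, lev)`. -/
def treeAut (lev : T → L) : Subgroup (Equiv.Perm T) where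
  carrier := {f | (∀ t, lev (f t) = lev t) ∧ ∀ t t', t ≤ t' ↔ f t ≤ f t'}
  mul_mem' := by
    rintro f g ⟨hf, hf'⟩ ⟨hg, hg'⟩
    refine ⟨fun t => ?_, fun t t' => ?_⟩
    · rw [Equiv.Perm.mul_apply, hf, hg]
    · rw [Equiv.Perm.mul_apply, Equiv.Perm.mul_apply, hg', hf']
  one_mem' := ⟨fun _ => rfl, fun _ _ => Iff.rfl⟩
  inv_mem' := by
    rintro f ⟨hf, hf'⟩
    refine ⟨fun t => ?_, fun t t' => ?_⟩
    · rw [← hf (f⁻¹ t), perm_apply_inv]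
    · rw [hf' (f⁻¹ t), perm_apply_inv, perm_apply_inv]

/-- Pointwise convergence, the set of nodes being discrete. -/
instance treeAutTopology (lev : T → L) : TopologicalSpace (treeAut lev) :=
  TopologicalSpace.induced (fun (f : treeAut lev) (t : T) => f.1 t)
    (@Pi.topologicalSpace T (fun _ => T) fun _ => ⊥)

/-- The equivalence relation "some automorphism maps `t` to `t'`". -/
def orbitSetoid (lev : T → L) : Setoid T where
  r t t' := ∃ f ∈ treeAut lev, f t = t'
  iseqv :=
    { refl := fun _ => ⟨1, one_mem _, rfl⟩
      symm := by
        rintro t t' ⟨f, hf, rfl⟩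
        exact ⟨f⁻¹, inv_mem hf, f.symm_apply_apply t⟩
      trans := by
        rintro t t' t'' ⟨f, hf, rfl⟩ ⟨g, hg, rfl⟩
        exact ⟨g * f, mul_mem hg hf, rfl⟩ }

/-- The nodes of the condensed tree. -/
def Condensed (lev : T → L) : Type := Quotient (orbitSetoid lev)

/-- The class `[t]` of a node. -/
def Condensed.mk (lev : T → L) (t : T) : Condensed lev := Quotient.mk (orbitSetoid lev) t

/-- `δ ≤ δ'` if and only if `t ≤ t'` for some `t ∈ δ` and `t' ∈ δ'`. -/
instance (lev : T → L) : LE (Condensed lev) where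
  le δ δ' := ∃ t t' : T, Condensed.mk lev t = δ ∧ Condensed.mk lev t' = δ' ∧ t ≤ t'

/-- The level function of the condensed tree. -/
def Condensed.lev (lev : T → L) : Condensed lev → L :=
  Quotient.lift lev (by rintro t t' ⟨f, hf, rfl⟩; exact (hf.1 t).symm)

/-- An `L`-tree is special if its condensed tree is an `L`-tree. -/
def IsSpecial (lev : T → L) : Prop := IsLTree (Condensed.lev lev)

/-- `C` is a proper upward closed chain. -/
structure IsProperUpperChain (C : Set T) : Prop where
  chain : ∀ t ∈ C, ∀ t' ∈ C, t ≤ t' ∨ t' ≤ t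
  upward_closed : ∀ t ∈ C, ∀ t', t ≤ t' → t' ∈ C
  proper : ∃ t, ∀ t' ∈ C, t ≤ t' ∧ t ≠ t'

/-- Property (⋆). -/
def HasStar (lev : T → L) : Prop :=
  ∀ C : Set T, IsProperUpperChain C → ∀ t : T,
    (∀ t' ∈ C, Condensed.mk lev t ≤ Condensed.mk lev t') →
      ∃ s : T, Condensed.mk lev s = Condensed.mk lev t ∧ ∀ t' ∈ C, s ≤ t'

end Trees

/-! ### Skeletons and generalized sequences

All skeletons below have labels `N δ ≤ ω`, and are given by a function `N : Δ → ℕ∞` on a partial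
order `Δ`; the label `N δ` stands for the set of all natural numbers below `N δ`. -/

section Sequences

variable {Δ : Type}

/-- The set `N δ`, i.e. `{0, …, N δ - 1}` or `ℕ`. -/
def Coord (N : Δ → ℕ∞) (δ : Δ) : Type := {n : ℕ // (n : ℕ∞) < N δ}

/-- The product of all sets `N δ`. -/
def GlobalSeq (N : Δ → ℕ∞) : Type := ∀ δ, Coord N δ

/-- The support of a sequence. -/
def supp {N : Δ → ℕ∞} (x : GlobalSeq N) : Set Δ := {δ | (x δ).1 ≠ 0}

variable [PartialOrder Δ]

/-- `⟨Δ, N⟩` is a countable skeleton that is treeable: `Δ` is a pruned `L`-tree for some linear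
order `L` and some level function. -/
structure IsCountableTreeable (N : Δ → ℕ∞) : Prop where
  nonempty : Nonempty Δ
  countable : Countable Δ
  label_ne_zero : ∀ δ, N δ ≠ 0
  treeable : ∃ (L : Type) (_ : LinearOrder L) (lev : Δ → L), IsLTree lev ∧ IsPruned lev

variable (N : Δ → ℕ∞)

/-- The product of the sets `N γ` over the cone `γ ≥ δ`. -/
def LocalSeq (δ : Δ) : Type := ∀ γ : Set.Ici δ, Coord N γ

variable {N}

/-- `x|_δ` -/
def GlobalSeq.restrict (x : GlobalSeq N) (δ : Δ) : LocalSeq N δ := fun γ => x γ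

/-- `z|_γ`, for `z` defined on the cone above `δ` and `γ ≥ δ`. -/
def LocalSeq.restrict {δ γ : Δ} (h : δ ≤ γ) (z : LocalSeq N δ) : LocalSeq N γ :=
  fun β => z ⟨β, h.trans β.2⟩

open Classical in
/-- `z^δ_i`: the value at the vertex `δ` of the cone is replaced by `i`. -/
noncomputable def LocalSeq.perturb {δ : Δ} (z : LocalSeq N δ) (i : Coord N δ) : LocalSeq N δ :=
  Function.update z ⟨δ, le_refl δ⟩ i

/-- The value at the vertex of the cone. -/
def LocalSeq.value {δ : Δ} (z : LocalSeq N δ) : Coord N δ := z ⟨δ, le_refl δ⟩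

/-- The topology `τ_Δ`, generated by the sets of all `y` with `y|_γ = x|_γ`. -/
instance tauTopology : TopologicalSpace (GlobalSeq N) :=
  TopologicalSpace.generateFrom {V | ∃ (x : GlobalSeq N) (γ : Δ), V = {y | y.restrict γ = x.restrict γ}}

/-- The supports satisfying the maximum condition: no strictly increasing infinite sequences. -/
def maxSupports (Δ : Type) [PartialOrder Δ] : Set (Set Δ) :=
  {A | ∀ f : ℕ → Δ, StrictMono f → ¬ ∀ n, f n ∈ A}

/-- The supports satisfying Malicki's condition: moreover, no strictly decreasing infinite
sequence has a lower bound in `Δ`. -/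
def wspSupports (Δ : Type) [PartialOrder Δ] : Set (Set Δ) :=
  {A | A ∈ maxSupports Δ ∧
    ∀ f : ℕ → Δ, StrictAnti f → (∀ n, f n ∈ A) → ¬ BddBelow (Set.range f)}

/-- The locally finite supports. -/
def lfSupports (Δ : Type) [PartialOrder Δ] : Set (Set Δ) :=
  {A | ∀ δ : Δ, (A ∩ Set.Ici δ).Finite}

end Sequences

/-! ### Wreath products over global domains -/

section Global

variable {Δ : Type} [PartialOrder Δ]

/-- A global domain: a set of sequences closed under pointwise perturbations. -/
structure GlobalDomain (N : Δ → ℕ∞) where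
  carrier : Set (GlobalSeq N)
  perturb : ∀ x ∈ carrier, ∀ (δ : Δ) (i : Coord N δ),
    ∃ y ∈ carrier, y δ = i ∧ ∀ γ, δ < γ → y γ = x γ

variable {N : Δ → ℕ∞}

/-- Condition (H1). -/
def CondH1 (S : GlobalDomain N) (g : Equiv.Perm S.carrier) : Prop :=
  ∀ (x y : S.carrier) (δ : Δ),
    x.1.restrict δ = y.1.restrict δ ↔ (g x).1.restrict δ = (g y).1.restrict δ

/-- Condition (H2) for full symmetric groups: for all `x` and `δ` and every choice of elements
`c i = x^δ_i` of the domain, the map `i ↦ g (x^δ_i) (δ)` is a permutation of `N δ`. -/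
def CondH2 (S : GlobalDomain N) (g : Equiv.Perm S.carrier) : Prop :=
  ∀ (x : S.carrier) (δ : Δ) (c : Coord N δ → S.carrier),
    (∀ i, (c i).1 δ = i ∧ ∀ γ, δ < γ → (c i).1 γ = x.1 γ) →
      Function.Bijective fun i => (g (c i)).1 δ

theorem restrict_eq_iff (x y : GlobalSeq N) (δ : Δ) :
    x.restrict δ = y.restrict δ ↔ ∀ γ, δ ≤ γ → x γ = y γ :=
  ⟨fun h γ hγ => congrFun h ⟨γ, hγ⟩, fun h => funext fun γ => h γ.1 γ.2⟩

theorem condH2_of_condH1 {S : GlobalDomain N} {g : Equiv.Perm S.carrier} (hg : CondH1 S g) :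
    CondH2 S g := by
  intro x δ c hc
  have key : ∀ y : S.carrier, (∀ γ, δ < γ → y.1 γ = x.1 γ) ↔
      ∀ γ, δ < γ → (g y).1 γ = (g x).1 γ := by
    intro y
    have aux : ∀ u v : GlobalSeq N, (∀ γ, δ < γ → u γ = v γ) ↔
        ∀ γ, δ < γ → u.restrict γ = v.restrict γ := fun u v =>
      ⟨fun h γ hγ => (restrict_eq_iff _ _ _).2 fun β hβ => h β (hγ.trans_le hβ),
        fun h γ hγ => (restrict_eq_iff _ _ _).1 (h γ hγ) γ le_rfl⟩
    rw [aux, aux]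
    exact forall_congr' fun γ => imp_congr_right fun _ => hg y x γ
  constructor
  · intro i j hij
    have h : (g (c i)).1.restrict δ = (g (c j)).1.restrict δ := by
      rw [restrict_eq_iff]
      intro γ hγ
      rcases hγ.eq_or_lt with rfl | hlt
      · exact hij
      · rw [(key (c i)).1 (hc i).2 γ hlt, (key (c j)).1 (hc j).2 γ hlt]
    have h' := (restrict_eq_iff _ _ _).1 ((hg _ _ _).2 h) δ le_rfl
    rwa [(hc i).1, (hc j).1] at h'
  · intro j
    obtain ⟨y, hy, hyj, hyγ⟩ := S.perturb (g x).1 (g x).2 δ j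
    set w : S.carrier := g.symm ⟨y, hy⟩ with hw
    have hgw : g w = ⟨y, hy⟩ := g.apply_symm_apply _
    have hwx : ∀ γ, δ < γ → w.1 γ = x.1 γ := (key w).2 (by rw [hgw]; exact hyγ)
    refine ⟨w.1 δ, ?_⟩
    have h : (c (w.1 δ)).1.restrict δ = w.1.restrict δ := by
      rw [restrict_eq_iff]
      intro γ hγ
      rcases hγ.eq_or_lt with rfl | hlt
      · exact (hc _).1
      · rw [(hc _).2 γ hlt, hwx γ hlt]
    have h' := (restrict_eq_iff _ _ _).1 ((hg _ _ _).1 h) δ le_rfl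
    rw [hgw] at h'
    exact h'.trans hyj

/-- The generalized wreath product of the full symmetric groups `Sym (N δ)` over the global
domain `S`. -/
def wreath (S : GlobalDomain N) : Subgroup (Equiv.Perm S.carrier) where
  carrier := {g | CondH1 S g ∧ CondH2 S g}
  mul_mem' := by
    rintro f g ⟨hf, -⟩ ⟨hg, -⟩
    have h : CondH1 S (f * g) := fun x y δ => (hg x y δ).trans (hf (g x) (g y) δ)
    exact ⟨h, condH2_of_condH1 h⟩
  one_mem' :=
    have h : CondH1 S 1 := fun _ _ _ => Iff.rfl
    ⟨h, condH2_of_condH1 h⟩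
  inv_mem' := by
    rintro f ⟨hf, -⟩
    have h : CondH1 S f⁻¹ := fun x y δ => by
      rw [hf (f⁻¹ x), perm_apply_inv, perm_apply_inv]
    exact ⟨h, condH2_of_condH1 h⟩

/-- Pointwise convergence with respect to the relative topology `τ_Δ` on `S`. -/
instance wreathTopology (S : GlobalDomain N) : TopologicalSpace (wreath S) :=
  TopologicalSpace.induced (fun (g : wreath S) (x : S.carrier) => g.1 x) inferInstance

/-- Approximate homogeneity of a global domain. -/
def GlobalDomain.IsApproxHomogeneous (S : GlobalDomain N) : Prop :=
  ∀ (x y : S.carrier) (δ : Δ), ∃ g ∈ wreath S, (g x).1.restrict δ = y.1.restrict δ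

/-- `S` consists of all sequences whose restrictions to the cones are restrictions of elements
of `S`. This implies that `S` is closed for `τ_Δ`, and is equivalent to it if `Δ` is linear. -/
def GlobalDomain.IsLocallyDetermined (S : GlobalDomain N) : Prop :=
  ∀ x : GlobalSeq N, (∀ γ : Δ, ∃ y ∈ S.carrier, x.restrict γ = y.restrict γ) → x ∈ S.carrier

open Classical in
/-- The domain of all sequences whose support belongs to a given family of admissible supports,
which has to be closed under changing finitely many elements. -/
def supportDomain (N : Δ → ℕ∞) (𝒜 : Set (Set Δ))
    (h𝒜 : ∀ A ∈ 𝒜, ∀ A' : Set Δ, (symmDiff A A').Finite → A' ∈ 𝒜) : GlobalDomain N where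
  carrier := {x | supp x ∈ 𝒜}
  perturb := by
    intro x hx δ i
    refine ⟨Function.update x δ i, ?_, Function.update_self .., fun γ hγ =>
      Function.update_of_ne hγ.ne' ..⟩
    refine h𝒜 _ hx _ ((Set.finite_singleton δ).subset fun γ hγ => ?_)
    by_contra hne
    have hne' : γ ≠ δ := hne
    have hval : (Function.update x δ i : GlobalSeq N) γ = x γ := Function.update_of_ne hne' ..
    have : γ ∈ supp x ↔ γ ∈ supp (Function.update x δ i : GlobalSeq N) := by
      change (x γ).1 ≠ 0 ↔ _ ≠ 0
      rw [hval]
    rcases hγ with ⟨h1, h2⟩ | ⟨h1, h2⟩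
    · exact h2 (this.1 h1)
    · exact h2 (this.2 h1)

theorem lfSupports_stable (A : Set Δ) (hA : A ∈ lfSupports Δ) (A' : Set Δ)
    (h : (symmDiff A A').Finite) : A' ∈ lfSupports Δ := by
  intro δ
  refine ((hA δ).union h).subset fun γ hγ => ?_
  by_cases hγA : γ ∈ A
  · exact Or.inl ⟨hγA, hγ.2⟩
  · exact Or.inr (Or.inr ⟨hγ.1, hγA⟩)

/-- An injective sequence in `A'` is eventually in `A` if `A` and `A'` differ finitely. -/
theorem exists_tail_mem {Δ : Type} {A A' : Set Δ} (h : (symmDiff A A').Finite) (f : ℕ → Δ)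
    (hf : Function.Injective f) (hfA : ∀ n, f n ∈ A') : ∃ m, ∀ n, f (n + m) ∈ A := by
  have hfin : (f ⁻¹' (symmDiff A A')).Finite := h.preimage hf.injOn
  obtain ⟨m, hm⟩ := hfin.bddAbove
  refine ⟨m + 1, fun n => ?_⟩
  by_contra hn
  have : n + (m + 1) ≤ m := hm (show f (n + (m + 1)) ∈ symmDiff A A' from
    Or.inr ⟨hfA _, hn⟩)
  omega

theorem wspSupports_stable (A : Set Δ) (hA : A ∈ wspSupports Δ) (A' : Set Δ)
    (h : (symmDiff A A').Finite) : A' ∈ wspSupports Δ := by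
  refine ⟨fun f hf hfA => ?_, fun f hf hfA hb => ?_⟩
  · obtain ⟨m, hm⟩ := exists_tail_mem h f hf.injective hfA
    exact hA.1 (fun n => f (n + m)) (fun a b hab => hf (by omega)) hm
  · obtain ⟨m, hm⟩ := exists_tail_mem h f hf.injective hfA
    refine hA.2 (fun n => f (n + m)) (fun a b hab => hf (by omega)) hm (hb.mono ?_)
    rintro _ ⟨n, rfl⟩
    exact ⟨n + m, rfl⟩

/-- The domain of the sequences with locally finite support. -/
def domainLF (N : Δ → ℕ∞) : GlobalDomain N :=
  supportDomain N (lfSupports Δ) lfSupports_stable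

/-- The domain of the sequences satisfying Malicki's condition. -/
def domainWsp (N : Δ → ℕ∞) : GlobalDomain N :=
  supportDomain N (wspSupports Δ) wspSupports_stable

end Global

/-! ### Projective wreath products and wreath products over local domains -/

section Projective

variable {Δ : Type} [PartialOrder Δ]

/-- A system of projections `⟨S, π⟩`. The family `S` is given by its pieces `S δ`, which
consist of sequences on the cone above `δ`. -/
structure ProjectionSystem (N : Δ → ℕ∞) where
  S : ∀ δ, Set (LocalSeq N δ)
  nonempty : ∀ δ, (S δ).Nonempty
  perturb_mem : ∀ δ, ∀ z ∈ S δ, ∀ i, z.perturb i ∈ S δ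
  proj : ∀ {δ γ : Δ}, δ ≤ γ → S δ → S γ
  proj_surjective : ∀ {δ γ : Δ} (h : δ ≤ γ), Function.Surjective (proj h)
  proj_eq_iff : ∀ {δ γ : Δ} (h : δ ≤ γ) (z z' : S δ),
    proj h z = proj h z' ↔ z.1.restrict h = z'.1.restrict h
  proj_comp : ∀ {δ γ β : Δ} (h : δ ≤ γ) (h' : γ ≤ β) (z : S δ),
    proj h' (proj h z) = proj (h.trans h') z

variable {N : Δ → ℕ∞}

/-- Condition (P1), for a permutation of the union of the sets `S δ` that maps each `S δ` onto
itself, given as the family of its restrictions. -/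
def CondP1 (P : ProjectionSystem N) (g : ∀ δ, Equiv.Perm (P.S δ)) : Prop :=
  ∀ (δ γ : Δ) (h : δ ≤ γ) (z : P.S δ), g γ (P.proj h z) = P.proj h (g δ z)

/-- Condition (P2) for full symmetric groups: `i ↦ g (z^δ_i) (δ)` is a permutation of `N δ`. -/
def CondP2 (P : ProjectionSystem N) (g : ∀ δ, Equiv.Perm (P.S δ)) : Prop :=
  ∀ (δ : Δ) (z : P.S δ),
    Function.Bijective fun i => (g δ ⟨z.1.perturb i, P.perturb_mem δ z.1 z.2 i⟩).1.value

theorem LocalSeq.value_perturb {δ : Δ} (z : LocalSeq N δ) (i : Coord N δ) :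
    (z.perturb i).value = i := by
  classical exact Function.update_self ..

theorem LocalSeq.perturb_apply {δ : Δ} (z : LocalSeq N δ) (i : Coord N δ) (γ : Set.Ici δ)
    (h : δ < γ.1) : z.perturb i γ = z γ := by
  classical exact Function.update_of_ne (fun h' => h.ne' (congrArg Subtype.val h')) ..

theorem LocalSeq.ext_lt {δ : Δ} {z w : LocalSeq N δ} (hv : z.value = w.value)
    (h : ∀ γ (hγ : δ < γ), z.restrict hγ.le = w.restrict hγ.le) : z = w := by
  funext ⟨γ, hγ⟩
  rcases (show δ ≤ γ from hγ).eq_or_lt with rfl | hlt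
  · exact hv
  · exact congrFun (h γ hlt) ⟨γ, le_refl γ⟩

theorem LocalSeq.perturb_restrict {δ γ : Δ} (z : LocalSeq N δ) (i : Coord N δ) (h : δ < γ) :
    (z.perturb i).restrict h.le = z.restrict h.le :=
  funext fun β => z.perturb_apply i _ (h.trans_le β.2)

theorem condP2_of_condP1 {P : ProjectionSystem N} {g : ∀ δ, Equiv.Perm (P.S δ)}
    (hg : CondP1 P g) : CondP2 P g := by
  intro δ z
  have key : ∀ (u v : P.S δ) (γ : Δ) (h : δ < γ), u.1.restrict h.le = v.1.restrict h.le ↔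
      (g δ u).1.restrict h.le = (g δ v).1.restrict h.le := by
    intro u v γ h
    rw [← P.proj_eq_iff, ← P.proj_eq_iff, ← hg, ← hg, (g γ).injective.eq_iff]
  constructor
  · intro i j hij
    have h := (g δ).injective (Subtype.ext (LocalSeq.ext_lt hij fun γ hγ =>
      (key _ _ γ hγ).1 ((LocalSeq.perturb_restrict _ _ hγ).trans (LocalSeq.perturb_restrict _ _ hγ).symm)))
    have h' := congrArg LocalSeq.value (congrArg Subtype.val h)
    rwa [LocalSeq.value_perturb, LocalSeq.value_perturb] at h'
  · intro j
    set y : P.S δ := ⟨(g δ z).1.perturb j, P.perturb_mem δ _ (g δ z).2 j⟩ with hy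
    set w : P.S δ := (g δ).symm y with hw
    have hgw : g δ w = y := (g δ).apply_symm_apply _
    have hwz : ∀ γ (hγ : δ < γ), w.1.restrict hγ.le = z.1.restrict hγ.le := fun γ hγ => by
      rw [key w z γ hγ, hgw]
      exact LocalSeq.perturb_restrict _ _ hγ
    refine ⟨w.1.value, ?_⟩
    have hwe : (⟨z.1.perturb w.1.value, P.perturb_mem δ z.1 z.2 _⟩ : P.S δ) = w := by
      refine Subtype.ext (LocalSeq.ext_lt (LocalSeq.value_perturb _ _) fun γ hγ => ?_)
      exact (LocalSeq.perturb_restrict _ _ hγ).trans (hwz γ hγ).symm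
    simp only [hwe, hgw]
    exact LocalSeq.value_perturb _ _

/-- The projective wreath product of the full symmetric groups `Sym (N δ)`. -/
def projWreath (P : ProjectionSystem N) : Subgroup (∀ δ, Equiv.Perm (P.S δ)) where
  carrier := {g | CondP1 P g ∧ CondP2 P g}
  mul_mem' := by
    rintro f g ⟨hf, -⟩ ⟨hg, -⟩
    have h : CondP1 P (f * g) := fun δ γ hδ z => by
      simp only [Pi.mul_apply, Equiv.Perm.mul_apply, hg δ γ hδ z, hf δ γ hδ]
    exact ⟨h, condP2_of_condP1 h⟩
  one_mem' :=
    have h : CondP1 P 1 := fun _ _ _ _ => rfl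
    ⟨h, condP2_of_condP1 h⟩
  inv_mem' := by
    rintro f ⟨hf, -⟩
    have h : CondP1 P f⁻¹ := fun δ γ hδ z => by
      rw [Pi.inv_apply, Pi.inv_apply, Equiv.Perm.inv_eq_iff_eq, hf, perm_apply_inv]
    exact ⟨h, condP2_of_condP1 h⟩

/-- Pointwise convergence, the union of the sets `S δ` being discrete. -/
instance projWreathTopology (P : ProjectionSystem N) : TopologicalSpace (projWreath P) :=
  TopologicalSpace.induced (fun (g : projWreath P) (p : Σ δ, P.S δ) =>
      (⟨p.1, g.1 p.1 p.2⟩ : Σ δ, P.S δ))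
    (@Pi.topologicalSpace (Σ δ, P.S δ) (fun _ => Σ δ, P.S δ) fun _ => ⊥)

/-- Countability of the union of the sets `S δ`. -/
def ProjectionSystem.IsCountable (P : ProjectionSystem N) : Prop := Countable (Σ δ, P.S δ)

/-- Local homogeneity of a system of projections. -/
def ProjectionSystem.IsLocallyHomogeneous (P : ProjectionSystem N) : Prop :=
  ∀ (δ : Δ) (z z' : P.S δ), ∃ g ∈ projWreath P, g δ z = z'

/-- Fullness: every `z ∈ S δ₀` belongs to a coherent family. -/
def ProjectionSystem.IsFull (P : ProjectionSystem N) : Prop :=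
  ∀ (δ₀ : Δ) (z : P.S δ₀), ∃ c : ∀ δ, P.S δ,
    c δ₀ = z ∧ ∀ (δ γ : Δ) (h : δ ≤ γ), P.proj h (c δ) = c γ

/-- Every element is a restriction of a sequence satisfying the maximum condition. -/
def SubsetMax (S : ∀ δ, Set (LocalSeq N δ)) : Prop :=
  ∀ δ, ∀ z ∈ S δ, ∃ x : GlobalSeq N, supp x ∈ maxSupports Δ ∧ x.restrict δ = z

/-- A family of local domains. -/
structure LocalDomains (N : Δ → ℕ∞) where
  S : ∀ δ, Set (LocalSeq N δ)
  nonempty : ∀ δ, (S δ).Nonempty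
  restrict_eq : ∀ {δ γ : Δ} (h : δ ≤ γ), S γ = LocalSeq.restrict h '' S δ
  perturb_mem : ∀ δ, ∀ z ∈ S δ, ∀ i, z.perturb i ∈ S δ

/-- A family of local domains with the trivial projections, i.e. the restrictions. -/
def LocalDomains.toProjectionSystem (D : LocalDomains N) : ProjectionSystem N where
  S := D.S
  nonempty := D.nonempty
  perturb_mem := D.perturb_mem
  proj := fun h z => ⟨z.1.restrict h, by rw [D.restrict_eq h]; exact ⟨z.1, z.2, rfl⟩⟩
  proj_surjective := by
    rintro δ γ h ⟨w, hw⟩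
    obtain ⟨z, hz, rfl⟩ := D.restrict_eq h ▸ hw
    exact ⟨⟨z, hz⟩, rfl⟩
  proj_eq_iff := fun _ _ _ => Subtype.ext_iff
  proj_comp := fun _ _ _ => rfl

/-- The generalized wreath product of the full symmetric groups `Sym (N δ)` over a family of local
domains: coherence is preservation of restrictions. -/
abbrev localWreath (D : LocalDomains N) := projWreath D.toProjectionSystem

/-- Countability of a family of local domains. -/
def LocalDomains.IsCountable (D : LocalDomains N) : Prop := Countable (Σ δ, D.S δ)

/-- Local homogeneity of a family of local domains. -/
def LocalDomains.IsLocallyHomogeneous (D : LocalDomains N) : Prop :=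
  ∀ (δ : Δ) (z z' : D.S δ), ∃ g ∈ localWreath D, g δ z = z'

/-- Fullness: every element of the family is a restriction of a sequence whose restrictions to
the cones all belong to the family. -/
def LocalDomains.IsFull (D : LocalDomains N) : Prop :=
  ∀ (δ₀ : Δ), ∀ z ∈ D.S δ₀, ∃ x : GlobalSeq N,
    x.restrict δ₀ = z ∧ ∀ γ, x.restrict γ ∈ D.S γ

end Projective

end UltraIso

/-!
The balls of an exact ultrametric space form a tree on which the isometries act, and exactness
becomes property (⋆) of this tree. The radii may range over any countable set containing all
distances together with arbitrarily large numbers and enough small ones: one of order type `ℚ` in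
general, one with a minimum if the space is uniformly discrete.

In a tree with (⋆), every node lies on a section of the condensation map. Cover the tree by
countably many sections, and label the siblings of each node by natural numbers so that `0` marks
the sibling on the first section that passes through them. Among the nodes above a fixed node `t`,
those with nonzero labels have different first sections, none of them later than a section through
`t`, so they are finite in number. This identifies the nodes with the restrictions of the sequences
of locally finite support over the condensed tree, and the automorphism group with a wreath product.

Conversely, the elements of a countable locally homogeneous full system of projections are the nodes
of a tree, and two nodes are given a distance that encodes the set of levels at which they differ.
Replacing each node by a rigid fibre that depends only on its class, and is either discrete or a
Cantor space, yields an ultrametric space whose isometries are the elements of the wreath product.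
Fullness makes the space exact: two classes realise their distance along one thread of projections.
-/

namespace UltraIso

/-! ### Weak trees -/

section WeakTrees

variable {T L : Type} [LE T] [LinearOrder L] {lev : T → L}

theorem IsWeakLTree.lev_mono (h : IsWeakLTree lev) {t t' : T} (htt : t ≤ t') :
    lev t ≤ lev t' := by
  by_cases hne : t = t'
  · rw [hne]
  · exact (h.lev_lt t t' htt hne).le

theorem IsWeakLTree.le_of_lev_le (h : IsWeakLTree lev) {t s s' : T} (hs : t ≤ s) (hs' : t ≤ s')
    (hl : lev s ≤ lev s') : s ≤ s' := by
  obtain ⟨u, ⟨hu, hul⟩, -⟩ := h.existsUnique_above s _ hl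
  have hus' : u = s' := (h.existsUnique_above t (lev s') (h.lev_mono hs')).unique
    ⟨h.le_trans _ _ _ hs hu, hul⟩ ⟨hs', rfl⟩
  exact hus' ▸ hu

theorem IsWeakLTree.eq_of_lev_eq (h : IsWeakLTree lev) {t s s' : T} (hs : t ≤ s) (hs' : t ≤ s')
    (hl : lev s = lev s') : s = s' :=
  h.le_antisymm _ _ (h.le_of_lev_le hs hs' hl.le) (h.le_of_lev_le hs' hs hl.ge)

theorem IsWeakLTree.le_total_of_le (h : IsWeakLTree lev) {t s s' : T} (hs : t ≤ s)
    (hs' : t ≤ s') : s ≤ s' ∨ s' ≤ s :=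
  (le_total (lev s) (lev s')).imp (h.le_of_lev_le hs hs') (h.le_of_lev_le hs' hs)

end WeakTrees

/-! ### Supports -/

section Supports

variable {Δ : Type} [PartialOrder Δ]

theorem lfSupports_subset_maxSupports : lfSupports Δ ⊆ maxSupports Δ := fun A hA f hf hfA =>
  Set.infinite_of_injective_forall_mem (s := A ∩ Set.Ici (f 0)) hf.injective
    (fun n => ⟨hfA n, hf.monotone (Nat.zero_le n)⟩) (hA (f 0))

theorem lfSupports_subset_wspSupports : lfSupports Δ ⊆ wspSupports Δ := by
  refine fun A hA => ⟨lfSupports_subset_maxSupports hA, ?_⟩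
  rintro f hf hfA ⟨δ, hδ⟩
  exact Set.infinite_of_injective_forall_mem (s := A ∩ Set.Ici δ) hf.injective
    (fun n => ⟨hfA n, hδ ⟨n, rfl⟩⟩) (hA δ)

theorem wspSupports_subset_lfSupports (hchain : ∀ δ : Δ, IsChain (· ≤ ·) (Set.Ici δ)) :
    wspSupports Δ ⊆ lfSupports Δ := by
  rintro A ⟨hmax, hmin⟩ δ
  by_contra hinf
  let f := Set.Infinite.natEmbedding _ hinf
  have hf_inj : Function.Injective fun n => (f n).1 := Subtype.val_injective.comp f.injective
  obtain ⟨g, hincr | hnonincr⟩ :=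
    exists_increasing_or_nonincreasing_subseq (· < ·) fun n => (f n).1
  · exact hmax (fun n => f (g n)) (fun m n => hincr m n) fun n => (f (g n)).2.1
  · have hanti : StrictAnti fun n => (f (g n)).1 := fun m n hmn => by
      have hne : (f (g m)).1 ≠ f (g n) := (hf_inj.comp g.injective).ne hmn.ne
      rcases hchain δ (f (g m)).2.2 (f (g n)).2.2 hne with h | h
      · exact absurd (h.lt_of_ne hne) (hnonincr m n hmn)
      · exact h.lt_of_ne hne.symm
    refine hmin _ hanti (fun n => (f (g n)).2.1) ⟨δ, ?_⟩
    rintro _ ⟨n, rfl⟩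
    exact (f (g n)).2.2

theorem IsCountableTreeable.isChain_Ici {N : Δ → ℕ∞} (hN : IsCountableTreeable N) (δ : Δ) :
    IsChain (· ≤ ·) (Set.Ici δ) := by
  obtain ⟨L, _, lev, hT, -⟩ := hN.treeable
  exact fun _ h _ h' _ => hT.le_total_of_le h h'

theorem domainLF_eq_domainWsp {N : Δ → ℕ∞} (hN : IsCountableTreeable N) :
    domainLF N = domainWsp N := by
  have h : lfSupports Δ = wspSupports Δ :=
    lfSupports_subset_wspSupports.antisymm (wspSupports_subset_lfSupports hN.isChain_Ici)
  simp only [domainLF, domainWsp, supportDomain, h]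

end Supports

/-! ### Topologies of pointwise convergence -/

section Continuity

variable {X : Type*} [TopologicalSpace X]

theorem continuous_treeAut_iff {T L : Type} [LE T] {lev : T → L}
    {k : X → treeAut lev} : Continuous k ↔ ∀ t s, IsOpen {x | (k x).1 t = s} := by
  let _ : TopologicalSpace T := ⊥
  have : DiscreteTopology T := ⟨rfl⟩
  exact continuous_induced_rng.trans (continuous_pi_iff.trans
    (forall_congr' fun _ => continuous_discrete_rng))

variable {Δ : Type} [PartialOrder Δ] {N : Δ → ℕ∞}

theorem continuous_projWreath_iff {P : ProjectionSystem N} {k : X → projWreath P} :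
    Continuous k ↔ ∀ δ (z w : P.S δ), IsOpen {x | (k x).1 δ z = w} := by
  let _ : TopologicalSpace (Σ δ, P.S δ) := ⊥
  have : DiscreteTopology (Σ δ, P.S δ) := ⟨rfl⟩
  have hopen : Continuous k ↔
      ∀ p q : Σ δ, P.S δ, IsOpen {x | (⟨p.1, (k x).1 p.1 p.2⟩ : Σ δ, P.S δ) = q} :=
    continuous_induced_rng.trans (continuous_pi_iff.trans
      (forall_congr' fun _ => continuous_discrete_rng))
  refine hopen.trans ⟨fun h δ z w => by simpa using h ⟨δ, z⟩ ⟨δ, w⟩, fun h => ?_⟩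
  rintro ⟨δ, z⟩ ⟨γ, w⟩
  by_cases hγ : δ = γ
  · subst hγ
    simpa using h δ z w
  · simp [hγ]

theorem isOpen_restrict_eq (w : GlobalSeq N) (γ : Δ) :
    IsOpen {y : GlobalSeq N | y.restrict γ = w.restrict γ} :=
  TopologicalSpace.isOpen_generateFrom_of_mem ⟨w, γ, rfl⟩

theorem continuous_wreath_iff {S : GlobalDomain N} {k : X → wreath S} :
    Continuous k ↔ ∀ (x : S.carrier) (w : GlobalSeq N) (γ : Δ),
      IsOpen {a | ((k a).1 x).1.restrict γ = w.restrict γ} := by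
  refine continuous_induced_rng.trans (continuous_pi_iff.trans (forall_congr' fun x => ?_))
  refine continuous_induced_rng.trans (continuous_generateFrom_iff.trans ?_)
  exact ⟨fun h w γ => h _ ⟨w, γ, rfl⟩, by rintro h _ ⟨w, γ, rfl⟩; exact h w γ⟩

theorem continuous_isometryEquiv_iff {U : Type} [MetricSpace U] {k : X → (U ≃ᵢ U)} :
    Continuous k ↔ ∀ u, Continuous fun x => k x u :=
  continuous_induced_rng.trans continuous_pi_iff

end Continuity

/-! ### Locally determined global domains -/

theorem exists_perm_semiconj {X Y : Type*} {π : X → Y} (hπ : Function.Surjective π)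
    (g : Equiv.Perm X) (hg : ∀ x y, π x = π y ↔ π (g x) = π (g y)) :
    ∃ f : Equiv.Perm Y, ∀ x, f (π x) = π (g x) := by
  let f : Y → Y := fun y => π (g (Function.surjInv hπ y))
  have hf : ∀ x, f (π x) = π (g x) := fun x => (hg _ _).1 (Function.surjInv_eq hπ _)
  refine ⟨Equiv.ofBijective f ⟨hπ.forall₂.2 fun x y hxy => ?_, hπ.forall.2 fun x => ?_⟩, hf⟩
  · rwa [hf, hf, ← hg] at hxy
  · exact ⟨π (g.symm x), by rw [hf, g.apply_symm_apply]⟩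

section LocallyDetermined

variable {Δ : Type} [PartialOrder Δ] {N : Δ → ℕ∞}

theorem GlobalSeq.ext_restrict {x y : GlobalSeq N} (h : ∀ δ, x.restrict δ = y.restrict δ) :
    x = y :=
  funext fun δ => congrFun (h δ) ⟨δ, le_refl δ⟩

theorem LocalDomains.IsFull.toProjectionSystem {D : LocalDomains N} (hD : D.IsFull) :
    D.toProjectionSystem.IsFull := by
  intro δ z
  obtain ⟨x, hx, hx'⟩ := hD δ z.1 z.2
  exact ⟨fun γ => ⟨x.restrict γ, hx' γ⟩, Subtype.ext hx, fun _ _ _ => rfl⟩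

namespace GlobalDomain

variable {S : GlobalDomain N}

theorem IsLocallyDetermined.isClosed (hld : S.IsLocallyDetermined) : IsClosed S.carrier := by
  refine ⟨isOpen_iff_forall_mem_open.2 fun x hx => ?_⟩
  obtain ⟨γ, hγ⟩ : ∃ γ, ∀ y ∈ S.carrier, x.restrict γ ≠ y.restrict γ := by
    by_contra! h
    exact hx (hld x h)
  exact ⟨_, fun y hy hyS => hγ y hyS hy.symm, isOpen_restrict_eq x γ, rfl⟩

/-- The family of local domains consisting of the restrictions of the elements of a global
domain. -/
def localDomains (S : GlobalDomain N) (hS : S.carrier.Nonempty) : LocalDomains N where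
  S δ := (fun x => x.restrict δ) '' S.carrier
  nonempty _ := hS.image _
  restrict_eq h := by rw [Set.image_image]; rfl
  perturb_mem := by
    rintro δ _ ⟨x, hx, rfl⟩ i
    obtain ⟨y, hy, hi, hγ⟩ := S.perturb x hx δ i
    refine ⟨y, hy, LocalSeq.ext_lt ?_ fun γ hlt => ?_⟩
    · rw [LocalSeq.value_perturb]
      exact hi
    · rw [LocalSeq.perturb_restrict _ _ hlt]
      exact funext fun β => hγ _ (hlt.trans_le β.2)

variable (hS : S.carrier.Nonempty)

theorem localDomains_isFull : (S.localDomains hS).IsFull := by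
  rintro δ _ ⟨x, hx, rfl⟩
  exact ⟨x, rfl, fun γ => ⟨x, hx, rfl⟩⟩

/-- The restrictions of the elements of a global domain, with the trivial projections. -/
abbrev projections (S : GlobalDomain N) (hS : S.carrier.Nonempty) : ProjectionSystem N :=
  (S.localDomains hS).toProjectionSystem

variable (S) in
/-- The restriction of an element of a global domain, as an element of the local domain. -/
def res (δ : Δ) (x : S.carrier) : (S.projections hS).S δ := ⟨x.1.restrict δ, x.1, x.2, rfl⟩

theorem res_surjective (δ : Δ) : Function.Surjective (S.res hS δ) := by
  rintro ⟨_, x, hx, rfl⟩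
  exact ⟨⟨x, hx⟩, rfl⟩

variable {hS} in
theorem res_eq_iff {x y : S.carrier} {δ : Δ} :
    S.res hS δ x = S.res hS δ y ↔ x.1.restrict δ = y.1.restrict δ :=
  Subtype.ext_iff

theorem ext_res {x y : S.carrier} (h : ∀ δ, S.res hS δ x = S.res hS δ y) : x = y :=
  Subtype.ext (GlobalSeq.ext_restrict fun δ => res_eq_iff.1 (h δ))

theorem localDomains_isCountable [Countable Δ] [TopologicalSpace.SeparableSpace S.carrier] :
    (S.localDomains hS).IsCountable := by
  obtain ⟨Q, hQ, hdense⟩ := TopologicalSpace.exists_countable_dense S.carrier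
  have := hQ.to_subtype
  have (δ : Δ) : Countable ((S.projections hS).S δ) := by
    refine Function.Surjective.countable (f := fun q : Q => S.res hS δ q)
      ((res_surjective hS δ).forall.2 fun x => ?_)
    obtain ⟨q, hqx, hq⟩ := hdense.inter_open_nonempty _
      ((isOpen_restrict_eq x.1 δ).preimage continuous_subtype_val) ⟨x, rfl⟩
    exact ⟨⟨q, hq⟩, res_eq_iff.2 hqx⟩
  exact inferInstanceAs (Countable (Σ δ, (S.projections hS).S δ))

theorem exists_localWreath_of_mem_wreath {g : Equiv.Perm S.carrier} (hg : g ∈ wreath S) :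
    ∃ f : projWreath (S.projections hS), ∀ δ x, f.1 δ (S.res hS δ x) = S.res hS δ (g x) := by
  choose f hf using fun δ => exists_perm_semiconj (res_surjective hS δ) g
    fun x y => by rw [res_eq_iff, res_eq_iff, hg.1]
  have hP1 : CondP1 (S.projections hS) f := fun δ γ h =>
    (res_surjective hS δ).forall.2 fun x =>
      (hf γ x).trans (congrArg ((S.projections hS).proj h) (hf δ x).symm)
  exact ⟨⟨f, hP1, condP2_of_condP1 hP1⟩, hf⟩

theorem IsApproxHomogeneous.localDomains (hah : S.IsApproxHomogeneous) :
    (S.localDomains hS).IsLocallyHomogeneous := fun δ =>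
  (res_surjective hS δ).forall₂.2 fun x y => by
    obtain ⟨g, hg, hgx⟩ := hah x y δ
    obtain ⟨f, hf⟩ := exists_localWreath_of_mem_wreath hS hg
    exact ⟨f, f.2, (hf δ x).trans (res_eq_iff.2 hgx)⟩

variable {hS}

/-- The image of `x` under an element of the local wreath product: its value at `δ` is read off at
the vertex of the image of the restriction of `x` to the cone above `δ`. -/
def glue (f : projWreath (S.projections hS)) (x : S.carrier) : GlobalSeq N :=
  fun δ => (f.1 δ (S.res hS δ x)).1.value

theorem glue_restrict (f : projWreath (S.projections hS)) (x : S.carrier) (δ : Δ) :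
    (glue f x).restrict δ = (f.1 δ (S.res hS δ x)).1 := by
  funext ⟨γ, hγ⟩
  exact congrFun (congrArg Subtype.val (f.2.1 δ γ hγ (S.res hS δ x))) ⟨γ, le_refl γ⟩

theorem glue_mem (hld : S.IsLocallyDetermined) (f : projWreath (S.projections hS))
    (x : S.carrier) : glue f x ∈ S.carrier := by
  refine hld _ fun γ => ?_
  obtain ⟨y, hy, hyx⟩ := (f.1 γ (S.res hS γ x)).2
  exact ⟨y, hy, (glue_restrict f x γ).trans hyx.symm⟩

theorem res_glue (hld : S.IsLocallyDetermined) (f : projWreath (S.projections hS))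
    (x : S.carrier) (δ : Δ) : S.res hS δ ⟨glue f x, glue_mem hld f x⟩ = f.1 δ (S.res hS δ x) :=
  Subtype.ext (glue_restrict f x δ)

/-- Gluing as an action of the local wreath product on a locally determined global domain. -/
def gluePerm (hld : S.IsLocallyDetermined) (f : projWreath (S.projections hS)) :
    Equiv.Perm S.carrier where
  toFun x := ⟨glue f x, glue_mem hld f x⟩
  invFun x := ⟨glue f⁻¹ x, glue_mem hld f⁻¹ x⟩
  left_inv x := ext_res hS fun δ => by
    rw [res_glue hld, res_glue hld]
    exact (f.1 δ).symm_apply_apply _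
  right_inv x := ext_res hS fun δ => by
    rw [res_glue hld, res_glue hld]
    exact (f.1 δ).apply_symm_apply _

theorem res_gluePerm (hld : S.IsLocallyDetermined) (f : projWreath (S.projections hS))
    (δ : Δ) (x : S.carrier) : S.res hS δ (gluePerm hld f x) = f.1 δ (S.res hS δ x) :=
  res_glue hld f x δ

theorem gluePerm_mem (hld : S.IsLocallyDetermined) (f : projWreath (S.projections hS)) :
    gluePerm hld f ∈ wreath S := by
  have h : CondH1 S (gluePerm hld f) := fun x y δ => by
    rw [← res_eq_iff (hS := hS), ← res_eq_iff (hS := hS), res_gluePerm, res_gluePerm,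
      (f.1 δ).injective.eq_iff]
  exact ⟨h, condH2_of_condH1 h⟩

/-- `gluePerm` as a homomorphism into the wreath product over the global domain. -/
def glueHom (hld : S.IsLocallyDetermined) : projWreath (S.projections hS) →* wreath S where
  toFun f := ⟨gluePerm hld f, gluePerm_mem hld f⟩
  map_one' := Subtype.ext <| Equiv.ext fun x => ext_res hS fun δ => res_gluePerm hld 1 δ x
  map_mul' f g := Subtype.ext <| Equiv.ext fun x => ext_res hS fun δ => by
    rw [res_gluePerm]
    exact ((res_gluePerm hld f δ _).trans (congrArg (f.1 δ) (res_gluePerm hld g δ x))).symm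

theorem glueHom_bijective (hld : S.IsLocallyDetermined) :
    Function.Bijective (glueHom (hS := hS) hld) := by
  constructor
  · refine fun f g hfg => Subtype.ext <| funext fun δ => Equiv.ext <|
      (res_surjective hS δ).forall.2 fun x => ?_
    rw [← res_gluePerm hld, ← res_gluePerm hld]
    exact congrArg (fun k : wreath S => S.res hS δ (k.1 x)) hfg
  · intro g
    obtain ⟨f, hf⟩ := exists_localWreath_of_mem_wreath hS g.2
    exact ⟨f, Subtype.ext <| Equiv.ext fun x => ext_res hS fun δ =>
      (res_gluePerm hld f δ x).trans (hf δ x)⟩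

theorem continuous_glueHom (hld : S.IsLocallyDetermined) :
    Continuous (glueHom (hS := hS) hld) := by
  refine continuous_wreath_iff.2 fun x w γ => ?_
  by_cases h : ∃ y ∈ S.carrier, y.restrict γ = w.restrict γ
  · obtain ⟨y, hy, hyw⟩ := h
    convert continuous_projWreath_iff.1 continuous_id γ (S.res hS γ x) (S.res hS γ ⟨y, hy⟩)
      using 1
    ext f
    change _ = _ ↔ f.1 γ (S.res hS γ x) = _
    rw [← res_gluePerm hld, res_eq_iff, ← hyw]
    rfl
  · convert isOpen_empty
    exact Set.eq_empty_of_forall_notMem fun f hf => h ⟨_, Subtype.prop _, hf⟩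

theorem nonempty_localWreath_continuousMulEquiv (hld : S.IsLocallyDetermined) :
    Nonempty (projWreath (S.projections hS) ≃ₜ* wreath S) := by
  let e := MulEquiv.ofBijective (glueHom (hS := hS) hld) (glueHom_bijective hld)
  have hres (g : wreath S) (δ : Δ) (x : S.carrier) :
      (e.symm g).1 δ (S.res hS δ x) = S.res hS δ (g.1 x) :=
    (res_gluePerm hld _ δ x).symm.trans
      (congrArg (fun k : wreath S => S.res hS δ (k.1 x)) (e.apply_symm_apply g))
  refine ⟨{ e with
    continuous_toFun := continuous_glueHom hld
    continuous_invFun := continuous_projWreath_iff.2 fun δ =>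
      (res_surjective hS δ).forall₂.2 fun x y => ?_ }⟩
  convert continuous_wreath_iff.1 continuous_id x y.1 δ using 3
  exact (Eq.congr_left (hres _ δ x)).trans res_eq_iff

end GlobalDomain

end LocallyDetermined

/-! ### Sequences with locally finite support -/

section LocallyFinite

variable {Δ : Type} [PartialOrder Δ]

theorem mem_lfSupports_of_subset_union {A B C : Set Δ} (hA : A ∈ lfSupports Δ)
    (hB : B ∈ lfSupports Δ) (hC : C ⊆ A ∪ B) : C ∈ lfSupports Δ := fun δ =>
  ((hA δ).union (hB δ)).subset fun _ hγ => (hC hγ.1).imp (⟨·, hγ.2⟩) (⟨·, hγ.2⟩)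

variable {N : Δ → ℕ∞}

theorem domainLF_isLocallyDetermined : (domainLF N).IsLocallyDetermined := by
  intro x hx δ
  obtain ⟨y, hy, hxy⟩ := hx δ
  refine (hy δ).subset fun γ hγ => ⟨?_, hγ.2⟩
  have hγxy : x γ = y γ := congrFun hxy ⟨γ, hγ.2⟩
  exact fun h => hγ.1 ((congrArg Subtype.val hγxy).trans h)

theorem piCongrRight_mem_domainLF {p : ∀ δ, Equiv.Perm (Coord N δ)}
    (hp : {δ | p δ ≠ 1} ∈ lfSupports Δ) {x : GlobalSeq N} (hx : x ∈ (domainLF N).carrier) :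
    Equiv.piCongrRight p x ∈ (domainLF N).carrier := by
  refine mem_lfSupports_of_subset_union hx hp fun γ hγ => ?_
  by_contra! h
  obtain ⟨hx0, hp1⟩ : (x γ).1 = 0 ∧ p γ = 1 := by simpa [supp] using h
  rw [← Equiv.Perm.one_apply (x γ), ← hp1] at hx0
  exact hγ hx0

theorem exists_mem_wreath_domainLF {p : ∀ δ, Equiv.Perm (Coord N δ)}
    (hp : {δ | p δ ≠ 1} ∈ lfSupports Δ) :
    ∃ g ∈ wreath (domainLF N), ∀ x δ, (g x).1 δ = p δ (x.1 δ) := by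
  have hp' : {δ | (p δ)⁻¹ ≠ 1} ∈ lfSupports Δ := by simpa only [ne_eq, inv_eq_one] using hp
  let g : Equiv.Perm (domainLF N).carrier := (Equiv.piCongrRight p).subtypeEquiv fun x =>
    ⟨piCongrRight_mem_domainLF hp, fun hx =>
      (Equiv.piCongrRight p).symm_apply_apply x ▸ piCongrRight_mem_domainLF hp' hx⟩
  have hg : CondH1 (domainLF N) g := fun x y δ => by
    rw [restrict_eq_iff, restrict_eq_iff]
    exact forall₂_congr fun γ _ => (p γ).injective.eq_iff.symm
  exact ⟨g, ⟨hg, condH2_of_condH1 hg⟩, fun _ _ => rfl⟩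

theorem domainLF_isApproxHomogeneous : (domainLF N).IsApproxHomogeneous := by
  classical
  intro x y δ
  let p : ∀ γ, Equiv.Perm (Coord N γ) := fun γ =>
    @Equiv.swap _ (Classical.decEq _) (x.1 γ) (y.1 γ)
  have hp : {γ | p γ ≠ 1} ∈ lfSupports Δ := by
    refine mem_lfSupports_of_subset_union x.2 y.2 fun γ hγ => ?_
    by_contra! h
    obtain ⟨hx0, hy0⟩ : (x.1 γ).1 = 0 ∧ (y.1 γ).1 = 0 := by simpa [supp] using h
    have hxy : x.1 γ = y.1 γ := Subtype.ext (hx0.trans hy0.symm)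
    exact hγ (by simp [p, hxy, Equiv.Perm.one_def])
  obtain ⟨g, hg, hgp⟩ := exists_mem_wreath_domainLF hp
  exact ⟨g, hg, funext fun γ => (hgp x γ).trans (Equiv.swap_apply_left _ _)⟩

/-- The sequence that vanishes everywhere. -/
def zeroSeq (hN : ∀ δ, N δ ≠ 0) : GlobalSeq N := fun δ => ⟨0, pos_iff_ne_zero.2 (hN δ)⟩

theorem zeroSeq_mem_domainLF (hN : ∀ δ, N δ ≠ 0) : zeroSeq hN ∈ (domainLF N).carrier := fun _ =>
  Set.finite_empty.subset fun _ hγ => hγ.1 rfl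

theorem countable_finite_supp {Δ : Type} {N : Δ → ℕ∞} [Countable Δ] :
    {x : GlobalSeq N | (supp x).Finite}.Countable := by
  let k : {x : GlobalSeq N | (supp x).Finite} → (Δ →₀ ℕ) := fun x =>
    Finsupp.ofSupportFinite (fun δ => (x.1 δ).1) x.2
  refine Set.countable_coe_iff.1 (Function.Injective.countable (f := k) fun x y hxy => ?_)
  exact Subtype.ext <| funext fun δ => Subtype.ext (DFunLike.congr_fun hxy δ)

theorem exists_finite_supp_restrict_eq (hN : ∀ δ, N δ ≠ 0) {x : GlobalSeq N}
    (hx : supp x ∈ lfSupports Δ) {F : Set Δ} (hF : F.Finite) :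
    ∃ y : GlobalSeq N, (supp y).Finite ∧ ∀ δ ∈ F, y.restrict δ = x.restrict δ := by
  classical
  let A : Set Δ := ⋃ δ ∈ F, supp x ∩ Set.Ici δ
  have hA : A.Finite := hF.biUnion fun δ _ => hx δ
  let y : GlobalSeq N := fun γ => if γ ∈ A then x γ else zeroSeq hN γ
  refine ⟨y, hA.subset fun γ hγ => ?_, fun δ hδ => (restrict_eq_iff _ _ _).2 fun γ hγ => ?_⟩
  · by_contra h
    exact hγ (by simp [y, h, zeroSeq])
  · by_cases hγx : γ ∈ supp x
    · exact if_pos (Set.mem_biUnion (t := fun δ => supp x ∩ Set.Ici δ) hδ ⟨hγx, hγ⟩)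
    · have hx0 : x γ = zeroSeq hN γ := Subtype.ext (not_not.1 hγx)
      simp only [y, hx0, ite_self]

theorem domainLF_separable [Countable Δ] (hN : ∀ δ, N δ ≠ 0) :
    TopologicalSpace.SeparableSpace (domainLF N).carrier := by
  refine ⟨{x | (supp x.1).Finite}, countable_finite_supp.preimage Subtype.val_injective, ?_⟩
  have hbasis := (TopologicalSpace.isTopologicalBasis_of_subbasis
    (rfl : (tauTopology : TopologicalSpace (GlobalSeq N)) = _)).induced
      (Subtype.val : (domainLF N).carrier → _)
  refine hbasis.dense_iff.2 ?_
  rintro _ ⟨_, ⟨f, ⟨hf, hfs⟩, rfl⟩, rfl⟩ ⟨x, hx⟩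
  choose w γ hwγ using hfs
  have := hf.to_subtype
  obtain ⟨y, hy, hyx⟩ := exists_finite_supp_restrict_eq hN x.2
    (Set.finite_range fun V : f => γ V.2)
  refine ⟨⟨y, fun δ => hy.subset Set.inter_subset_left⟩, fun V hV => ?_, hy⟩
  have hxV := hx V hV
  rw [hwγ hV] at hxV ⊢
  exact (hyx _ ⟨⟨V, hV⟩, rfl⟩).trans hxV

theorem subsetMax_localDomains_domainLF (hS : (domainLF N).carrier.Nonempty) :
    SubsetMax ((domainLF N).localDomains hS).S := by
  rintro δ _ ⟨x, hx, rfl⟩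
  exact ⟨x, lfSupports_subset_maxSupports hx, rfl⟩

end LocallyFinite

/-! ### Condensed trees -/

section CondensedTrees

variable {T L : Type} [LE T] {lev : T → L}

namespace Condensed

theorem mk_eq_iff {t t' : T} : mk lev t = mk lev t' ↔ ∃ f ∈ treeAut lev, f t = t' :=
  Quotient.eq (r := orbitSetoid lev)

theorem mk_surjective : Function.Surjective (mk lev) := Quotient.exists_rep

theorem mk_apply {f : Equiv.Perm T} (hf : f ∈ treeAut lev) (t : T) : mk lev (f t) = mk lev t :=
  (mk_eq_iff.2 ⟨f, hf, rfl⟩).symm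

theorem mk_le_mk {t t' : T} (h : t ≤ t') : mk lev t ≤ mk lev t' := ⟨t, t', rfl, rfl, h⟩

theorem mk_le_iff {t t' : T} : mk lev t ≤ mk lev t' ↔ ∃ f ∈ treeAut lev, f t ≤ t' := by
  constructor
  · rintro ⟨a, b, ha, hb, hab⟩
    obtain ⟨f, hf, rfl⟩ := mk_eq_iff.1 ha
    obtain ⟨g, hg, rfl⟩ := mk_eq_iff.1 hb
    refine ⟨g * f⁻¹, mul_mem hg (inv_mem hf), ?_⟩
    rw [Equiv.Perm.mul_apply, show f⁻¹ (f a) = a from f.symm_apply_apply a]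
    exact (hg.2 a b).1 hab
  · rintro ⟨f, hf, h⟩
    exact mk_apply hf t ▸ mk_le_mk h

theorem exists_ge {t : T} {δ : Condensed lev} (h : mk lev t ≤ δ) :
    ∃ s, t ≤ s ∧ mk lev s = δ := by
  obtain ⟨t', rfl⟩ := mk_surjective δ
  obtain ⟨f, hf, hft⟩ := mk_le_iff.1 h
  refine ⟨f⁻¹ t', ?_, mk_apply (inv_mem hf) t'⟩
  rwa [hf.2, perm_apply_inv]

theorem exists_le {t : T} {δ : Condensed lev} (h : δ ≤ mk lev t) :
    ∃ s, s ≤ t ∧ mk lev s = δ := by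
  obtain ⟨t', rfl⟩ := mk_surjective δ
  obtain ⟨f, hf, hft⟩ := mk_le_iff.1 h
  exact ⟨f t', hft, mk_apply hf t'⟩

end Condensed

variable [LinearOrder L]

theorem IsWeakLTree.condensed (h : IsWeakLTree lev) : IsWeakLTree (Condensed.lev lev) where
  le_refl := Condensed.mk_surjective.forall.2 fun t => Condensed.mk_le_mk (h.le_refl t)
  le_trans δ δ' δ'' h₁ h₂ := by
    obtain ⟨t, rfl⟩ := Condensed.mk_surjective δ
    obtain ⟨s, hts, rfl⟩ := Condensed.exists_ge h₁
    obtain ⟨u, hsu, rfl⟩ := Condensed.exists_ge h₂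
    exact Condensed.mk_le_mk (h.le_trans _ _ _ hts hsu)
  le_antisymm δ δ' h₁ h₂ := by
    obtain ⟨t, rfl⟩ := Condensed.mk_surjective δ
    obtain ⟨s, hts, rfl⟩ := Condensed.exists_ge h₁
    obtain ⟨u, hsu, hut⟩ := Condensed.exists_ge h₂
    have hlev : lev u = lev t := congrArg (Condensed.lev lev) hut
    rw [h.eq_of_lev_eq (h.le_refl t) hts ((h.lev_mono hts).antisymm (hlev ▸ h.lev_mono hsu))]
  lev_surjective ℓ := by
    obtain ⟨t, rfl⟩ := h.lev_surjective ℓ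
    exact ⟨Condensed.mk lev t, rfl⟩
  lev_lt δ δ' hle hne := by
    obtain ⟨t, rfl⟩ := Condensed.mk_surjective δ
    obtain ⟨s, hts, rfl⟩ := Condensed.exists_ge hle
    exact h.lev_lt t s hts fun hts_eq => hne (hts_eq ▸ rfl)
  existsUnique_above δ ℓ hℓ := by
    obtain ⟨t, rfl⟩ := Condensed.mk_surjective δ
    obtain ⟨s, ⟨hts, rfl⟩, -⟩ := h.existsUnique_above t ℓ hℓ
    refine ⟨Condensed.mk lev s, ⟨Condensed.mk_le_mk hts, rfl⟩, ?_⟩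
    rintro δ' ⟨hle, hlev⟩
    obtain ⟨u, htu, rfl⟩ := Condensed.exists_ge hle
    rw [h.eq_of_lev_eq htu hts hlev]
  exists_agree := Condensed.mk_surjective.forall₂.2 fun t t' => by
    obtain ⟨ℓ, hℓ, s, hts, ht's, rfl⟩ := h.exists_agree t t'
    exact ⟨_, hℓ, Condensed.mk lev s, Condensed.mk_le_mk hts, Condensed.mk_le_mk ht's, rfl⟩

/-- By (⋆), the class of `t'` contains a node `s` that is below every node above `t` whose class is
above the class of `t'`. Then `t` and `s` agree exactly where their classes agree. -/
theorem HasStar.exists_agreeAt_iff (hstar : HasStar lev) (h : IsWeakLTree lev) {t t' : T}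
    (hle : ¬ Condensed.mk lev t' ≤ Condensed.mk lev t) :
    ∃ s, Condensed.mk lev s = Condensed.mk lev t' ∧
      ∀ ℓ, AgreeAt (Condensed.lev lev) (Condensed.mk lev t) (Condensed.mk lev s) ℓ ↔
        AgreeAt lev t s ℓ := by
  let C : Set T := {c | t ≤ c ∧ Condensed.mk lev t' ≤ Condensed.mk lev c}
  have hC : IsProperUpperChain C :=
    { chain := fun c hc d hd => h.le_total_of_le hc.1 hd.1
      upward_closed := fun c hc d hcd => ⟨h.le_trans _ _ _ hc.1 hcd,
        h.condensed.le_trans _ _ _ hc.2 (Condensed.mk_le_mk hcd)⟩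
      proper := ⟨t, fun c hc => ⟨hc.1, fun htc => hle (htc ▸ hc.2)⟩⟩ }
  obtain ⟨s, hst', hs⟩ := hstar C hC t' fun c hc => hc.2
  refine ⟨s, hst', fun ℓ => ⟨?_, ?_⟩⟩
  · rintro ⟨γ, htγ, hsγ, rfl⟩
    obtain ⟨c, htc, rfl⟩ := Condensed.exists_ge htγ
    exact ⟨c, htc, hs c ⟨htc, hst' ▸ hsγ⟩, rfl⟩
  · rintro ⟨c, htc, hsc, rfl⟩
    exact ⟨Condensed.mk lev c, Condensed.mk_le_mk htc, Condensed.mk_le_mk hsc, rfl⟩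

theorem IsLTree.isSpecial (h : IsLTree lev) (hstar : HasStar lev) : IsSpecial lev := by
  refine ⟨h.toIsWeakLTree.condensed, Condensed.mk_surjective.forall₂.2 fun t t' hle hle' => ?_⟩
  obtain ⟨s, hst', hagree⟩ := hstar.exists_agreeAt_iff h.toIsWeakLTree hle'
  rw [← hst'] at hle hle' ⊢
  obtain ⟨ℓ, hℓ⟩ := h.exists_split t s (fun hts => hle (Condensed.mk_le_mk hts))
    fun hst => hle' (Condensed.mk_le_mk hst)
  simp only [hagree]
  exact ⟨ℓ, hℓ⟩

theorem IsPruned.condensed (h : IsPruned lev) : IsPruned (Condensed.lev lev) :=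
  Condensed.mk_surjective.forall.2 fun t => by
    obtain ⟨b, hb, hmono, hbt⟩ := h t
    exact ⟨fun ℓ => Condensed.mk lev (b ℓ), hb,
      fun ℓ ℓ' hle => Condensed.mk_le_mk (hmono ℓ ℓ' hle), congrArg _ hbt⟩

end CondensedTrees

/-! ### The tree of balls of an ultrametric space -/

section BallTree

variable {U L : Type} [MetricSpace U]

/-- A family of radii, indexed by `L`, that is rich enough to recover the space `U` from its open
balls with these radii. -/
structure IsScale [LinearOrder L] (U : Type) [MetricSpace U] (e : L → ℝ) : Prop where
  strictMono : StrictMono e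
  pos : ∀ ℓ, 0 < e ℓ
  exists_eq_dist : ∀ x y : U, x ≠ y → ∃ ℓ, e ℓ = dist x y
  exists_dist_lt : ∀ x y : U, ∃ ℓ, dist x y < e ℓ
  exists_ball_subset : ∀ ε : ℝ, 0 < ε → ∃ ℓ, ∀ x : U, Metric.ball x (e ℓ) ⊆ Metric.ball x ε

variable {e : L → ℝ}

theorem IsScale.dist_le_dist [LinearOrder L] (he : IsScale U e) {x y x' y' : U}
    (h : ∀ ℓ, dist x' y' < e ℓ → dist x y < e ℓ) : dist x y ≤ dist x' y' := by
  by_contra! hlt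
  obtain ⟨ℓ, hℓ⟩ := he.exists_eq_dist x y (dist_pos.1 (dist_nonneg.trans_lt hlt))
  exact (h ℓ (hℓ ▸ hlt)).ne' hℓ

variable (U e) in
/-- The nodes of the tree of balls: the open balls with radii `e ℓ`. The index `ℓ` is part of the
node, since a ball may have several radii. -/
def BallNode : Type := {p : L × Set U // ∃ x, p.2 = Metric.ball x (e p.1)}

namespace BallNode

instance [LinearOrder L] : LE (BallNode U e) where
  le s t := s.1.1 ≤ t.1.1 ∧ s.1.2 ⊆ t.1.2

/-- The level of a ball in the tree of balls: the index of its radius. -/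
def lev (t : BallNode U e) : L := t.1.1

variable (e) in
/-- The ball with centre `x` and radius `e ℓ`, as a node of the tree of balls. -/
def node (x : U) (ℓ : L) : BallNode U e := ⟨(ℓ, Metric.ball x (e ℓ)), x, rfl⟩

theorem exists_eq_node (t : BallNode U e) : ∃ x, t = node e x t.lev :=
  let ⟨x, hx⟩ := t.2
  ⟨x, Subtype.ext (Prod.ext rfl hx)⟩

theorem forall_node {p : BallNode U e → Prop} (h : ∀ x ℓ, p (node e x ℓ)) (t : BallNode U e) :
    p t := by
  obtain ⟨x, hx⟩ := t.exists_eq_node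
  exact hx ▸ h x _

/-- The action of an isometry on the balls. -/
def map (e : L → ℝ) (φ : U ≃ᵢ U) : Equiv.Perm (BallNode U e) where
  toFun t := ⟨(t.1.1, φ '' t.1.2), by
    obtain ⟨x, hx⟩ := t.2
    exact ⟨φ x, by rw [hx, φ.image_ball]⟩⟩
  invFun t := ⟨(t.1.1, φ.symm '' t.1.2), by
    obtain ⟨x, hx⟩ := t.2
    exact ⟨φ.symm x, by rw [hx, φ.symm.image_ball]⟩⟩
  left_inv t := Subtype.ext (Prod.ext rfl (φ.toEquiv.symm_image_image _))
  right_inv t := Subtype.ext (Prod.ext rfl (φ.symm.toEquiv.symm_image_image _))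

theorem map_node (φ : U ≃ᵢ U) (x : U) (ℓ : L) : map e φ (node e x ℓ) = node e (φ x) ℓ :=
  Subtype.ext (Prod.ext rfl (φ.image_ball x _))

variable [LinearOrder L] [IsUltrametricDist U] (he : IsScale U e)

include he

theorem node_le_iff {x y : U} {ℓ ℓ' : L} :
    node e x ℓ ≤ node e y ℓ' ↔ ℓ ≤ ℓ' ∧ dist x y < e ℓ' := by
  refine and_congr_right fun hℓ => ⟨fun h => h (Metric.mem_ball_self (he.pos ℓ)), fun h => ?_⟩
  change Metric.ball x (e ℓ) ⊆ Metric.ball y (e ℓ')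
  rw [IsUltrametricDist.ball_eq_of_mem (Metric.mem_ball.2 h)]
  exact Metric.ball_subset_ball (he.strictMono.monotone hℓ)

theorem node_le_node (x : U) {ℓ ℓ' : L} (h : ℓ ≤ ℓ') : node e x ℓ ≤ node e x ℓ' :=
  (node_le_iff he).2 ⟨h, by simpa only [dist_self] using he.pos ℓ'⟩

theorem node_eq_iff {x y : U} {ℓ : L} : node e x ℓ = node e y ℓ ↔ dist x y < e ℓ := by
  refine ⟨fun h => ((node_le_iff he).1 (h.subst (node_le_node he x le_rfl))).2, fun h => ?_⟩
  exact Subtype.ext (Prod.ext rfl (IsUltrametricDist.ball_eq_of_mem (Metric.mem_ball.2 h)).symm)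

theorem eq_of_forall_node_eq {x y : U} (h : ∀ ℓ, node e x ℓ = node e y ℓ) : x = y :=
  dist_le_zero.1 <| (he.dist_le_dist fun ℓ _ => (node_eq_iff he).1 (h ℓ)).trans_eq (dist_self x)

theorem agreeAt_iff {x y : U} {ℓ ℓ' k : L} (hk : max ℓ ℓ' ≤ k) :
    AgreeAt lev (node e x ℓ) (node e y ℓ') k ↔ dist x y < e k := by
  constructor
  · rintro ⟨s, hx, hy, rfl⟩
    obtain ⟨w, hw⟩ := s.exists_eq_node
    rw [hw, node_le_iff he] at hx hy
    exact (dist_triangle_max x w y).trans_lt (max_lt hx.2 (dist_comm y w ▸ hy.2))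
  · intro h
    exact ⟨node e y k, (node_le_iff he).2 ⟨(le_max_left _ _).trans hk, h⟩,
      node_le_node he y ((le_max_right _ _).trans hk), rfl⟩

theorem isWeakLTree [Nonempty U] : IsWeakLTree (lev : BallNode U e → L) where
  le_refl t := ⟨le_rfl, Set.Subset.rfl⟩
  le_trans t t' t'' h h' := ⟨h.1.trans h'.1, h.2.trans h'.2⟩
  le_antisymm t t' h h' := Subtype.ext (Prod.ext (h.1.antisymm h'.1) (h.2.antisymm h'.2))
  lev_surjective ℓ := ⟨node e (Classical.arbitrary U) ℓ, rfl⟩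
  lev_lt := forall_node fun x ℓ => forall_node fun y ℓ' hle hne => by
    obtain ⟨hℓ, hxy⟩ := (node_le_iff he).1 hle
    refine lt_of_le_of_ne hℓ ?_
    rintro rfl
    exact hne ((node_eq_iff he).2 hxy)
  existsUnique_above := forall_node fun x ℓ k hk => by
    refine ⟨node e x k, ⟨node_le_node he x hk, rfl⟩, ?_⟩
    rintro s ⟨hs, rfl⟩
    obtain ⟨y, hy⟩ := s.exists_eq_node
    rw [hy, node_le_iff he] at hs
    exact hy.trans ((node_eq_iff he).2 hs.2).symm
  exists_agree := forall_node fun x ℓ => forall_node fun y ℓ' => by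
    obtain ⟨k, hk⟩ := he.exists_dist_lt x y
    refine ⟨max (max ℓ ℓ') k, le_max_left _ _, (agreeAt_iff he (le_max_left _ _)).2 ?_⟩
    exact hk.trans_le (he.strictMono.monotone (le_max_right _ _))

theorem isLTree [Nonempty U] : IsLTree (lev : BallNode U e → L) where
  toIsWeakLTree := isWeakLTree he
  exists_split := forall_node fun x ℓ => forall_node fun y ℓ' hle hle' => by
    rw [node_le_iff he, not_and, not_lt] at hle hle'
    have hdist : e (max ℓ ℓ') ≤ dist x y := by
      rcases le_total ℓ ℓ' with h | h
      · rw [max_eq_right h]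
        exact hle h
      · rw [max_eq_left h, dist_comm]
        exact hle' h
    obtain ⟨k, hk⟩ := he.exists_eq_dist x y (dist_pos.1 ((he.pos _).trans_le hdist))
    have hmax : max ℓ ℓ' ≤ k := he.strictMono.le_iff_le.1 (hk ▸ hdist)
    refine ⟨k, ⟨hmax, fun hagree => ?_⟩, ?_⟩
    · exact (((agreeAt_iff he hmax).1 hagree).trans_eq hk).false
    · rintro j ⟨hj, hdiff⟩
      rw [agreeAt_iff he (ℓ := ℓ) (ℓ' := ℓ') hj, not_lt, ← hk] at hdiff
      exact he.strictMono.le_iff_le.1 hdiff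

theorem isPruned : IsPruned (lev : BallNode U e → L) :=
  forall_node fun x _ => ⟨fun k => node e x k, fun _ => rfl, fun _ _ h => node_le_node he x h, rfl⟩

theorem countable [Countable L] [TopologicalSpace.SeparableSpace U] :
    Countable (BallNode U e) := by
  obtain ⟨Q, hQ, hdense⟩ := TopologicalSpace.exists_countable_dense U
  have := hQ.to_subtype
  refine Function.Surjective.countable (f := fun p : Q × L => node e p.1.1 p.2) <|
    forall_node fun x ℓ => ?_
  obtain ⟨q, hq, hxq⟩ := hdense.exists_dist_lt x (he.pos ℓ)
  exact ⟨(⟨q, hq⟩, ℓ), (node_eq_iff he).2 (by rwa [dist_comm])⟩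

theorem map_mem (φ : U ≃ᵢ U) : map e φ ∈ treeAut (lev : BallNode U e → L) :=
  ⟨fun _ => rfl, forall_node fun x ℓ => forall_node fun y ℓ' => by
    rw [map_node, map_node, node_le_iff he, node_le_iff he, φ.dist_eq]⟩

/-- The action of isometries on balls, as a homomorphism. -/
def mapHom : (U ≃ᵢ U) →* treeAut (lev : BallNode U e → L) where
  toFun φ := ⟨map e φ, map_mem he φ⟩
  map_one' := Subtype.ext <| Equiv.ext <| forall_node fun x ℓ => map_node 1 x ℓ
  map_mul' φ ψ := Subtype.ext <| Equiv.ext <| forall_node fun x ℓ => by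
    change map e (φ * ψ) _ = map e φ (map e ψ _)
    simp only [map_node, IsometryEquiv.mul_apply]

theorem exists_forall_dist_lt [Nonempty U] [CompleteSpace U] {y : L → U}
    (hy : ∀ ℓ ℓ', ℓ ≤ ℓ' → dist (y ℓ) (y ℓ') < e ℓ') : ∃ a, ∀ ℓ, dist (y ℓ) a < e ℓ := by
  have : Nonempty L := ⟨(he.exists_dist_lt (Classical.arbitrary U) (Classical.arbitrary U)).choose⟩
  have hcauchy : Cauchy (Filter.map y Filter.atBot) := by
    refine Metric.cauchy_iff.2 ⟨inferInstance, fun ε hε => ?_⟩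
    obtain ⟨k, hk⟩ := he.exists_ball_subset ε hε
    refine ⟨y '' Set.Iic k, Filter.image_mem_map (Filter.Iic_mem_atBot k), ?_⟩
    rintro _ ⟨ℓ, hℓ, rfl⟩ _ ⟨ℓ', hℓ', rfl⟩
    refine hk (y ℓ') (Metric.mem_ball.2 ?_)
    exact (dist_triangle_max _ (y k) _).trans_lt
      (max_lt (hy _ _ hℓ) (dist_comm (y ℓ') _ ▸ hy _ _ hℓ'))
  obtain ⟨a, ha⟩ := CompleteSpace.complete hcauchy
  refine ⟨a, fun ℓ => ?_⟩
  have hev : ∀ᶠ k in Filter.atBot, dist (y k) a < e ℓ :=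
    (Metric.tendsto_nhds (f := Filter.atBot) (u := y)).1 ha _ (he.pos ℓ)
  obtain ⟨k, hk, hkℓ⟩ := (hev.and (Filter.Iic_mem_atBot ℓ)).exists
  exact (dist_triangle_max _ (y k) _).trans_lt (max_lt (dist_comm (y k) _ ▸ hy _ _ hkℓ) hk)

theorem exists_forall_apply_node_eq [Nonempty U] [CompleteSpace U] {f : Equiv.Perm (BallNode U e)}
    (hf : f ∈ treeAut (lev : BallNode U e → L)) (x : U) :
    ∃ a, ∀ ℓ, f (node e x ℓ) = node e a ℓ := by
  have hnode (ℓ : L) : ∃ y, f (node e x ℓ) = node e y ℓ := by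
    simpa only [hf.1] using! (f (node e x ℓ)).exists_eq_node
  choose y hy using hnode
  obtain ⟨a, ha⟩ := exists_forall_dist_lt he (y := y) fun ℓ ℓ' hle => by
    have hle' := (hf.2 _ _).1 (node_le_node he x hle)
    rw [hy, hy, node_le_iff he] at hle'
    exact hle'.2
  exact ⟨a, fun ℓ => (hy ℓ).trans ((node_eq_iff he).2 (ha ℓ))⟩

theorem exists_map_eq [Nonempty U] [CompleteSpace U] {f : Equiv.Perm (BallNode U e)}
    (hf : f ∈ treeAut (lev : BallNode U e → L)) : ∃ φ, map e φ = f := by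
  choose a ha using exists_forall_apply_node_eq he hf
  choose b hb using exists_forall_apply_node_eq he (inv_mem hf)
  have hab (x : U) : a (b x) = x := eq_of_forall_node_eq he fun ℓ => by
    rw [← ha, ← hb, perm_apply_inv]
  have hba (x : U) : b (a x) = x := eq_of_forall_node_eq he fun ℓ => by
    rw [← hb, ← ha]
    exact f.symm_apply_apply _
  have hdist (x y : U) (ℓ : L) : dist (a x) (a y) < e ℓ ↔ dist x y < e ℓ := by
    rw [← node_eq_iff he, ← node_eq_iff he, ← ha, ← ha, f.injective.eq_iff]
  refine ⟨⟨⟨a, b, hba, hab⟩, Isometry.of_dist_eq fun x y => le_antisymm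
    (he.dist_le_dist fun ℓ => (hdist x y ℓ).2) (he.dist_le_dist fun ℓ => (hdist x y ℓ).1)⟩, ?_⟩
  exact Equiv.ext <| forall_node fun x ℓ => (map_node _ _ _).trans (ha x ℓ).symm

theorem mapHom_bijective [Nonempty U] [CompleteSpace U] : Function.Bijective (mapHom he) := by
  constructor
  · intro φ ψ h
    refine IsometryEquiv.ext fun x => eq_of_forall_node_eq he fun ℓ => ?_
    rw [← map_node, ← map_node]
    exact congrArg (fun k : treeAut (lev : BallNode U e → L) => k.1 (node e x ℓ)) h
  · rintro ⟨f, hf⟩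
    obtain ⟨φ, hφ⟩ := exists_map_eq he hf
    exact ⟨φ, Subtype.ext hφ⟩

theorem continuous_mapHom : Continuous (mapHom he) := by
  refine continuous_treeAut_iff.2 <| forall_node fun x ℓ t => isOpen_iff_forall_mem_open.2 ?_
  intro φ hφ
  refine ⟨{ψ | dist (ψ x) (φ x) < e ℓ}, fun ψ hψ => Eq.trans ?_ hφ, ?_,
    by simpa using he.pos ℓ⟩
  · change map e ψ (node e x ℓ) = map e φ (node e x ℓ)
    rw [map_node, map_node, node_eq_iff he]
    exact hψ
  · exact isOpen_lt ((continuous_isometryEquiv_iff.1 continuous_id x).dist continuous_const)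
      continuous_const

theorem nonempty_isometryEquiv_continuousMulEquiv [Nonempty U] [CompleteSpace U] :
    Nonempty ((U ≃ᵢ U) ≃ₜ* treeAut (lev : BallNode U e → L)) := by
  let E := MulEquiv.ofBijective (mapHom he) (mapHom_bijective he)
  have hmap (f : treeAut (lev : BallNode U e → L)) : map e (E.symm f) = f.1 :=
    congrArg Subtype.val (E.apply_symm_apply f)
  refine ⟨{ E with
    continuous_toFun := continuous_mapHom he
    continuous_invFun := continuous_isometryEquiv_iff.2 fun x =>
      Metric.continuous_iff'.2 fun f ε hε => ?_ }⟩
  obtain ⟨ℓ, hℓ⟩ := he.exists_ball_subset ε hε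
  have hopen : IsOpen {g : treeAut (lev : BallNode U e → L) |
      g.1 (node e x ℓ) = f.1 (node e x ℓ)} :=
    continuous_treeAut_iff.1 continuous_id _ _
  filter_upwards [hopen.mem_nhds rfl] with g hg
  refine hℓ _ (Metric.mem_ball.2 ((node_eq_iff he).1 ?_))
  change node e (E.symm g x) ℓ = node e (E.symm f x) ℓ
  rw [← map_node, ← map_node, hmap, hmap]
  exact hg

/-- If the distance of the components of `x` and `y` is attained at `φ x` and `ψ y`, then
`φ⁻¹ ψ y` lies in all balls containing `x` that meet the component of `y`. -/
theorem hasStar [Nonempty U] [CompleteSpace U] (hex : IsExact U) :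
    HasStar (lev : BallNode U e → L) := by
  rintro C ⟨-, -, u, hu⟩ t ht
  obtain ⟨x, hx⟩ := u.exists_eq_node
  obtain ⟨y, hy⟩ := t.exists_eq_node
  obtain ⟨_, ⟨φ, rfl⟩, _, ⟨ψ, rfl⟩, hmin⟩ := hex x y
  have hle (χ : U ≃ᵢ U) : dist (φ x) (ψ y) ≤ dist x (χ y) := hmin ▸
    csInf_le ⟨0, by rintro _ ⟨a, -, b, -, rfl⟩; exact dist_nonneg⟩ ⟨x, ⟨1, rfl⟩, χ y, ⟨χ, rfl⟩, rfl⟩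
  refine ⟨map e (ψ.trans φ.symm) t, Condensed.mk_apply (map_mem he _) t, fun c hc => ?_⟩
  obtain ⟨w, hw⟩ := c.exists_eq_node
  obtain ⟨f, hf, hfle⟩ := Condensed.mk_le_iff.1 (ht _ hc)
  obtain ⟨χ, rfl⟩ := exists_map_eq he hf
  have hxw := (hu c hc).1
  rw [hx, hw, node_le_iff he] at hxw
  rw [hy, hw, map_node, node_le_iff he] at hfle ⊢
  refine ⟨hfle.1, (dist_triangle_max _ x _).trans_lt (max_lt ?_ hxw.2)⟩
  calc dist (φ.symm (ψ y)) x = dist (φ x) (ψ y) := by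
        rw [← φ.dist_eq, φ.apply_symm_apply, dist_comm]
    _ ≤ dist x (χ y) := hle χ
    _ ≤ max (dist x w) (dist w (χ y)) := dist_triangle_max _ _ _
    _ < e c.lev := max_lt hxw.2 (dist_comm w _ ▸ hfle.2)

end BallNode

end BallTree

/-! ### A strictly monotone mass of sets of levels -/

section GeomMass

variable {α : Type*} [Encodable α] {s t : Set α}

/-- The sum of the weights `2⁻ⁿ` of the elements of `s`, where `n` is the code of the element. It
encodes lower sets of a countable linear order by real numbers. -/
noncomputable def geomMass (s : Set α) : ℝ :=
  ∑' a, s.indicator (fun a => (1 / 2 : ℝ) ^ Encodable.encode a) a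

theorem summable_geomMass (s : Set α) :
    Summable (s.indicator fun a => (1 / 2 : ℝ) ^ Encodable.encode a) :=
  summable_geometric_two_encode.indicator _

theorem geomMass_nonneg (s : Set α) : 0 ≤ geomMass s :=
  tsum_nonneg fun a => Set.indicator_nonneg (fun a _ => by positivity) a

theorem geomMass_mono (h : s ⊆ t) : geomMass s ≤ geomMass t :=
  (summable_geomMass s).tsum_le_tsum
    (Set.indicator_le_indicator_of_subset h fun a => by positivity) (summable_geomMass t)

theorem geomMass_strictMono : StrictMono (geomMass : Set α → ℝ) := by
  intro s t hst
  obtain ⟨a, hat, has⟩ := Set.exists_of_ssubset hst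
  refine (summable_geomMass s).tsum_lt_tsum (i := a)
    (Set.indicator_le_indicator_of_subset hst.subset fun a => by positivity) ?_
    (summable_geomMass t)
  rw [Set.indicator_of_notMem has, Set.indicator_of_mem hat]
  positivity

theorem geomMass_injOn_isLowerSet [LinearOrder α] :
    Set.InjOn (geomMass : Set α → ℝ) {s | IsLowerSet s} := by
  intro s hs t ht h
  rcases hs.total ht with hle | hle
  · exact hle.eq_of_not_lt fun hlt => (geomMass_strictMono hlt).ne h
  · exact (hle.eq_of_not_lt fun hlt => (geomMass_strictMono hlt).ne' h).symm

end GeomMass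

/-! ### Systems of projections as trees -/

section Joins

variable {Δ : Type} [PartialOrder Δ] {N : Δ → ℕ∞}

namespace ProjectionSystem

theorem proj_self (P : ProjectionSystem N) {δ : Δ} (h : δ ≤ δ) (z : P.S δ) : P.proj h z = z :=
  Subtype.ext ((P.proj_eq_iff h _ _).1 (P.proj_comp h h z))

/-- The projections to `γ` of the two elements of the system exist and coincide. -/
def Joins (P : ProjectionSystem N) (p q : Σ δ, P.S δ) (γ : Δ) : Prop :=
  ∃ (h : p.1 ≤ γ) (h' : q.1 ≤ γ), P.proj h p.2 = P.proj h' q.2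

/-- The levels at which two elements of the system, seen as nodes of a tree ordered by the
projections, have no common upper bound. -/
def disagree {L : Type} (P : ProjectionSystem N) (lev : Δ → L) (p q : Σ δ, P.S δ) : Set L :=
  {ℓ | ¬ ∃ γ, lev γ = ℓ ∧ P.Joins p q γ}

variable {L : Type} {P : ProjectionSystem N} {lev : Δ → L} {p q r : Σ δ, P.S δ} {γ : Δ}

theorem Joins.symm (h : P.Joins p q γ) : P.Joins q p γ :=
  ⟨h.2.1, h.1, h.2.2.symm⟩

theorem Joins.mono {γ' : Δ} (h : P.Joins p q γ) (hγ : γ ≤ γ') : P.Joins p q γ' := by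
  obtain ⟨h₁, h₂, h₃⟩ := h
  refine ⟨h₁.trans hγ, h₂.trans hγ, ?_⟩
  rw [← P.proj_comp h₁ hγ, h₃, P.proj_comp]

theorem Joins.trans (h : P.Joins p q γ) (h' : P.Joins q r γ) : P.Joins p r γ :=
  ⟨h.1, h'.2.1, h.2.2.trans h'.2.2⟩

theorem joins_sigmaCongrRight_iff {g : ∀ δ, Equiv.Perm (P.S δ)} (hg : CondP1 P g) :
    P.Joins (Equiv.sigmaCongrRight g p) (Equiv.sigmaCongrRight g q) γ ↔ P.Joins p q γ := by
  obtain ⟨δ, z⟩ := p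
  obtain ⟨β, w⟩ := q
  refine exists_congr fun (h : δ ≤ γ) => exists_congr fun (h' : β ≤ γ) => ?_
  change P.proj h (g δ z) = P.proj h' (g β w) ↔ P.proj h z = P.proj h' w
  rw [← hg, ← hg, (g γ).injective.eq_iff]

theorem disagree_comm (p q : Σ δ, P.S δ) : P.disagree lev p q = P.disagree lev q p :=
  Set.ext fun _ => not_congr <| exists_congr fun _ =>
    and_congr_right fun _ => ⟨Joins.symm, Joins.symm⟩

variable [LinearOrder L]

theorem disagree_isLowerSet (hT : IsWeakLTree lev) (p q : Σ δ, P.S δ) :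
    IsLowerSet (P.disagree lev p q) := by
  rintro ℓ ℓ' hle hℓ ⟨γ, rfl, hγ⟩
  obtain ⟨γ', ⟨hγγ', hlev⟩, -⟩ := hT.existsUnique_above γ ℓ hle
  exact hℓ ⟨γ', hlev, hγ.mono hγγ'⟩

theorem lev_notMem_disagree_iff (hT : IsWeakLTree lev) {w : P.S γ} :
    lev γ ∉ P.disagree lev p ⟨γ, w⟩ ↔ ∃ h : p.1 ≤ γ, P.proj h p.2 = w := by
  constructor
  · intro hmem
    obtain ⟨γ', hlev, h₁, h₂, h₃⟩ := not_not.1 hmem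
    obtain rfl : γ = γ' := hT.eq_of_lev_eq (hT.le_refl _) h₂ hlev.symm
    exact ⟨h₁, h₃.trans (P.proj_self _ _)⟩
  · rintro ⟨h, rfl⟩ hn
    exact hn ⟨γ, rfl, h, le_rfl, (P.proj_self _ _).symm⟩

theorem disagree_subset_or (hT : IsWeakLTree lev) (p q r : Σ δ, P.S δ) :
    P.disagree lev p r ⊆ P.disagree lev p q ∨ P.disagree lev p r ⊆ P.disagree lev q r := by
  have hunion : P.disagree lev p r ⊆ P.disagree lev p q ∪ P.disagree lev q r := by
    intro ℓ hℓ
    by_contra hn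
    obtain ⟨hpq, hqr⟩ := not_or.1 hn
    obtain ⟨γ, hγ, h₁⟩ := not_not.1 hpq
    obtain ⟨γ', hγ', h₂⟩ := not_not.1 hqr
    obtain rfl := hT.eq_of_lev_eq h₁.2.1 h₂.1 (hγ.trans hγ'.symm)
    exact hℓ ⟨γ, hγ, h₁.trans h₂⟩
  rcases (disagree_isLowerSet hT p q).total (disagree_isLowerSet hT q r) with h | h
  · exact Or.inr (Set.union_eq_self_of_subset_left h ▸ hunion)
  · exact Or.inl (Set.union_eq_self_of_subset_right h ▸ hunion)

theorem condP1_of_disagree_eq (hT : IsWeakLTree lev) {g : ∀ δ, Equiv.Perm (P.S δ)}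
    (hg : ∀ p q, p ≠ q → P.disagree lev (Equiv.sigmaCongrRight g p) (Equiv.sigmaCongrRight g q) =
      P.disagree lev p q) : CondP1 P g := by
  intro δ γ h z
  by_cases hδγ : δ = γ
  · subst hδγ
    rw [P.proj_self, P.proj_self]
  have hne : (⟨δ, z⟩ : Σ δ, P.S δ) ≠ ⟨γ, P.proj h z⟩ := fun h' => hδγ (congrArg Sigma.fst h')
  have hmem : lev γ ∉ P.disagree lev ⟨δ, z⟩ ⟨γ, P.proj h z⟩ :=
    (lev_notMem_disagree_iff hT).2 ⟨h, rfl⟩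
  rw [← hg _ _ hne] at hmem
  obtain ⟨_, h'⟩ := (lev_notMem_disagree_iff hT).1 hmem
  exact h'.symm

end ProjectionSystem

end Joins

/-! ### Spaces with rigid fibres -/

/-- A family of ultrametrics below `1` on `K` with no isometric self-maps but the identity and no
isometric maps between different members. Only the distances `sep i a b` of different
points `a`, `b` are recorded. -/
structure RigidMetrics (ι K : Type*) where
  sep : ι → K → K → ℝ
  sep_comm : ∀ i a b, sep i a b = sep i b a
  sep_pos : ∀ i a b, 0 < sep i a b
  sep_lt_one : ∀ i a b, sep i a b < 1
  sep_le_max : ∀ i a b c, a ≠ b → b ≠ c → a ≠ c → sep i a c ≤ max (sep i a b) (sep i b c)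
  rigid : ∀ i j (f : K → K), Function.Injective f →
    (∀ a b, a ≠ b → sep j (f a) (f b) = sep i a b) → i = j ∧ ∀ a, f a = a

/-- The product of the set of nodes of a system of projections with a fibre `K`. Points over the
same node have the distance given by `κ`, and the distance of points over different nodes encodes
the set of levels at which the nodes disagree. -/
@[ext]
structure FibreSpace {Δ L : Type} [PartialOrder Δ] [LinearOrder L] {N : Δ → ℕ∞} {K : Type}
    {lev : Δ → L} (P : ProjectionSystem N) (hT : IsWeakLTree lev) (κ : RigidMetrics Δ K) where
  node : Σ δ, P.S δ
  pos : K

namespace FibreSpace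

variable {Δ L K : Type} [PartialOrder Δ] [LinearOrder L] {N : Δ → ℕ∞} {lev : Δ → L}
  {P : ProjectionSystem N} {hT : IsWeakLTree lev} {κ : RigidMetrics Δ K}

section Metric

variable [Encodable L]

open Classical in
noncomputable instance : Dist (FibreSpace P hT κ) where
  dist x y := if x = y then 0 else if x.node = y.node then κ.sep x.node.1 x.pos y.pos
    else 1 + geomMass (P.disagree lev x.node y.node)

theorem dist_fibre (p : Σ δ, P.S δ) {a b : K} (h : a ≠ b) :
    dist (⟨p, a⟩ : FibreSpace P hT κ) ⟨p, b⟩ = κ.sep p.1 a b :=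
  (if_neg fun h' => h (congrArg pos h')).trans (if_pos rfl)

theorem dist_of_node_ne {x y : FibreSpace P hT κ} (h : x.node ≠ y.node) :
    dist x y = 1 + geomMass (P.disagree lev x.node y.node) :=
  (if_neg fun h' => h (congrArg node h')).trans (if_neg h)

theorem dist_lt_one_iff {x y : FibreSpace P hT κ} : dist x y < 1 ↔ x.node = y.node := by
  constructor
  · intro h
    by_contra hne
    rw [dist_of_node_ne hne] at h
    linarith [geomMass_nonneg (P.disagree lev x.node y.node)]
  · obtain ⟨p, a⟩ := x
    obtain ⟨q, b⟩ := y
    rintro rfl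
    by_cases hab : a = b
    · subst hab
      exact (if_pos rfl : dist (⟨p, a⟩ : FibreSpace P hT κ) ⟨p, a⟩ = 0).trans_lt one_pos
    · exact (dist_fibre _ hab).trans_lt (κ.sep_lt_one _ _ _)

theorem dist_pos_of_ne {x y : FibreSpace P hT κ} (h : x ≠ y) : 0 < dist x y := by
  by_cases hnode : x.node = y.node
  · exact (κ.sep_pos x.node.1 x.pos y.pos).trans_eq ((if_neg h).trans (if_pos hnode)).symm
  · exact one_pos.trans_le (not_lt.1 (mt dist_lt_one_iff.1 hnode))

theorem dist_le_max_of_node_ne {x y z : FibreSpace P hT κ} (hxy : x.node ≠ y.node)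
    (hyz : y.node ≠ z.node) (hxz : x.node ≠ z.node) : dist x z ≤ max (dist x y) (dist y z) := by
  rw [dist_of_node_ne hxy, dist_of_node_ne hyz, dist_of_node_ne hxz]
  rcases P.disagree_subset_or hT x.node y.node z.node with h | h
  · exact le_max_of_le_left (by linarith [geomMass_mono h])
  · exact le_max_of_le_right (by linarith [geomMass_mono h])

theorem dist_eq_of_node_eq {x y z : FibreSpace P hT κ} (hxy : x.node = y.node)
    (hyz : y.node ≠ z.node) : dist x z = dist y z := by
  rw [dist_of_node_ne hyz, dist_of_node_ne (hxy ▸ hyz), hxy]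

protected theorem dist_comm (x y : FibreSpace P hT κ) : dist x y = dist y x := by
  by_cases hxy : x = y
  · rw [hxy]
  obtain ⟨p, a⟩ := x
  obtain ⟨q, b⟩ := y
  by_cases hpq : p = q
  · subst hpq
    have hab : a ≠ b := fun h => hxy (h ▸ rfl)
    rw [dist_fibre _ hab, dist_fibre _ hab.symm, κ.sep_comm]
  · rw [dist_of_node_ne hpq, dist_of_node_ne (Ne.symm hpq), P.disagree_comm]

theorem dist_le_max (x y z : FibreSpace P hT κ) : dist x z ≤ max (dist x y) (dist y z) := by
  by_cases hxz : x = z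
  · exact (if_pos hxz).trans_le (le_max_of_le_left <| by
      by_cases hxy : x = y
      · exact (if_pos hxy).ge
      · exact (dist_pos_of_ne hxy).le)
  by_cases hxy : x = y
  · exact hxy ▸ le_max_right _ _
  by_cases hyz : y = z
  · exact hyz ▸ le_max_left _ _
  by_cases hnxy : x.node = y.node
  · by_cases hnyz : y.node = z.node
    · obtain ⟨p, a⟩ := x
      obtain ⟨q, b⟩ := y
      obtain ⟨r, c⟩ := z
      obtain rfl : p = q := hnxy
      obtain rfl : p = r := hnyz
      have hab : a ≠ b := fun h => hxy (h ▸ rfl)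
      have hbc : b ≠ c := fun h => hyz (h ▸ rfl)
      have hac : a ≠ c := fun h => hxz (h ▸ rfl)
      rw [dist_fibre _ hab, dist_fibre _ hbc, dist_fibre _ hac]
      exact κ.sep_le_max _ _ _ _ hab hbc hac
    · exact (dist_eq_of_node_eq hnxy hnyz).trans_le (le_max_right _ _)
  by_cases hnyz : y.node = z.node
  · rw [FibreSpace.dist_comm x z, dist_eq_of_node_eq hnyz.symm (Ne.symm hnxy),
      FibreSpace.dist_comm y x]
    exact le_max_left _ _
  by_cases hnxz : x.node = z.node
  · exact (dist_lt_one_iff.2 hnxz).le.trans <|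
      le_max_of_le_left (not_lt.1 (mt dist_lt_one_iff.1 hnxy))
  · exact dist_le_max_of_node_ne hnxy hnyz hnxz

noncomputable instance : MetricSpace (FibreSpace P hT κ) where
  dist_self _ := if_pos rfl
  dist_comm := FibreSpace.dist_comm
  dist_triangle x y z := by
    have hnonneg (x y : FibreSpace P hT κ) : 0 ≤ dist x y := by
      by_cases h : x = y
      · exact (if_pos h).ge
      · exact (dist_pos_of_ne h).le
    exact (dist_le_max x y z).trans (max_le_add_of_nonneg (hnonneg _ _) (hnonneg _ _))
  eq_of_dist_eq_zero h := by_contra fun hne => (dist_pos_of_ne hne).ne' h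

instance : IsUltrametricDist (FibreSpace P hT κ) := ⟨dist_le_max⟩

end Metric

section Isometries

theorem mk_mk_inj {δ : Δ} {z w : P.S δ} {a b : K} :
    (⟨⟨δ, z⟩, a⟩ : FibreSpace P hT κ) = ⟨⟨δ, w⟩, b⟩ ↔ z = w ∧ a = b := by
  simp

variable [Encodable L]

theorem dist_map_sigmaCongrRight {g : ∀ δ, Equiv.Perm (P.S δ)} (hg : CondP1 P g)
    (x y : FibreSpace P hT κ) :
    dist (⟨Equiv.sigmaCongrRight g x.node, x.pos⟩ : FibreSpace P hT κ)
      ⟨Equiv.sigmaCongrRight g y.node, y.pos⟩ = dist x y := by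
  by_cases hxy : x = y
  · rw [hxy, dist_self, dist_self]
  obtain ⟨p, a⟩ := x
  obtain ⟨q, b⟩ := y
  by_cases hpq : p = q
  · subst hpq
    have hab : a ≠ b := fun h => hxy (h ▸ rfl)
    rw [dist_fibre _ hab, dist_fibre _ hab]
    rfl
  · rw [dist_of_node_ne ((Equiv.sigmaCongrRight g).injective.ne hpq), dist_of_node_ne hpq]
    simp only [ProjectionSystem.disagree, ProjectionSystem.joins_sigmaCongrRight_iff hg]

variable (P hT κ) in
/-- The action of the wreath product by isometries: nodes are permuted and positions are kept. -/
def isomHom : projWreath P →* (FibreSpace P hT κ ≃ᵢ FibreSpace P hT κ) where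
  toFun g :=
    { toFun := fun x => ⟨Equiv.sigmaCongrRight g.1 x.node, x.pos⟩
      invFun := fun x => ⟨(Equiv.sigmaCongrRight g.1).symm x.node, x.pos⟩
      left_inv := fun _ => FibreSpace.ext (Equiv.symm_apply_apply _ _) rfl
      right_inv := fun _ => FibreSpace.ext (Equiv.apply_symm_apply _ _) rfl
      isometry_toFun := Isometry.of_dist_eq (dist_map_sigmaCongrRight g.2.1) }
  map_one' := rfl
  map_mul' _ _ := rfl

/-- An isometry maps fibres to fibres, since these are the balls of radius `1`; rigidity of the
fibres does the rest. -/
theorem exists_isometryEquiv_apply_eq [Nonempty K] (φ : FibreSpace P hT κ ≃ᵢ FibreSpace P hT κ)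
    {δ : Δ} (z : P.S δ) : ∃ w : P.S δ, ∀ a, φ ⟨⟨δ, z⟩, a⟩ = ⟨⟨δ, w⟩, a⟩ := by
  obtain ⟨q, hq⟩ : ∃ q, ∀ a, (φ ⟨⟨δ, z⟩, a⟩).node = q :=
    ⟨(φ ⟨⟨δ, z⟩, Classical.arbitrary K⟩).node, fun a =>
      dist_lt_one_iff.1 ((φ.dist_eq _ _).trans_lt (dist_lt_one_iff.2 rfl))⟩
  obtain ⟨f, hf⟩ : ∃ f : K → K, ∀ a, φ ⟨⟨δ, z⟩, a⟩ = ⟨q, f a⟩ :=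
    ⟨fun a => (φ ⟨⟨δ, z⟩, a⟩).pos, fun a => FibreSpace.ext (hq a) rfl⟩
  have hinj : Function.Injective f := fun a b hab =>
    (mk_mk_inj.1 (φ.injective ((hf a).trans (hab ▸ (hf b).symm)))).2
  obtain ⟨hcode, hfix⟩ := κ.rigid δ q.1 f hinj fun a b hab => by
    rw [← dist_fibre (hT := hT) q (hinj.ne hab), ← hf, ← hf, φ.dist_eq, dist_fibre _ hab]
  obtain ⟨γ, w⟩ := q
  obtain rfl : δ = γ := hcode
  exact ⟨w, fun a => by rw [hf, hfix]⟩

theorem disagree_eq_of_dist_eq {x y x' y' : FibreSpace P hT κ} (hne : x.node ≠ y.node)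
    (h : dist x' y' = dist x y) :
    P.disagree lev x'.node y'.node = P.disagree lev x.node y.node := by
  have hne' : x'.node ≠ y'.node := fun h' => hne (dist_lt_one_iff.1 (h ▸ dist_lt_one_iff.2 h'))
  rw [dist_of_node_ne hne, dist_of_node_ne hne'] at h
  exact geomMass_injOn_isLowerSet (P.disagree_isLowerSet hT _ _) (P.disagree_isLowerSet hT _ _)
    (add_left_cancel h)

theorem continuous_isomHom : Continuous (isomHom P hT κ) := by
  refine continuous_isometryEquiv_iff.2 fun x => continuous_iff_continuousAt.2 fun g => ?_
  have hopen : IsOpen {h : projWreath P | h.1 x.node.1 x.node.2 = g.1 x.node.1 x.node.2} :=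
    continuous_projWreath_iff.1 continuous_id _ _ _
  refine (continuousAt_const (y := isomHom P hT κ g x)).congr ?_
  filter_upwards [hopen.mem_nhds rfl] with h hh
  exact (mk_mk_inj.2 ⟨hh, rfl⟩).symm

variable [Nonempty K]

theorem isomHom_injective : Function.Injective (isomHom P hT κ) := by
  intro g h hgh
  refine Subtype.ext (funext fun δ => Equiv.ext fun z => ?_)
  exact (mk_mk_inj.1 (DFunLike.congr_fun hgh ⟨⟨δ, z⟩, Classical.arbitrary K⟩)).1

theorem isomHom_surjective : Function.Surjective (isomHom P hT κ) := by
  intro φ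
  choose G hG using fun δ (z : P.S δ) => exists_isometryEquiv_apply_eq φ z
  choose G' hG' using fun δ (z : P.S δ) => exists_isometryEquiv_apply_eq φ.symm z
  have a₀ : K := Classical.arbitrary K
  let g (δ : Δ) : Equiv.Perm (P.S δ) :=
    { toFun := G δ
      invFun := G' δ
      left_inv := fun z => (mk_mk_inj.1 <|
        show (⟨⟨δ, _⟩, a₀⟩ : FibreSpace P hT κ) = ⟨⟨δ, z⟩, a₀⟩ by
          rw [← hG', ← hG, φ.symm_apply_apply]).1
      right_inv := fun z => (mk_mk_inj.1 <|
        show (⟨⟨δ, _⟩, a₀⟩ : FibreSpace P hT κ) = ⟨⟨δ, z⟩, a₀⟩ by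
          rw [← hG, ← hG', φ.apply_symm_apply]).1 }
  have hg : CondP1 P g := P.condP1_of_disagree_eq hT fun p q hpq => by
    refine disagree_eq_of_dist_eq (x := ⟨p, a₀⟩) (y := ⟨q, a₀⟩) (x' := φ ⟨p, a₀⟩)
      (y' := φ ⟨q, a₀⟩) hpq (φ.dist_eq _ _) ▸ ?_
    rw [hG, hG]
    rfl
  exact ⟨⟨g, hg, condP2_of_condP1 hg⟩, IsometryEquiv.ext fun x => (hG _ _ _).symm⟩

variable (P hT κ) in
theorem nonempty_projWreath_continuousMulEquiv :
    Nonempty (projWreath P ≃ₜ* (FibreSpace P hT κ ≃ᵢ FibreSpace P hT κ)) := by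
  let E := MulEquiv.ofBijective (isomHom P hT κ) ⟨isomHom_injective, isomHom_surjective⟩
  refine ⟨{ E with
    continuous_toFun := continuous_isomHom
    continuous_invFun := continuous_projWreath_iff.2 fun δ z w => ?_ }⟩
  have a₀ : K := Classical.arbitrary K
  have hopen : IsOpen {φ : FibreSpace P hT κ ≃ᵢ FibreSpace P hT κ |
      dist (φ ⟨⟨δ, z⟩, a₀⟩) ⟨⟨δ, w⟩, a₀⟩ < 1} :=
    isOpen_lt ((continuous_isometryEquiv_iff.1 continuous_id _).dist continuous_const)
      continuous_const
  convert hopen using 3 with φ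
  obtain ⟨g, rfl⟩ := E.surjective φ
  rw [dist_lt_one_iff]
  change (E.symm (E g)).1 δ z = w ↔ (⟨δ, g.1 δ z⟩ : Σ δ, P.S δ) = ⟨δ, w⟩
  rw [E.symm_apply_apply]
  simp

end Isometries

section Exactness

variable [Encodable L]

theorem mem_component_iff [Nonempty K] (hhom : P.IsLocallyHomogeneous) {δ : Δ} {z : P.S δ}
    {a : K} {y : FibreSpace P hT κ} :
    y ∈ component (⟨⟨δ, z⟩, a⟩ : FibreSpace P hT κ) ↔ ∃ w, y = ⟨⟨δ, w⟩, a⟩ := by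
  constructor
  · rintro ⟨φ, rfl⟩
    obtain ⟨w, hw⟩ := exists_isometryEquiv_apply_eq φ z
    exact ⟨w, hw a⟩
  · rintro ⟨w, rfl⟩
    obtain ⟨g, hg, rfl⟩ := hhom δ z w
    exact ⟨isomHom P hT κ ⟨g, hg⟩, rfl⟩

theorem dist_coherent_le {c : ∀ δ, P.S δ}
    (hc : ∀ (δ γ : Δ) (h : δ ≤ γ), P.proj h (c δ) = c γ) {δ γ : Δ} (z : P.S δ) (w : P.S γ)
    (a b : K) : dist (⟨⟨δ, c δ⟩, a⟩ : FibreSpace P hT κ) ⟨⟨γ, c γ⟩, b⟩ ≤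
      dist (⟨⟨δ, z⟩, a⟩ : FibreSpace P hT κ) ⟨⟨γ, w⟩, b⟩ := by
  by_cases hδγ : δ = γ
  · subst hδγ
    by_cases hzw : z = w
    · subst hzw
      by_cases hab : a = b
      · rw [hab, dist_self, dist_self]
      · rw [dist_fibre _ hab, dist_fibre _ hab]
    · have hle : dist (⟨⟨δ, c δ⟩, a⟩ : FibreSpace P hT κ) ⟨⟨δ, c δ⟩, b⟩ < 1 :=
        dist_lt_one_iff.2 rfl
      refine hle.le.trans (not_lt.1 fun h => hzw ?_)
      simpa using dist_lt_one_iff.1 h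
  · have hne (u : P.S δ) (v : P.S γ) : (⟨δ, u⟩ : Σ δ, P.S δ) ≠ ⟨γ, v⟩ := fun h =>
      hδγ (congrArg Sigma.fst h)
    rw [dist_of_node_ne (hne _ _), dist_of_node_ne (hne _ _)]
    refine add_le_add_right (geomMass_mono ?_) 1
    rintro ℓ hℓ ⟨β, hβ, h₁, h₂, -⟩
    exact hℓ ⟨β, hβ, h₁, h₂, (hc _ _ _).trans (hc _ _ _).symm⟩

theorem isExact [Nonempty K] (hhom : P.IsLocallyHomogeneous) (hfull : P.IsFull) :
    IsExact (FibreSpace P hT κ) := by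
  rintro ⟨⟨δ, z⟩, a⟩ ⟨⟨γ, w⟩, b⟩
  obtain ⟨c, -, hc⟩ := hfull δ z
  have hmem {β : Δ} (u : P.S β) (d : K) :
      (⟨⟨β, c β⟩, d⟩ : FibreSpace P hT κ) ∈ component ⟨⟨β, u⟩, d⟩ :=
    (mem_component_iff hhom).2 ⟨_, rfl⟩
  refine ⟨_, hmem z a, _, hmem w b, (IsLeast.csInf_eq ?_).symm⟩
  refine ⟨⟨_, hmem z a, _, hmem w b, rfl⟩, ?_⟩
  rintro _ ⟨x, hx, y, hy, rfl⟩
  obtain ⟨z', rfl⟩ := (mem_component_iff hhom).1 hx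
  obtain ⟨w', rfl⟩ := (mem_component_iff hhom).1 hy
  exact dist_coherent_le hc z' w' a b

end Exactness

section Topology

variable [Encodable L]

theorem ball_one (p : Σ δ, P.S δ) (a : K) :
    Metric.ball (⟨p, a⟩ : FibreSpace P hT κ) 1 = Set.range (mk p) := by
  ext ⟨q, b⟩
  rw [Metric.mem_ball, dist_lt_one_iff]
  constructor
  · rintro rfl
    exact ⟨b, rfl⟩
  · rintro ⟨c, hc⟩
    exact (congrArg node hc).symm

theorem isUniformlyDiscrete {r : ℝ} (hr : 0 < r) (hr₁ : r ≤ 1)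
    (hκ : ∀ δ a b, a ≠ b → r ≤ κ.sep δ a b) : IsUniformlyDiscrete (FibreSpace P hT κ) := by
  refine ⟨r, hr, ?_⟩
  rintro ⟨p, a⟩
  refine Set.Subset.antisymm ?_ (Set.singleton_subset_iff.2 (Metric.mem_ball_self hr))
  intro y hy
  obtain ⟨b, rfl⟩ : y ∈ Set.range (mk p) := by
    rw [← ball_one p a]
    exact Metric.ball_subset_ball hr₁ hy
  by_contra hne
  have hba : b ≠ a := fun h => hne (h ▸ rfl)
  rw [Metric.mem_ball, dist_fibre p hba] at hy
  exact (hκ p.1 b a hba).not_gt hy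

variable [TopologicalSpace K] (hκ : ∀ p, Continuous (mk p : K → FibreSpace P hT κ))

include hκ

theorem isCompact_ball_one [CompactSpace K] (x : FibreSpace P hT κ) :
    IsCompact (Metric.ball x 1) := by
  rw [ball_one x.node x.pos]
  exact isCompact_range (hκ x.node)

theorem separableSpace [Countable (Σ δ, P.S δ)] [TopologicalSpace.SeparableSpace K] :
    TopologicalSpace.SeparableSpace (FibreSpace P hT κ) := by
  rw [← TopologicalSpace.isSeparable_univ_iff]
  refine .mono (.iUnion fun p => TopologicalSpace.isSeparable_range (hκ p)) fun x _ => ?_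
  exact Set.mem_iUnion.2 ⟨x.node, x.pos, rfl⟩

theorem perfectSpace [PerfectSpace K] : PerfectSpace (FibreSpace P hT κ) := by
  refine perfectSpace_iff_forall_not_isolated.2 ?_
  rintro ⟨p, a⟩
  have hinj : Function.Injective (mk p : K → FibreSpace P hT κ) := fun _ _ h => congrArg pos h
  have hne : Set.MapsTo (mk p : K → FibreSpace P hT κ) {a}ᶜ {⟨p, a⟩}ᶜ := fun _ => hinj.ne
  exact ((hκ p).continuousWithinAt.tendsto_nhdsWithin hne).neBot

end Topology

end FibreSpace

theorem completeSpace_of_isCompact_ball {X : Type*} [PseudoMetricSpace X] {r : ℝ} (hr : 0 < r)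
    (h : ∀ x : X, IsCompact (Metric.ball x r)) : CompleteSpace X := by
  refine Metric.complete_of_cauchySeq_tendsto fun u hu => ?_
  obtain ⟨n, hn⟩ := Metric.cauchySeq_iff'.1 hu r hr
  obtain ⟨a, -, ha⟩ := cauchySeq_tendsto_of_isComplete (h (u n)).isComplete
    (fun m => hn (m + n) (Nat.le_add_left _ _)) (hu.comp_tendsto (Filter.tendsto_add_atTop_nat n))
  exact ⟨a, (Filter.tendsto_add_atTop_iff_nat n).1 ha⟩

theorem IsUniformlyDiscrete.completeSpace {X : Type} [MetricSpace X]
    (h : IsUniformlyDiscrete X) : CompleteSpace X :=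
  let ⟨_, hr, hball⟩ := h
  completeSpace_of_isCompact_ball hr fun x => hball x ▸ isCompact_singleton

/-! ### Rigid fibres -/

section RigidFibres

/-- An injective enumeration of positive numbers below `1` that converges to `0` in the first
argument, uniformly in the second. -/
noncomputable def weight (k c : ℕ) : ℝ := (1 / 2) ^ (k + 1) * (1 + 1 / (c + 2))

theorem lt_weight (k c : ℕ) : (1 / 2 : ℝ) ^ (k + 1) < weight k c :=
  lt_mul_of_one_lt_right (by positivity) (lt_add_of_pos_right _ (by positivity))

theorem weight_lt (k c : ℕ) : weight k c < (1 / 2 : ℝ) ^ k := by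
  have hc : (1 : ℝ) / (c + 2) < 1 := by
    rw [div_lt_one (by positivity)]
    linarith [c.cast_nonneg (α := ℝ)]
  have hk : (0 : ℝ) < (1 / 2) ^ k := by positivity
  rw [weight, pow_succ]
  nlinarith

theorem weight_pos (k c : ℕ) : 0 < weight k c :=
  lt_trans (by positivity) (lt_weight k c)

theorem weight_lt_one (k c : ℕ) : weight k c < 1 :=
  (weight_lt k c).trans_le (pow_le_one₀ (by norm_num) (by norm_num))

theorem weight_lt_weight {k k' : ℕ} (h : k < k') (c c' : ℕ) : weight k' c' < weight k c :=
  (weight_lt k' c').trans_le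
    ((pow_le_pow_of_le_one (by norm_num) (by norm_num) h).trans (lt_weight k c).le)

theorem weight_le_weight {k k' : ℕ} (h : k ≤ k') (c : ℕ) : weight k' c ≤ weight k c :=
  h.eq_or_lt.elim (fun h => h ▸ le_rfl) fun h => (weight_lt_weight h c c).le

theorem weight_inj {k c k' c' : ℕ} : weight k c = weight k' c' ↔ k = k' ∧ c = c' := by
  refine ⟨fun h => ?_, fun ⟨hk, hc⟩ => hk ▸ hc ▸ rfl⟩
  obtain rfl : k = k' := by
    rcases lt_trichotomy k k' with hlt | heq | hlt
    · exact absurd h (weight_lt_weight hlt _ _).ne'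
    · exact heq
    · exact absurd h (weight_lt_weight hlt _ _).ne
  have hinv := add_left_cancel (mul_left_cancel₀ (by positivity) h)
  simp only [one_div, inv_inj, add_left_inj, Nat.cast_inj] at hinv
  exact ⟨rfl, hinv⟩

/-- Rigid uniformly discrete ultrametrics on `ℕ`. -/
noncomputable def discreteRigid (ι : Type*) [Encodable ι] : RigidMetrics ι ℕ where
  sep i a b := 1 / 2 + weight (min a b) (Encodable.encode i) / 2
  sep_comm i a b := by rw [min_comm]
  sep_pos i a b := by linarith [weight_pos (min a b) (Encodable.encode i)]
  sep_lt_one i a b := by linarith [weight_lt_one (min a b) (Encodable.encode i)]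
  sep_le_max i a b c _ _ _ := by
    rcases le_total a c with h | h
    · refine le_max_of_le_left ?_
      linarith [weight_le_weight (show min a b ≤ min a c by omega) (Encodable.encode i)]
    · refine le_max_of_le_right ?_
      linarith [weight_le_weight (show min b c ≤ min a c by omega) (Encodable.encode i)]
  rigid i j f _ hf := by
    have hweight (a b : ℕ) (hab : a ≠ b) :
        min (f a) (f b) = min a b ∧ Encodable.encode j = Encodable.encode i :=
      weight_inj.1 (by linarith [hf a b hab])
    refine ⟨Encodable.encode_injective (hweight 0 1 zero_ne_one).2.symm, fun a => ?_⟩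
    have h₀₂ := (hweight a (a + 2) (by omega)).1
    have h₁₂ := (hweight (a + 1) (a + 2) (by omega)).1
    omega

theorem half_le_discreteRigid_sep {ι : Type*} [Encodable ι] (i : ι) (a b : ℕ) :
    1 / 2 ≤ (discreteRigid ι).sep i a b :=
  le_add_of_nonneg_right (half_pos (weight_pos _ _)).le

theorem firstDiff_update {α : Type*} {a : ℕ → α} {k : ℕ} {x : α} (hx : x ≠ a k) :
    PiNat.firstDiff a (Function.update a k x) = k := by
  have hne : a ≠ Function.update a k x := fun h =>
    hx ((Function.update_self k x a).symm.trans (congrFun h k).symm)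
  refine le_antisymm (not_lt.1 fun hlt => ?_) (not_lt.1 fun hlt => ?_)
  · exact hx ((PiNat.apply_eq_of_lt_firstDiff hlt).trans (Function.update_self k x a)).symm
  · exact PiNat.apply_firstDiff_ne hne (Function.update_of_ne hlt.ne x a).symm

instance : PerfectSpace (ℕ → Bool) := by
  refine perfectSpace_iff_forall_not_isolated.2 fun a => ?_
  have htendsto : Filter.Tendsto (fun k => Function.update a k (!a k)) Filter.atTop (nhds a) :=
    tendsto_pi_nhds.2 fun i => tendsto_const_nhds.congr' <|
      (Filter.eventually_gt_atTop i).mono fun k hk => (Function.update_of_ne hk.ne _ _).symm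
  have hne (k : ℕ) : Function.update a k (!a k) ∈ ({a}ᶜ : Set (ℕ → Bool)) := fun h => by
    simpa using congrFun h k
  exact (tendsto_nhdsWithin_iff.2 ⟨htendsto, .of_forall hne⟩).neBot

variable {ι : Type*} [Encodable ι]

/-- The distance of different sequences in the Cantor space. It determines the first position
where they differ, their common initial segment and the index `i`. -/
noncomputable def cantorSep (i : ι) (a b : ℕ → Bool) : ℝ :=
  weight (PiNat.firstDiff a b) (Encodable.encode (i, PiNat.res a (PiNat.firstDiff a b)))

theorem cantorSep_comm (i : ι) (a b : ℕ → Bool) : cantorSep i a b = cantorSep i b a := by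
  have hres : PiNat.res a (PiNat.firstDiff a b) = PiNat.res b (PiNat.firstDiff a b) :=
    PiNat.res_eq_res.2 fun _ hk => PiNat.apply_eq_of_lt_firstDiff hk
  rw [cantorSep, cantorSep, hres, PiNat.firstDiff_comm]

theorem cantorSep_le_max (i : ι) {a b c : ℕ → Bool} (hac : a ≠ c) :
    cantorSep i a c ≤ max (cantorSep i a b) (cantorSep i b c) := by
  rcases min_le_iff.1 (PiNat.min_firstDiff_le a b c hac) with h | h
  · refine le_max_of_le_left (h.lt_or_eq.elim (fun h => (weight_lt_weight h _ _).le) fun h => ?_)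
    rw [cantorSep, cantorSep, h]
  · refine le_max_of_le_right (h.lt_or_eq.elim (fun h => (weight_lt_weight h _ _).le) fun h => ?_)
    rw [cantorSep_comm, cantorSep_comm i b, cantorSep, cantorSep, PiNat.firstDiff_comm c a,
      PiNat.firstDiff_comm c b, h]

theorem res_eq_of_cantorSep_eq {i j : ι} {a b a' b' : ℕ → Bool}
    (h : cantorSep j a' b' = cantorSep i a b) :
    j = i ∧ PiNat.res a' (PiNat.firstDiff a b) = PiNat.res a (PiNat.firstDiff a b) := by
  obtain ⟨hfirst, hcode⟩ := weight_inj.1 h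
  rw [hfirst, Encodable.encode_inj, Prod.mk.injEq] at hcode
  exact hcode

theorem cantorSep_lt {i : ι} {a b : ℕ → Bool} {k : ℕ} (hab : a ≠ b)
    (h : a ∈ PiNat.cylinder b k) : cantorSep i a b < (1 / 2) ^ k :=
  (weight_lt _ _).trans_le <| pow_le_pow_of_le_one (by norm_num) (by norm_num) <|
    (PiNat.mem_cylinder_iff_le_firstDiff hab k).1 h

variable (ι) in
/-- Rigid perfect compact ultrametrics on the Cantor space. -/
noncomputable def cantorRigid : RigidMetrics ι (ℕ → Bool) where
  sep := cantorSep
  sep_comm := cantorSep_comm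
  sep_pos _ _ _ := weight_pos _ _
  sep_lt_one _ _ _ := weight_lt_one _ _
  sep_le_max i _ _ _ _ _ hac := cantorSep_le_max i hac
  rigid i j f _ hf := by
    have hres (a : ℕ → Bool) (k : ℕ) : j = i ∧ PiNat.res (f a) k = PiNat.res a k := by
      have hne : a ≠ Function.update a k (!a k) := fun h => by simpa using congrFun h k
      exact firstDiff_update (Bool.not_ne_self (a k)) ▸ res_eq_of_cantorSep_eq (hf _ _ hne)
    exact ⟨(hres (fun _ => false) 0).1.symm, fun a => PiNat.res_injective (funext fun k =>
      (hres a k).2)⟩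

end RigidFibres

section Existence

variable {Δ : Type} [PartialOrder Δ] {N : Δ → ℕ∞} {P : ProjectionSystem N}

theorem FibreSpace.continuous_mk_cantorRigid [Encodable Δ] {L : Type} [LinearOrder L]
    [Encodable L] {lev : Δ → L} {hT : IsWeakLTree lev} (p : Σ δ, P.S δ) :
    Continuous (FibreSpace.mk p : (ℕ → Bool) → FibreSpace P hT (cantorRigid Δ)) := by
  refine continuous_iff_continuousAt.2 fun a => Metric.tendsto_nhds.2 fun ε hε => ?_
  obtain ⟨k, hk⟩ := exists_pow_lt_of_lt_one hε (by norm_num : (1 / 2 : ℝ) < 1)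
  filter_upwards [(PiNat.isOpen_cylinder _ a k).mem_nhds (PiNat.self_mem_cylinder a k)] with b hb
  by_cases hba : b = a
  · rwa [hba, dist_self]
  · rw [dist_fibre p hba]
    exact (cantorSep_lt hba hb).trans hk

theorem exists_uniformlyDiscrete (hN : IsCountableTreeable N) (hc : P.IsCountable)
    (hhom : P.IsLocallyHomogeneous) (hfull : P.IsFull) :
    ∃ (U : Type) (_ : MetricSpace U), IsPolishUltrametric U ∧ IsExact U ∧
      IsUniformlyDiscrete U ∧ Nonempty (projWreath P ≃ₜ* (U ≃ᵢ U)) := by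
  obtain ⟨L, _, lev, hT, -⟩ := hN.treeable
  have := hN.countable
  have := hT.lev_surjective.countable
  have := Encodable.ofCountable Δ
  have := Encodable.ofCountable L
  have : Countable (Σ δ, P.S δ) := hc
  have hκ (p : Σ δ, P.S δ) :
      Continuous (FibreSpace.mk p : ℕ → FibreSpace P hT.toIsWeakLTree (discreteRigid Δ)) :=
    continuous_of_discreteTopology
  have := FibreSpace.separableSpace hκ
  have hdiscrete := FibreSpace.isUniformlyDiscrete (P := P) (hT := hT.toIsWeakLTree)
    (κ := discreteRigid Δ) one_half_pos one_half_lt_one.le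
    fun i a b _ => half_le_discreteRigid_sep i a b
  exact ⟨_, _, ⟨inferInstance, hdiscrete.completeSpace,
    UniformSpace.secondCountable_of_separable _⟩, FibreSpace.isExact hhom hfull, hdiscrete,
    FibreSpace.nonempty_projWreath_continuousMulEquiv P _ _⟩

theorem exists_perfect_locallyCompact (hN : IsCountableTreeable N) (hc : P.IsCountable)
    (hhom : P.IsLocallyHomogeneous) (hfull : P.IsFull) :
    ∃ (U : Type) (_ : MetricSpace U), IsPolishUltrametric U ∧ IsExact U ∧
      PerfectSpace U ∧ LocallyCompactSpace U ∧ Nonempty (projWreath P ≃ₜ* (U ≃ᵢ U)) := by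
  obtain ⟨L, _, lev, hT, -⟩ := hN.treeable
  have := hN.countable
  have := hT.lev_surjective.countable
  have := Encodable.ofCountable Δ
  have := Encodable.ofCountable L
  have : Countable (Σ δ, P.S δ) := hc
  have hκ := FibreSpace.continuous_mk_cantorRigid (P := P) (hT := hT.toIsWeakLTree)
  have hball := FibreSpace.isCompact_ball_one hκ
  have := FibreSpace.separableSpace hκ
  have : WeaklyLocallyCompactSpace (FibreSpace P hT.toIsWeakLTree (cantorRigid Δ)) :=
    ⟨fun x => ⟨_, hball x, Metric.ball_mem_nhds x one_pos⟩⟩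
  exact ⟨_, _, ⟨inferInstance, completeSpace_of_isCompact_ball one_pos hball,
    UniformSpace.secondCountable_of_separable _⟩, FibreSpace.isExact hhom hfull,
    FibreSpace.perfectSpace hκ, inferInstance,
    FibreSpace.nonempty_projWreath_continuousMulEquiv P _ _⟩

end Existence

/-! ### Automorphism groups of trees as projective wreath products -/

section NodeCoding

variable {Δ : Type} [PartialOrder Δ] {N : Δ → ℕ∞} {P : ProjectionSystem N}

namespace ProjectionSystem

/-- The element `q` of the system is the image of `p` under a projection. -/
def ProjectsTo (P : ProjectionSystem N) (p q : Σ δ, P.S δ) : Prop :=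
  ∃ h : p.1 ≤ q.1, P.proj h p.2 = q.2

theorem condP1_iff_projectsTo {g : ∀ δ, Equiv.Perm (P.S δ)} :
    CondP1 P g ↔ ∀ p q, P.ProjectsTo p q ↔
      P.ProjectsTo (Equiv.sigmaCongrRight g p) (Equiv.sigmaCongrRight g q) := by
  refine ⟨fun hg p q => exists_congr fun h => ?_, fun hg δ γ h z => ?_⟩
  · exact (g q.1).injective.eq_iff.symm.trans (by rw [hg]; rfl)
  · exact ((hg ⟨δ, z⟩ ⟨γ, P.proj h z⟩).1 ⟨h, rfl⟩).2.symm

end ProjectionSystem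

theorem exists_sigmaCongrRight_eq {ι : Type*} {α : ι → Type*} {f : Equiv.Perm (Σ i, α i)}
    (hf : ∀ p, (f p).1 = p.1) : ∃ g : ∀ i, Equiv.Perm (α i), Equiv.sigmaCongrRight g = f := by
  have hf' : ∀ p, (f.symm p).1 = p.1 := fun p => by rw [← hf, f.apply_symm_apply]
  have exists_eq : ∀ k : (Σ i, α i) → Σ i, α i, (∀ p, (k p).1 = p.1) →
      ∀ i a, ∃ b, k ⟨i, a⟩ = ⟨i, b⟩ := fun k hk i a =>
    ⟨cast (congrArg α (hk ⟨i, a⟩)) (k ⟨i, a⟩).2, Sigma.ext (hk ⟨i, a⟩) (cast_heq _ _).symm⟩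
  choose u hu using exists_eq f hf
  choose v hv using exists_eq f.symm hf'
  refine ⟨fun i => ⟨u i, v i, fun a => ?_, fun a => ?_⟩, Equiv.ext fun p => (hu p.1 p.2).symm⟩
  · exact sigma_mk_injective (by rw [← hv, ← hu, f.symm_apply_apply])
  · exact sigma_mk_injective (by rw [← hu, ← hv, f.apply_symm_apply])

/-- An identification of the nodes of a tree with the elements of a system of projections that
turns the order into the projections, and for which the index `δ` of a node is invariant under
automorphisms and determines its level. -/
structure NodeCoding {T L : Type} [LE T] (lev : T → L) (P : ProjectionSystem N) where
  code : T ≃ Σ δ, P.S δ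
  fst_code_apply : ∀ f ∈ treeAut lev, ∀ t, (code (f t)).1 = (code t).1
  lev_eq : ∀ t t', (code t).1 = (code t').1 → lev t = lev t'
  le_iff : ∀ t t', t ≤ t' ↔ P.ProjectsTo (code t) (code t')

namespace NodeCoding

variable {T L : Type} [LE T] {lev : T → L} (C : NodeCoding lev P)

/-- The action of the projective wreath product on the nodes. -/
def hom : projWreath P →* treeAut lev :=
  ((C.code.symm.permCongrHom.toMonoidHom.comp (Equiv.Perm.sigmaCongrRightHom _)).comp
    (projWreath P).subtype).codRestrict (treeAut lev) fun g =>
      ⟨fun t => C.lev_eq _ _ (by simp), fun t t' => by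
        rw [C.le_iff, C.le_iff, ProjectionSystem.condP1_iff_projectsTo.1 g.2.1]
        simp⟩

theorem code_hom_apply (g : projWreath P) (t : T) :
    C.code ((C.hom g).1 t) = Equiv.sigmaCongrRight g.1 (C.code t) := by
  simp [hom]

theorem hom_bijective : Function.Bijective C.hom := by
  refine ⟨fun g g' h => Subtype.ext (Equiv.Perm.sigmaCongrRightHom_injective ?_), fun f => ?_⟩
  · refine Equiv.ext (C.code.surjective.forall.2 fun t => ?_)
    exact (C.code_hom_apply g t).symm.trans (h ▸ C.code_hom_apply g' t)
  · obtain ⟨g, hg⟩ := exists_sigmaCongrRight_eq (f := C.code.permCongr f.1)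
      (C.code.surjective.forall.2 fun t => by simpa using C.fst_code_apply f.1 f.2 t)
    have hg_code : ∀ t, Equiv.sigmaCongrRight g (C.code t) = C.code (f.1 t) := fun t => by
      simp [hg]
    have hg_mem : CondP1 P g := ProjectionSystem.condP1_iff_projectsTo.2
      (C.code.surjective.forall₂.2 fun t t' => by
        rw [hg_code, hg_code, ← C.le_iff, ← C.le_iff, f.2.2])
    refine ⟨⟨g, hg_mem, condP2_of_condP1 hg_mem⟩, Subtype.ext (Equiv.ext fun t => ?_)⟩
    exact C.code.injective ((C.code_hom_apply _ t).trans (hg_code t))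

theorem continuous_hom : Continuous C.hom := by
  refine continuous_treeAut_iff.2 fun t s => ?_
  have h : {g | (C.hom g).1 t = s} =
      {g : projWreath P | (⟨(C.code t).1, g.1 _ (C.code t).2⟩ : Σ δ, P.S δ) = C.code s} := by
    ext g
    exact C.code.injective.eq_iff.symm.trans (by rw [C.code_hom_apply]; rfl)
  rw [h]
  generalize C.code s = q
  obtain ⟨γ, w⟩ := q
  by_cases hγ : (C.code t).1 = γ
  · subst hγ
    simp only [Sigma.mk.injEq, heq_eq_eq, true_and]
    exact continuous_projWreath_iff.1 continuous_id _ _ w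
  · simp only [Sigma.mk.injEq, hγ, false_and, Set.ofPred_false, isOpen_empty]

theorem nonempty_treeAut_continuousMulEquiv (C : NodeCoding lev P) :
    Nonempty (treeAut lev ≃ₜ* projWreath P) := by
  let E := MulEquiv.ofBijective C.hom C.hom_bijective
  have hE : Continuous E.symm := by
    refine continuous_projWreath_iff.2 fun δ z w => ?_
    have h : {f | (E.symm f).1 δ z = w} =
        {f : treeAut lev | f.1 (C.code.symm ⟨δ, z⟩) = C.code.symm ⟨δ, w⟩} := by
      refine Set.ext (E.surjective.forall.2 fun g => ?_)
      have hg : C.code ((E g).1 (C.code.symm ⟨δ, z⟩)) = ⟨δ, g.1 δ z⟩ :=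
        (C.code_hom_apply g _).trans (by rw [C.code.apply_symm_apply]; rfl)
      simp only [Set.mem_ofPred_eq, E.symm_apply_apply, Equiv.eq_symm_apply, hg,
        sigma_mk_injective.eq_iff]
    rw [h]
    exact continuous_treeAut_iff.1 continuous_id _ _
  exact ⟨ContinuousMulEquiv.symm { E with
    continuous_toFun := C.continuous_hom
    continuous_invFun := hE }⟩

end NodeCoding

end NodeCoding

/-! ### Sections of the condensation map -/

section Sections

variable {T L : Type} [LE T] {lev : T → L}

/-- Two nodes are coherent if the nodes above them with the same class coincide. -/
def Coherent (lev : T → L) (s t : T) : Prop :=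
  ∀ c d, s ≤ c → t ≤ d → Condensed.mk lev c = Condensed.mk lev d → c = d

theorem Coherent.symm {s t : T} (hst : Coherent lev s t) : Coherent lev t s :=
  fun c d hc hd hcd => (hst d c hd hc hcd.symm).symm

variable [LinearOrder L]

theorem IsWeakLTree.eq_of_mk_eq (h : IsWeakLTree lev) {t c d : T} (hc : t ≤ c) (hd : t ≤ d)
    (hcd : Condensed.mk lev c = Condensed.mk lev d) : c = d :=
  h.eq_of_lev_eq hc hd (congrArg (Condensed.lev lev) hcd)

theorem HasStar.exists_lowerBound (hstar : HasStar lev) (h : IsWeakLTree lev) {C : Set T}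
    (hupper : ∀ c ∈ C, ∀ d, c ≤ d → d ∈ C) {s : T} (hs : ∀ c ∈ C, s ≤ c) {δ : Condensed lev}
    (hδ : ∀ c ∈ C, δ ≤ Condensed.mk lev c) :
    ∃ t, Condensed.mk lev t = δ ∧ ∀ c ∈ C, t ≤ c := by
  by_cases hsC : s ∈ C
  · obtain ⟨t, hts, ht⟩ := Condensed.exists_le (hδ s hsC)
    exact ⟨t, ht, fun c hc => h.le_trans _ _ _ hts (hs c hc)⟩
  · obtain ⟨t₀, rfl⟩ := Condensed.mk_surjective δ
    exact hstar C
      { chain := fun c hc d hd => h.le_total_of_le (hs c hc) (hs d hd)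
        upward_closed := hupper
        proper := ⟨s, fun c hc => ⟨hs c hc, fun hsc => hsC (hsc ▸ hc)⟩⟩ } t₀ hδ

theorem Coherent.refl (h : IsWeakLTree lev) (t : T) : Coherent lev t t :=
  fun _ _ => h.eq_of_mk_eq

theorem Coherent.le_of_mk_le {s t : T} (hst : Coherent lev s t) (h : IsWeakLTree lev)
    (hle : Condensed.mk lev s ≤ Condensed.mk lev t) : s ≤ t := by
  obtain ⟨u, hsu, hut⟩ := Condensed.exists_ge hle
  exact hst u t hsu (h.le_refl t) hut ▸ hsu

/-- A set of pairwise coherent nodes: a partial section of the condensation map. -/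
def IsCoherentSet (lev : T → L) (F : Set T) : Prop := ∀ s ∈ F, ∀ t ∈ F, Coherent lev s t

theorem IsCoherentSet.exists_lowerBound {F : Finset T} (hF : IsCoherentSet lev (F : Set T))
    (h : IsWeakLTree lev) (hne : F.Nonempty) (δ : Condensed lev) :
    ∃ s ∈ F, ∀ c, (∃ r ∈ F, r ≤ c) → δ ≤ Condensed.mk lev c → s ≤ c := by
  by_contra! hno
  choose! c hc hδc hsc using hno
  choose! r hrF hrc using hc
  obtain ⟨s, hs, hsmin⟩ := F.exists_min_image (fun s => lev (c s)) hne
  obtain ⟨u, hcu, hu⟩ := Condensed.exists_ge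
    (h.condensed.le_of_lev_le (hδc s hs) (hδc _ (hrF s hs)) (hsmin _ (hrF s hs)))
  have huc : u = c (r s) := hF _ (hrF s hs) _ (hrF _ (hrF s hs)) u _
    (h.le_trans _ _ _ (hrc s hs) hcu) (hrc _ (hrF s hs)) hu
  exact hsc _ (hrF s hs) (h.le_trans _ _ _ (hrc s hs) (huc ▸ hcu))

theorem IsCoherentSet.exists_coherent {F : Finset T} (hF : IsCoherentSet lev (F : Set T))
    (h : IsWeakLTree lev) (hstar : HasStar lev) (δ : Condensed lev) :
    ∃ t, Condensed.mk lev t = δ ∧ ∀ s ∈ F, Coherent lev s t := by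
  rcases F.eq_empty_or_nonempty with rfl | hne
  · obtain ⟨t, ht⟩ := Condensed.mk_surjective δ
    exact ⟨t, ht, by simp⟩
  obtain ⟨s₀, -, hs₀⟩ := hF.exists_lowerBound h hne δ
  obtain ⟨t, rfl, ht⟩ := hstar.exists_lowerBound h (s := s₀) (δ := δ)
    (C := {c | (∃ r ∈ F, r ≤ c) ∧ δ ≤ Condensed.mk lev c})
    (fun c ⟨⟨r, hr, hrc⟩, hδ⟩ d hcd => ⟨⟨r, hr, h.le_trans _ _ _ hrc hcd⟩,
      h.condensed.le_trans _ _ _ hδ (Condensed.mk_le_mk hcd)⟩)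
    (fun c hc => hs₀ c hc.1 hc.2) fun c hc => hc.2
  refine ⟨t, rfl, fun s hs c d hsc htd hcd => h.eq_of_mk_eq (ht c ⟨⟨s, hs, hsc⟩, ?_⟩) htd hcd⟩
  exact hcd ▸ Condensed.mk_le_mk htd

theorem IsCoherentSet.insert {F : Set T} (hF : IsCoherentSet lev F) (h : IsWeakLTree lev) {t : T}
    (ht : ∀ s ∈ F, Coherent lev s t) : IsCoherentSet lev (insert t F) := by
  rintro a (rfl | ha) b (rfl | hb)
  · exact .refl h _
  · exact (ht b hb).symm
  · exact ht a ha
  · exact hF a ha b hb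

/-- A monotone choice of a node in each class. -/
structure IsSection (lev : T → L) (σ : Condensed lev → T) : Prop where
  mk_apply : ∀ δ, Condensed.mk lev (σ δ) = δ
  mono : ∀ δ γ, δ ≤ γ → σ δ ≤ σ γ

theorem IsSection.apply_eq_of_le {σ : Condensed lev → T} (hσ : IsSection lev σ)
    (h : IsWeakLTree lev) {δ : Condensed lev} {s : T} (hs : σ δ ≤ s) :
    σ (Condensed.mk lev s) = s := by
  refine h.eq_of_mk_eq (hσ.mono δ _ ?_) hs (hσ.mk_apply _)
  exact (hσ.mk_apply δ).symm.trans_le (Condensed.mk_le_mk hs)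

theorem exists_section [Countable T] (h : IsWeakLTree lev) (hstar : HasStar lev) (t : T) :
    ∃ σ, IsSection lev σ ∧ σ (Condensed.mk lev t) = t := by
  classical
  let Q := {F : Finset T // IsCoherentSet lev (F : Set T)}
  let 𝒟 : Condensed lev → Order.Cofinal Q := fun δ =>
    { carrier := {F | ∃ t ∈ F.1, Condensed.mk lev t = δ}
      isCofinal := by
        rintro ⟨F, hF⟩
        obtain ⟨t, ht, htF⟩ := hF.exists_coherent h hstar δ
        exact ⟨⟨insert t F, by simpa using hF.insert h htF⟩, ⟨t, F.mem_insert_self t, ht⟩,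
          F.subset_insert t⟩ }
  have : Countable (Condensed lev) := Condensed.mk_surjective.countable
  have := Encodable.ofCountable (Condensed lev)
  let p : Q := ⟨{t}, by simpa [IsCoherentSet] using Coherent.refl h t⟩
  let F := Order.sequenceOfCofinals p 𝒟
  have hF_mono : Monotone F := Order.sequenceOfCofinals.monotone p 𝒟
  have hF_coherent : ∀ n m, ∀ a ∈ (F n).1, ∀ b ∈ (F m).1, Coherent lev a b := fun n m a ha b hb =>
    (F (max n m)).2 a (hF_mono (le_max_left n m) ha) b (hF_mono (le_max_right n m) hb)
  choose σ hσF hσ using fun δ => Order.sequenceOfCofinals.encode_mem p 𝒟 δ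
  refine ⟨σ, ⟨hσ, fun δ γ hδγ => ?_⟩, ?_⟩
  · exact (hF_coherent _ _ _ (hσF δ) _ (hσF γ)).le_of_mk_le h (by rwa [hσ, hσ])
  · exact hF_coherent _ 0 _ (hσF _) t (Finset.mem_singleton_self t) _ _
      (h.le_refl _) (h.le_refl _) (hσ _)

end Sections

/-! ### Siblings -/

section Siblings

variable {T L : Type} [LE T] {lev : T → L}

/-- The nodes of the same class as `t` below all nodes that are strictly above `t`. -/
def siblings (lev : T → L) (t : T) : Set T :=
  {t' | Condensed.mk lev t' = Condensed.mk lev t ∧ ∀ s, t ≤ s → t ≠ s → t' ≤ s}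

theorem self_mem_siblings (t : T) : t ∈ siblings lev t := ⟨rfl, fun _ hs _ => hs⟩

theorem image_siblings_subset {f : Equiv.Perm T} (hf : f ∈ treeAut lev) (t : T) :
    f '' siblings lev t ⊆ siblings lev (f t) := by
  rintro _ ⟨t', ht, rfl⟩
  refine ⟨by rw [Condensed.mk_apply hf, Condensed.mk_apply hf, ht.1], ?_⟩
  refine f.surjective.forall.2 fun s hs hne => ?_
  exact (hf.2 _ _).1 (ht.2 s ((hf.2 _ _).2 hs) (hne <| congrArg f ·))

theorem encard_siblings_le {f : Equiv.Perm T} (hf : f ∈ treeAut lev) (t : T) :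
    (siblings lev t).encard ≤ (siblings lev (f t)).encard :=
  f.injective.encard_image (siblings lev t) ▸ Set.encard_le_encard (image_siblings_subset hf t)

/-- The number of siblings of the nodes of a class, each node counting as its own sibling. -/
noncomputable def sibCount (lev : T → L) : Condensed lev → ℕ∞ :=
  Quotient.lift (fun t => (siblings lev t).encard) <| by
    rintro t _ ⟨f, hf, rfl⟩
    have hle := encard_siblings_le (inv_mem hf) (f t)
    rw [show f⁻¹ (f t) = t from f.symm_apply_apply t] at hle
    exact (encard_siblings_le hf t).antisymm hle

theorem sibCount_ne_zero (δ : Condensed lev) : sibCount lev δ ≠ 0 := by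
  obtain ⟨t, rfl⟩ := Condensed.mk_surjective δ
  exact Set.encard_ne_zero.2 ⟨t, self_mem_siblings t⟩

variable [LinearOrder L] (h : IsWeakLTree lev)

include h

theorem ne_of_mem_siblings {t t' s : T} (ht : t' ∈ siblings lev t) (hs : t ≤ s) (hne : t ≠ s) :
    t' ≠ s := by
  rintro rfl
  exact hne (h.eq_of_mk_eq (h.le_refl t) hs ht.1.symm)

theorem mem_siblings_symm {t t' : T} (ht : t' ∈ siblings lev t) : t ∈ siblings lev t' := by
  refine ⟨ht.1.symm, fun s hs hne => ?_⟩
  obtain ⟨u, htu, hus⟩ := Condensed.exists_ge (ht.1.symm.trans_le (Condensed.mk_le_mk hs))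
  have htu_ne : t ≠ u := by
    rintro rfl
    exact hne (h.eq_of_mk_eq (h.le_refl t') hs (ht.1.trans hus))
  exact h.eq_of_mk_eq (ht.2 u htu htu_ne) hs hus ▸ htu

theorem siblings_eq {t t' : T} (ht : t' ∈ siblings lev t) : siblings lev t' = siblings lev t := by
  have trans : ∀ {a b c}, b ∈ siblings lev a → c ∈ siblings lev b → c ∈ siblings lev a :=
    fun hab hbc => ⟨hbc.1.trans hab.1, fun s hs hne =>
      hbc.2 s (hab.2 s hs hne) (ne_of_mem_siblings h hab hs hne)⟩
  exact Set.Subset.antisymm (fun _ => trans ht) fun _ => trans (mem_siblings_symm h ht)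

end Siblings

/-! ### Labels -/

theorem exists_pointed_bijOn {T : Type} {A : Set T} (hA : A.Countable) {a : T} (ha : a ∈ A) :
    ∃ k : T → ℕ, Set.BijOn k A {n | (n : ℕ∞) < A.encard} ∧ k a = 0 := by
  classical
  set B : Set ℕ := {n | (n : ℕ∞) < A.encard} with hB
  have hcard : A.encard = B.encard := by
    rw [hB]
    cases A.encard with
    | top => simp
    | coe k =>
      rw [show {n : ℕ | (n : ℕ∞) < k} = Finset.range k by ext; simp,
        Set.encard_coe_eq_coe_finsetCard, Finset.card_range]
  obtain ⟨e⟩ := Cardinal.eq.1 <| Cardinal.toENat_injOn hA.le_aleph0 B.to_countable.le_aleph0 hcard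
  have h0 : 0 ∈ B := pos_iff_ne_zero.2 (Set.encard_ne_zero.2 ⟨a, ha⟩)
  let e' : A ≃ B := e.trans (Equiv.swap (e ⟨a, ha⟩) ⟨0, h0⟩)
  let k : T → ℕ := Function.extend Subtype.val (fun t : A => (e' t : ℕ)) 0
  have hk : ∀ t : A, k t = e' t := Subtype.val_injective.extend_apply _ _
  refine ⟨k, ⟨fun t ht => ?_, fun t ht s hs hts => ?_, fun n hn => ?_⟩, ?_⟩
  · exact hk ⟨t, ht⟩ ▸ (e' ⟨t, ht⟩).2
  · rw [hk ⟨t, ht⟩, hk ⟨s, hs⟩] at hts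
    exact congrArg Subtype.val (e'.injective (Subtype.ext hts))
  · exact ⟨e'.symm ⟨n, hn⟩, (e'.symm ⟨n, hn⟩).2, by rw [hk, e'.apply_symm_apply]⟩
  · rw [hk ⟨a, ha⟩]
    simp [e']

section Labels

variable {T L : Type} [LE T] {lev : T → L}

/-- The index of the first section that passes through the siblings of `t`. -/
noncomputable def firstIndex (σ : ℕ → Condensed lev → T) (t : T) : ℕ :=
  sInf {n | σ n (Condensed.mk lev t) ∈ siblings lev t}

/-- The sibling of `t` on the first section that passes through its siblings. -/
noncomputable def baseSibling (σ : ℕ → Condensed lev → T) (t : T) : T :=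
  σ (firstIndex σ t) (Condensed.mk lev t)

/-- An enumeration of each set of siblings, starting with the base sibling. -/
structure IsLabelling (lev : T → L) (σ : ℕ → Condensed lev → T) (lab : T → ℕ) : Prop where
  bijOn : ∀ t, Set.BijOn lab (siblings lev t) {n | (n : ℕ∞) < sibCount lev (Condensed.mk lev t)}
  baseSibling_eq_zero : ∀ t, lab (baseSibling σ t) = 0

/-- A sequence of sections that passes through every node. -/
structure IsCover (lev : T → L) (σ : ℕ → Condensed lev → T) : Prop where
  isSection : ∀ n, IsSection lev (σ n)
  exists_eq : ∀ t, ∃ n, σ n (Condensed.mk lev t) = t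

variable {σ : ℕ → Condensed lev → T} {lab : T → ℕ}

theorem firstIndex_le {t : T} {n : ℕ} (hn : σ n (Condensed.mk lev t) = t) : firstIndex σ t ≤ n :=
  Nat.sInf_le (show _ ∈ siblings lev t from hn.symm ▸ self_mem_siblings t)

theorem IsCover.baseSibling_mem (hσ : IsCover lev σ) (t : T) :
    baseSibling σ t ∈ siblings lev t := by
  obtain ⟨n, hn⟩ := hσ.exists_eq t
  exact Nat.sInf_mem (s := {n | σ n (Condensed.mk lev t) ∈ siblings lev t})
    ⟨n, show _ ∈ siblings lev t from hn.symm ▸ self_mem_siblings t⟩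

theorem IsLabelling.lt (hlab : IsLabelling lev σ lab) (t : T) :
    (lab t : ℕ∞) < sibCount lev (Condensed.mk lev t) :=
  (hlab.bijOn t).mapsTo (self_mem_siblings t)

variable [LinearOrder L]

theorem exists_cover [Countable T] [Nonempty T] (h : IsWeakLTree lev) (hstar : HasStar lev) :
    ∃ σ, IsCover lev σ := by
  obtain ⟨a, ha⟩ := exists_surjective_nat T
  choose σ hσ hσa using fun n => exists_section h hstar (a n)
  exact ⟨σ, hσ, ha.forall.2 fun n => ⟨n, hσa n⟩⟩

theorem baseSibling_congr (h : IsWeakLTree lev) {t t' : T} (ht : t' ∈ siblings lev t) :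
    baseSibling σ t' = baseSibling σ t := by
  simp only [baseSibling, firstIndex, siblings_eq h ht, ht.1]

theorem IsCover.exists_labelling [Countable T] (h : IsWeakLTree lev) (hσ : IsCover lev σ) :
    ∃ lab, IsLabelling lev σ lab := by
  choose k hk hk_zero using fun t =>
    exists_pointed_bijOn (siblings lev t).to_countable (self_mem_siblings t)
  have hbase : ∀ t, baseSibling σ (baseSibling σ t) = baseSibling σ t :=
    fun t => baseSibling_congr h (hσ.baseSibling_mem t)
  refine ⟨fun t => k (baseSibling σ t) t, fun t => ?_, fun t => ?_⟩
  · have hbij := hk (baseSibling σ t)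
    rw [siblings_eq h (hσ.baseSibling_mem t)] at hbij
    exact hbij.congr fun t' ht' => by simp only [baseSibling_congr h ht']
  · simp only [hbase, hk_zero]

section Cover

variable (h : IsWeakLTree lev) (hσ : IsCover lev σ)

include h hσ

theorem IsCover.apply_firstIndex {t s : T} (hts : t ≤ s) (hne : t ≠ s) :
    σ (firstIndex σ t) (Condensed.mk lev s) = s :=
  (hσ.isSection _).apply_eq_of_le h ((hσ.baseSibling_mem t).2 s hts hne)

theorem IsCover.finite_setOf_label_ne_zero (hlab : IsLabelling lev σ lab) (t : T) :
    {s | t ≤ s ∧ lab s ≠ 0}.Finite := by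
  obtain ⟨n, hn⟩ := hσ.exists_eq t
  have hlab_zero : ∀ s s', s ≤ s' → s ≠ s' → firstIndex σ s = firstIndex σ s' → lab s' = 0 := by
    intro s s' hle hne heq
    have hbase : baseSibling σ s' = s' := by
      rw [baseSibling, ← heq, hσ.apply_firstIndex h hle hne]
    exact hbase ▸ hlab.baseSibling_eq_zero s'
  refine Set.Finite.of_finite_image (f := firstIndex σ) ((Set.finite_Iic n).subset ?_) ?_
  · rintro _ ⟨s, ⟨hts, -⟩, rfl⟩
    exact firstIndex_le ((hσ.isSection n).apply_eq_of_le h (hn.trans_le hts))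
  · rintro s ⟨hs, hs_zero⟩ s' ⟨hs', hs'_zero⟩ heq
    by_contra hne
    rcases h.le_total_of_le hs hs' with hle | hle
    · exact hs'_zero (hlab_zero s s' hle hne heq)
    · exact hs_zero (hlab_zero s' s hle (Ne.symm hne) heq.symm)

theorem IsCover.exists_le_forall_label_eq_zero (hlab : IsLabelling lev σ lab) {δ : Condensed lev}
    {s : T} (hδ : δ ≤ Condensed.mk lev s) :
    ∃ t, t ≤ s ∧ Condensed.mk lev t = δ ∧ ∀ u, t ≤ u → ¬ s ≤ u → lab u = 0 := by
  classical
  have hex := hσ.exists_eq s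
  have hs := Nat.find_spec hex
  have hmin : ∀ m, σ m (Condensed.mk lev s) = s → Nat.find hex ≤ m := fun _ => Nat.find_min' hex
  set n := Nat.find hex
  have hts : σ n δ ≤ s := ((hσ.isSection n).mono _ _ hδ).trans_eq hs
  refine ⟨σ n δ, hts, (hσ.isSection n).mk_apply δ, fun u htu hsu => ?_⟩
  have hus : u ≤ s := (h.le_total_of_le htu hts).resolve_right hsu
  have hun : σ n (Condensed.mk lev u) = u := (hσ.isSection n).apply_eq_of_le h htu
  have hindex : firstIndex σ u = n := (firstIndex_le hun).antisymm <|
    hmin _ (hσ.apply_firstIndex h hus fun heq => hsu (heq ▸ h.le_refl u))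
  have hbase : baseSibling σ u = u := by rw [baseSibling, hindex, hun]
  exact hbase ▸ hlab.baseSibling_eq_zero u

theorem IsCover.exists_forall_label_eq_zero (hlab : IsLabelling lev σ lab) (δ : Condensed lev) :
    ∃ t, Condensed.mk lev t = δ ∧ ∀ u, t ≤ u → lab u = 0 := by
  refine ⟨σ 0 δ, (hσ.isSection 0).mk_apply δ, fun u hu => ?_⟩
  have hu := (hσ.isSection 0).apply_eq_of_le h hu
  have hbase : baseSibling σ u = u := by rw [baseSibling, Nat.le_zero.1 (firstIndex_le hu), hu]
  exact hbase ▸ hlab.baseSibling_eq_zero u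

end Cover

theorem IsLabelling.exists_sibling (hlab : IsLabelling lev σ lab) (h : IsWeakLTree lev)
    {z : Condensed lev → ℕ} {t : T}
    (hz : (z (Condensed.mk lev t) : ℕ∞) < sibCount lev (Condensed.mk lev t))
    (ht : ∀ u, t ≤ u → t ≠ u → lab u = z (Condensed.mk lev u)) :
    ∃ s, Condensed.mk lev s = Condensed.mk lev t ∧
      ∀ u, s ≤ u → lab u = z (Condensed.mk lev u) := by
  obtain ⟨s, hs, hsz⟩ := (hlab.bijOn t).surjOn hz
  refine ⟨s, hs.1, fun u hsu => ?_⟩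
  have hts := mem_siblings_symm h hs
  rcases eq_or_ne s u with rfl | hne
  · rw [hsz, hs.1]
  · exact ht u (hts.2 u hsu hne) (ne_of_mem_siblings h hts hsu hne)

theorem IsLabelling.exists_node (hlab : IsLabelling lev σ lab) (h : IsWeakLTree lev)
    (hσ : IsCover lev σ) {z : Condensed lev → ℕ} (hz : ∀ γ, (z γ : ℕ∞) < sibCount lev γ)
    (δ : Condensed lev) (hfin : {γ | δ ≤ γ ∧ z γ ≠ 0}.Finite) :
    ∃ t, Condensed.mk lev t = δ ∧ ∀ u, t ≤ u → lab u = z (Condensed.mk lev u) := by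
  have hc := h.condensed
  let A : Condensed lev → Set (Condensed lev) := fun δ => {γ | δ ≤ γ ∧ δ ≠ γ ∧ z γ ≠ 0}
  induction hn : (A δ).ncard using Nat.strong_induction_on generalizing δ with | _ n ih
  suffices ∃ t, Condensed.mk lev t = δ ∧ ∀ u, t ≤ u → t ≠ u → lab u = z (Condensed.mk lev u) by
    obtain ⟨t, rfl, ht⟩ := this
    exact hlab.exists_sibling h (hz _) ht
  have hA : (A δ).Finite := hfin.subset fun γ hγ => ⟨hγ.1, hγ.2.2⟩
  have mk_mem : ∀ t u, t ≤ u → t ≠ u → z (Condensed.mk lev u) ≠ 0 →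
      Condensed.mk lev u ∈ A (Condensed.mk lev t) := fun t u htu hne hu =>
    ⟨Condensed.mk_le_mk htu, fun heq => hne (h.eq_of_mk_eq (h.le_refl t) htu heq), hu⟩
  rcases (A δ).eq_empty_or_nonempty with hempty | hne
  · obtain ⟨t, rfl, ht⟩ := hσ.exists_forall_label_eq_zero h hlab δ
    refine ⟨t, rfl, fun u htu hne => (ht u htu).trans (not_not.1 fun hu => ?_)⟩
    exact Set.eq_empty_iff_forall_notMem.1 hempty _ (mk_mem t u htu hne (Ne.symm hu))
  · obtain ⟨γ, ⟨hδγ, hδγ_ne, hγ⟩, hmin⟩ := Set.exists_min_image _ (Condensed.lev lev) hA hne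
    have hssub : A γ ⊂ A δ := by
      refine ⟨fun β hβ => ⟨hc.le_trans _ _ _ hδγ hβ.1, ?_, hβ.2.2⟩,
        fun hsub => (hsub ⟨hδγ, hδγ_ne, hγ⟩).2.1 rfl⟩
      rintro rfl
      exact hδγ_ne (hc.le_antisymm _ _ hδγ hβ.1)
    obtain ⟨s, rfl, hs⟩ := ih _ (hn ▸ Set.ncard_lt_ncard hssub hA) γ
      (hfin.subset fun β hβ => ⟨hc.le_trans _ _ _ hδγ hβ.1, hβ.2⟩) rfl
    obtain ⟨t, hts, rfl, ht⟩ := hσ.exists_le_forall_label_eq_zero h hlab hδγ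
    refine ⟨t, rfl, fun u htu hne => ?_⟩
    by_cases hsu : s ≤ u
    · exact hs u hsu
    · refine (ht u htu hsu).trans (not_not.1 fun hu => hsu (h.le_of_lev_le hts htu ?_))
      exact hmin _ (mk_mem t u htu hne (Ne.symm hu))

theorem IsLabelling.eq_of_labels_eq (hlab : IsLabelling lev σ lab) (h : IsLTree lev) {t t' : T}
    (htt' : Condensed.mk lev t = Condensed.mk lev t')
    (heq : ∀ s s', t ≤ s → t' ≤ s' → Condensed.mk lev s = Condensed.mk lev s' → lab s = lab s') :
    t = t' := by
  have hw := h.toIsWeakLTree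
  have hlev : lev t = lev t' := congrArg (Condensed.lev lev) htt'
  by_contra hne
  obtain ⟨ℓ, ⟨hℓ, hag⟩, hmax⟩ := h.exists_split t t' (fun hle => (hw.lev_lt _ _ hle hne).ne hlev)
    fun hle => (hw.lev_lt _ _ hle (Ne.symm hne)).ne hlev.symm
  obtain ⟨u, ⟨htu, rfl⟩, -⟩ := hw.existsUnique_above t ℓ ((le_max_left _ _).trans hℓ)
  obtain ⟨u', ⟨htu', hlev'⟩, -⟩ := hw.existsUnique_above t' _ ((le_max_right _ _).trans hℓ)
  have hmk : Condensed.mk lev u' = Condensed.mk lev u :=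
    hw.condensed.eq_of_lev_eq (htt' ▸ Condensed.mk_le_mk htu') (Condensed.mk_le_mk htu) hlev'
  have hsib : u' ∈ siblings lev u := by
    refine ⟨hmk, fun s hs hus => ?_⟩
    have hlt := hw.lev_lt u s hs hus
    have hagree : AgreeAt lev t t' (lev s) := by
      by_contra hna
      exact (hmax ⟨hℓ.trans hlt.le, hna⟩).not_gt hlt
    obtain ⟨c, hc, hc', hcs⟩ := hagree
    obtain rfl := hw.eq_of_lev_eq hc (hw.le_trans _ _ _ htu hs) hcs
    exact hw.le_of_lev_le htu' hc' (hlev'.le.trans hlt.le)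
  obtain rfl := (hlab.bijOn u).injOn hsib (self_mem_siblings u) (heq u u' htu htu' hmk.symm).symm
  exact hag ⟨u', htu, htu', rfl⟩

end Labels

/-! ### Coordinates of the nodes -/

/-- A system of natural labels below `N` on the nodes of a tree with condensation map `m`, such
that the nodes above `δ` correspond to the sequences with locally finite support. -/
structure IsCoordinateSystem {T Δ : Type} [LE T] [PartialOrder Δ] (m : T → Δ) (lab : T → ℕ)
    (N : Δ → ℕ∞) : Prop where
  lt : ∀ t, (lab t : ℕ∞) < N (m t)
  le_trans : ∀ t t' t'' : T, t ≤ t' → t' ≤ t'' → t ≤ t''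
  mono : ∀ t t', t ≤ t' → m t ≤ m t'
  existsUnique_above : ∀ t γ, m t ≤ γ → ∃! s, t ≤ s ∧ m s = γ
  finite : ∀ t, {s | t ≤ s ∧ lab s ≠ 0}.Finite
  existsUnique_node : ∀ δ (x : GlobalSeq N), {γ | δ ≤ γ ∧ (x γ).1 ≠ 0}.Finite →
    ∃! t, m t = δ ∧ ∀ u, t ≤ u → lab u = (x (m u)).1

namespace IsCoordinateSystem

variable {T Δ : Type} [LE T] [PartialOrder Δ] {m : T → Δ} {lab : T → ℕ} {N : Δ → ℕ∞}

theorem exists_labelSeq (hm : IsCoordinateSystem m lab N) (hN : ∀ δ, N δ ≠ 0) (t : T) :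
    ∃ x : (domainLF N).carrier, ∀ u, t ≤ u → (x.1 (m u)).1 = lab u := by
  classical
  choose up hup hup_unique using hm.existsUnique_above t
  have hlt : ∀ γ (hγ : m t ≤ γ), (lab (up γ hγ) : ℕ∞) < N γ := fun γ hγ =>
    (hm.lt _).trans_eq (congrArg N (hup γ hγ).2)
  let x : GlobalSeq N := fun γ =>
    if hγ : m t ≤ γ then ⟨lab (up γ hγ), hlt γ hγ⟩ else zeroSeq hN γ
  have hx : ∀ γ hγ, (x γ).1 = lab (up γ hγ) := fun γ hγ => congrArg Subtype.val (dif_pos hγ)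
  refine ⟨⟨x, fun β => ((hm.finite t).image m).subset ?_⟩, fun u hu => ?_⟩
  · rintro γ ⟨hγ, -⟩
    have hle : m t ≤ γ := by
      by_contra hle
      exact hγ (congrArg Subtype.val (dif_neg hle))
    exact ⟨up γ hle, ⟨(hup γ hle).1, hx γ hle ▸ hγ⟩, (hup γ hle).2⟩
  · rw [hx (m u) (hm.mono t u hu), ← hup_unique (m u) (hm.mono t u hu) u ⟨hu, rfl⟩]

/-- The sequence of the labels of the nodes above `t`, extended to all of `Δ`. -/
noncomputable def labelSeq (hm : IsCoordinateSystem m lab N) (hN : ∀ δ, N δ ≠ 0) (t : T) :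
    (domainLF N).carrier :=
  (hm.exists_labelSeq hN t).choose

theorem labelSeq_apply (hm : IsCoordinateSystem m lab N) (hN : ∀ δ, N δ ≠ 0) {t u : T}
    (hu : t ≤ u) : ((hm.labelSeq hN t).1 (m u)).1 = lab u :=
  (hm.exists_labelSeq hN t).choose_spec u hu

/-- The element of the system of projections that consists of the labels of the nodes above
`t`. -/
noncomputable def code (hm : IsCoordinateSystem m lab N) (hN : ∀ δ, N δ ≠ 0)
    (hS : (domainLF N).carrier.Nonempty) (t : T) :
    Σ δ, ((domainLF N).projections hS).S δ :=
  ⟨m t, (domainLF N).res hS (m t) (hm.labelSeq hN t)⟩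

variable (hm : IsCoordinateSystem m lab N) (hN : ∀ δ, N δ ≠ 0)
  (hS : (domainLF N).carrier.Nonempty)

include hm hN hS

theorem code_eq_iff (t : T) (δ : Δ) (x : (domainLF N).carrier) :
    hm.code hN hS t = ⟨δ, (domainLF N).res hS δ x⟩ ↔
      m t = δ ∧ ∀ u, t ≤ u → lab u = (x.1 (m u)).1 := by
  refine ⟨fun heq => ?_, ?_⟩
  · obtain rfl : m t = δ := congrArg Sigma.fst heq
    have hres := GlobalDomain.res_eq_iff.1 (Sigma.mk.inj_iff.1 heq).2.eq
    refine ⟨rfl, fun u hu => (hm.labelSeq_apply hN hu).symm.trans ?_⟩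
    exact congrArg Subtype.val ((restrict_eq_iff _ _ _).1 hres (m u) (hm.mono t u hu))
  · rintro ⟨rfl, hx⟩
    refine congrArg (Sigma.mk (m t)) <| GlobalDomain.res_eq_iff.2 <|
      (restrict_eq_iff _ _ _).2 fun γ hγ => ?_
    obtain ⟨u, ⟨hu, rfl⟩, -⟩ := hm.existsUnique_above t γ hγ
    exact Subtype.ext ((hm.labelSeq_apply hN hu).trans (hx u hu))

theorem code_bijective : Function.Bijective (hm.code hN hS) := by
  refine (Function.bijective_iff_existsUnique _).2 ?_
  rintro ⟨δ, q⟩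
  obtain ⟨x, rfl⟩ := GlobalDomain.res_surjective hS δ q
  simp only [code_eq_iff]
  exact hm.existsUnique_node δ x.1 ((x.2 δ).subset fun γ hγ => ⟨hγ.2, hγ.1⟩)

theorem le_iff_projectsTo (t t' : T) :
    t ≤ t' ↔ ((domainLF N).projections hS).ProjectsTo (hm.code hN hS t) (hm.code hN hS t') := by
  constructor
  · intro htt'
    have hcode : hm.code hN hS t' = ⟨m t', (domainLF N).res hS (m t') (hm.labelSeq hN t)⟩ :=
      (hm.code_eq_iff hN hS _ _ _).2
        ⟨rfl, fun u hu => (hm.labelSeq_apply hN (hm.le_trans t t' u htt' hu)).symm⟩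
    exact ⟨hm.mono t t' htt', (Sigma.mk.inj_iff.1 hcode).2.eq.symm⟩
  · rintro ⟨hle, heq⟩
    obtain ⟨s, ⟨hts, hs⟩, -⟩ := hm.existsUnique_above t (m t') hle
    have hcode : hm.code hN hS s = ⟨m t', (domainLF N).res hS (m t') (hm.labelSeq hN t)⟩ :=
      (hm.code_eq_iff hN hS _ _ _).2
        ⟨hs, fun u hu => (hm.labelSeq_apply hN (hm.le_trans t s u hts hu)).symm⟩
    have hst' : hm.code hN hS s = hm.code hN hS t' := hcode.trans (congrArg (Sigma.mk (m t')) heq)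
    exact (hm.code_bijective hN hS).1 hst' ▸ hts

end IsCoordinateSystem

/-! ### The wreath product of a tree with property (⋆) -/

section TreeToWreath

variable {T L : Type} [LE T] [LinearOrder L] {lev : T → L}

/-- The partial order on the condensed tree. -/
@[reducible]
def condensedOrder (h : IsWeakLTree lev) : PartialOrder (Condensed lev) where
  le_refl := h.condensed.le_refl
  le_trans := h.condensed.le_trans
  le_antisymm := h.condensed.le_antisymm

theorem isCountableTreeable_condensed [Countable T] [Nonempty T] (h : IsLTree lev)
    (hp : IsPruned lev) (hstar : HasStar lev) :
    @IsCountableTreeable _ (condensedOrder h.toIsWeakLTree) (sibCount lev) :=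
  let _ := condensedOrder h.toIsWeakLTree
  { nonempty := ‹Nonempty T›.map (Condensed.mk lev)
    countable := Condensed.mk_surjective.countable
    label_ne_zero := sibCount_ne_zero
    treeable := ⟨L, inferInstance, Condensed.lev lev, h.isSpecial hstar, hp.condensed⟩ }

theorem exists_isCoordinateSystem [Countable T] [Nonempty T] (h : IsLTree lev)
    (hstar : HasStar lev) :
    ∃ lab, @IsCoordinateSystem _ _ _ (condensedOrder h.toIsWeakLTree) (Condensed.mk lev) lab
      (sibCount lev) := by
  have hw := h.toIsWeakLTree
  obtain ⟨σ, hσ⟩ := exists_cover hw hstar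
  obtain ⟨lab, hlab⟩ := hσ.exists_labelling hw
  let _ := condensedOrder hw
  exact ⟨lab,
    { lt := hlab.lt
      le_trans := hw.le_trans
      mono := fun _ _ => Condensed.mk_le_mk
      existsUnique_above := fun t γ hγ => by
        obtain ⟨s, hts, rfl⟩ := Condensed.exists_ge hγ
        exact ⟨s, ⟨hts, rfl⟩, fun u hu => hw.eq_of_mk_eq hu.1 hts hu.2⟩
      finite := hσ.finite_setOf_label_ne_zero hw hlab
      existsUnique_node := fun δ x hx => by
        obtain ⟨t, rfl, ht⟩ := hlab.exists_node hw hσ (fun γ => (x γ).2) δ hx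
        refine ⟨t, ⟨rfl, ht⟩, fun t' ht' => hlab.eq_of_labels_eq h ht'.1 fun s s' hs hs' hss' => ?_⟩
        rw [ht'.2 s hs, ht s' hs', hss'] }⟩

theorem exists_wreath_equiv [Countable T] [Nonempty T] (h : IsLTree lev) (hp : IsPruned lev)
    (hstar : HasStar lev) :
    ∃ (Δ : Type) (_ : PartialOrder Δ) (N : Δ → ℕ∞), IsCountableTreeable N ∧
      Nonempty (treeAut lev ≃ₜ* wreath (domainLF N)) := by
  let _ := condensedOrder h.toIsWeakLTree
  obtain ⟨lab, hlab⟩ := exists_isCoordinateSystem h hstar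
  have hN : ∀ δ, sibCount lev δ ≠ 0 := sibCount_ne_zero
  have hS : (domainLF (sibCount lev)).carrier.Nonempty := ⟨zeroSeq hN, zeroSeq_mem_domainLF hN⟩
  let C : NodeCoding lev ((domainLF (sibCount lev)).projections hS) :=
    { code := Equiv.ofBijective _ (hlab.code_bijective hN hS)
      fst_code_apply := fun f hf t => Condensed.mk_apply hf t
      lev_eq := fun t t' htt' => congrArg (Condensed.lev lev) htt'
      le_iff := hlab.le_iff_projectsTo hN hS }
  obtain ⟨e₁⟩ := C.nonempty_treeAut_continuousMulEquiv
  obtain ⟨e₂⟩ := GlobalDomain.nonempty_localWreath_continuousMulEquiv (hS := hS)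
    (domainLF_isLocallyDetermined (N := sibCount lev))
  exact ⟨_, _, _, isCountableTreeable_condensed h hp hstar, ⟨e₁.trans e₂⟩⟩

end TreeToWreath

/-! ### Scales of Polish ultrametric spaces -/

section Scales

variable {U : Type} [MetricSpace U]

variable (U) in
/-- The distance set of a metric space, without `0`. -/
def distances : Set ℝ := {r | ∃ x y : U, x ≠ y ∧ dist x y = r}

theorem countable_distances (hU : IsPolishUltrametric U) : (distances U).Countable := by
  have := hU.ultrametric
  have := hU.secondCountable
  obtain ⟨Q, hQ, hdense⟩ := TopologicalSpace.exists_countable_dense U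
  refine (hQ.image2 hQ dist).mono ?_
  rintro _ ⟨x, y, hxy, rfl⟩
  obtain ⟨p, hp, hxp⟩ := hdense.exists_dist_lt x (dist_pos.2 hxy)
  obtain ⟨q, hq, hyq⟩ := hdense.exists_dist_lt y (dist_pos.2 hxy)
  refine ⟨p, hp, q, hq, le_antisymm ?_ ?_⟩
  · refine (dist_triangle_max p x q).trans (max_le (dist_comm x p ▸ hxp.le) ?_)
    exact (dist_triangle_max x y q).trans (max_le le_rfl hyq.le)
  · by_contra! hlt
    have hxq : dist x q < dist x y := (dist_triangle_max x p q).trans_lt (max_lt hxp hlt)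
    have hxy' := (dist_triangle_max x q y).trans_lt (max_lt hxq (dist_comm y q ▸ hyq))
    exact hxy'.false

theorem isScale_coe {R : Set ℝ} (hpos : ∀ r ∈ R, 0 < r) (hdist : distances U ⊆ R)
    (hlarge : ∀ a : ℝ, ∃ r ∈ R, a < r)
    (hsmall : ∀ ε : ℝ, 0 < ε → ∃ r ∈ R, ∀ x : U, Metric.ball x r ⊆ Metric.ball x ε) :
    IsScale U ((↑) : R → ℝ) where
  strictMono _ _ h := h
  pos r := hpos r r.2
  exists_eq_dist x y hxy := ⟨⟨dist x y, hdist ⟨x, y, hxy, rfl⟩⟩, rfl⟩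
  exists_dist_lt x y := let ⟨r, hr, hlt⟩ := hlarge (dist x y); ⟨⟨r, hr⟩, hlt⟩
  exists_ball_subset ε hε := let ⟨r, hr, hsub⟩ := hsmall ε hε; ⟨⟨r, hr⟩, hsub⟩

theorem IsScale.comp_orderIso {L M : Type} [LinearOrder L] [LinearOrder M] {e : M → ℝ}
    (he : IsScale U e) (i : L ≃o M) : IsScale U (e ∘ i) where
  strictMono := he.strictMono.comp i.strictMono
  pos ℓ := he.pos (i ℓ)
  exists_eq_dist x y hxy := i.surjective.exists.1 (he.exists_eq_dist x y hxy)
  exists_dist_lt x y := i.surjective.exists.1 (he.exists_dist_lt x y)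
  exists_ball_subset ε hε := i.surjective.exists.1 (he.exists_ball_subset ε hε)

theorem nonempty_orderIso_rat {R : Set ℝ} (hR : R.Countable) (hpos : ∀ r ∈ R, 0 < r)
    (hrat : ∀ q : ℚ, (0 : ℝ) < q → (q : ℝ) ∈ R) : Nonempty (ℚ ≃o R) := by
  have hbetween : ∀ a b : ℝ, 0 ≤ a → a < b → ∃ r : R, a < r ∧ r < b := fun a b ha hab =>
    let ⟨q, haq, hqb⟩ := exists_rat_btwn hab
    ⟨⟨q, hrat q (ha.trans_lt haq)⟩, haq, hqb⟩
  have : Countable R := hR.to_subtype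
  have : DenselyOrdered R := ⟨fun a b hab => hbetween a b (hpos a a.2).le hab⟩
  have : NoMinOrder R :=
    ⟨fun a => let ⟨r, _, hra⟩ := hbetween 0 a le_rfl (hpos a a.2); ⟨r, hra⟩⟩
  have : NoMaxOrder R :=
    ⟨fun a => let ⟨r, har, _⟩ := hbetween a (a + 1) (hpos a a.2).le (lt_add_one _); ⟨r, har⟩⟩
  have : Nonempty R := let ⟨r, _⟩ := hbetween 0 1 le_rfl one_pos; ⟨r⟩
  exact Order.iso_of_countable_dense ℚ R

theorem exists_ratScale (hU : IsPolishUltrametric U) : ∃ e : ℚ → ℝ, IsScale U e := by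
  let R : Set ℝ := distances U ∪ {r | 0 < r ∧ r ∈ Set.range ((↑) : ℚ → ℝ)}
  have hpos : ∀ r ∈ R, 0 < r := by
    rintro r (⟨x, y, hxy, rfl⟩ | ⟨hr, -⟩)
    exacts [dist_pos.2 hxy, hr]
  have hcount : R.Countable := (countable_distances hU).union
    ((Set.countable_range _).mono fun _ hr => hr.2)
  have hrat : ∀ q : ℚ, (0 : ℝ) < q → (q : ℝ) ∈ R := fun q hq => Or.inr ⟨hq, q, rfl⟩
  obtain ⟨i⟩ := nonempty_orderIso_rat hcount hpos hrat
  refine ⟨_, (isScale_coe hpos Set.subset_union_left (fun a => ?_) fun ε hε => ?_).comp_orderIso i⟩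
  · obtain ⟨q, hq⟩ := exists_rat_gt (max a 0)
    exact ⟨q, hrat q ((le_max_right _ _).trans_lt hq), (le_max_left _ _).trans_lt hq⟩
  · obtain ⟨q, hq, hqε⟩ := exists_rat_btwn hε
    exact ⟨q, hrat q hq, fun x => Metric.ball_subset_ball hqε.le⟩

theorem IsUniformlyDiscrete.exists_scale (hd : IsUniformlyDiscrete U)
    (hU : IsPolishUltrametric U) :
    ∃ (L : Type) (_ : LinearOrder L) (e : L → ℝ),
      Countable L ∧ IsScale U e ∧ ∃ ℓ₀ : L, ∀ ℓ, ℓ₀ ≤ ℓ := by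
  obtain ⟨r, hr, hball⟩ := hd
  have hle : ∀ x y : U, x ≠ y → r ≤ dist x y := fun x y hxy => by
    by_contra! hlt
    exact hxy (hball y ▸ Metric.mem_ball.2 hlt : x ∈ ({y} : Set U))
  let R : Set ℝ := distances U ∪ Set.range fun n : ℕ => r + n
  have hmin : ∀ s ∈ R, r ≤ s := by
    rintro s (⟨x, y, hxy, rfl⟩ | ⟨n, rfl⟩)
    exacts [hle x y hxy, le_add_of_nonneg_right n.cast_nonneg]
  have hrR : r ∈ R := Or.inr ⟨0, by simp⟩
  have hcount : R.Countable := (countable_distances hU).union (Set.countable_range _)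
  have hscale : IsScale U ((↑) : R → ℝ) := by
    refine isScale_coe (fun s hs => hr.trans_le (hmin s hs)) Set.subset_union_left (fun a => ?_)
      fun ε hε => ⟨r, hrR, fun x => ?_⟩
    · obtain ⟨n, hn⟩ := exists_nat_gt a
      exact ⟨r + n, Or.inr ⟨n, rfl⟩, hn.trans (lt_add_of_pos_left _ hr)⟩
    · rw [hball]
      exact Set.singleton_subset_iff.2 (Metric.mem_ball_self hε)
  exact ⟨R, inferInstance, (↑), hcount.to_subtype, hscale, ⟨r, hrR⟩, fun s => hmin s s.2⟩

theorem IsScale.of_subsingleton {V L : Type} [MetricSpace V] [Subsingleton V] [LinearOrder L]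
    {e : L → ℝ} (he : IsScale U e) : IsScale V e where
  strictMono := he.strictMono
  pos := he.pos
  exists_eq_dist x y hxy := absurd (Subsingleton.elim x y) hxy
  exists_dist_lt x y :=
    let ⟨ℓ, _⟩ := he.exists_ball_subset 1 one_pos
    ⟨ℓ, by rw [Subsingleton.elim x y, dist_self]; exact he.pos ℓ⟩
  exists_ball_subset ε hε :=
    let ⟨ℓ, _⟩ := he.exists_ball_subset 1 one_pos
    ⟨ℓ, fun x y _ => Subsingleton.elim x y ▸ Metric.mem_ball_self hε⟩

end Scales

/-! ### The trivial group -/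

theorem nonempty_continuousMulEquiv_of_subsingleton (G H : Type*) [Group G] [Group H]
    [TopologicalSpace G] [TopologicalSpace H] [Subsingleton G] [Subsingleton H] :
    Nonempty (G ≃ₜ* H) :=
  ⟨{ toFun _ := 1
     invFun _ := 1
     left_inv _ := Subsingleton.elim _ _
     right_inv _ := Subsingleton.elim _ _
     map_mul' _ _ := (one_mul 1).symm
     continuous_toFun := continuous_const
     continuous_invFun := continuous_const }⟩

section Subsingleton

variable (U : Type) [MetricSpace U] [Subsingleton U]

theorem isPolishUltrametric_of_subsingleton : IsPolishUltrametric U where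
  ultrametric := ⟨fun x y z => by simp only [Subsingleton.elim x z, dist_self, le_max_iff,
    dist_nonneg, true_or]⟩
  complete := inferInstance
  secondCountable := inferInstance

theorem isExact_of_subsingleton : IsExact U := by
  refine fun x y => ⟨x, ⟨1, rfl⟩, y, ⟨1, rfl⟩, ?_⟩
  have himage : Set.image2 dist (component x) (component y) = {dist x y} := by
    refine Set.eq_singleton_iff_unique_mem.2 ⟨⟨x, ⟨1, rfl⟩, y, ⟨1, rfl⟩, rfl⟩, ?_⟩
    rintro _ ⟨x', -, y', -, rfl⟩
    rw [Subsingleton.elim x' x, Subsingleton.elim y' y]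
  rw [himage, csInf_singleton]

theorem isUniformlyDiscrete_of_subsingleton : IsUniformlyDiscrete U :=
  ⟨1, one_pos, fun _ => Set.eq_singleton_iff_unique_mem.2
    ⟨Metric.mem_ball_self one_pos, fun _ _ => Subsingleton.elim _ _⟩⟩

instance : Subsingleton (U ≃ᵢ U) :=
  ⟨fun _ _ => IsometryEquiv.ext fun _ => Subsingleton.elim _ _⟩

end Subsingleton

/-! ### Passing between the descriptions -/

section Representations

variable {G : Type*} [Group G] [TopologicalSpace G]

theorem IsScale.exists_tree_of_nonempty {U L : Type} [MetricSpace U] [Nonempty U] [LinearOrder L]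
    [Countable L] {e : L → ℝ} (he : IsScale U e) (hU : IsPolishUltrametric U) (hex : IsExact U)
    (g : G ≃ₜ* (U ≃ᵢ U)) :
    ∃ (T : Type) (_ : LE T) (lev : T → L), IsLTree lev ∧ Countable T ∧ IsPruned lev ∧
      IsSpecial lev ∧ HasStar lev ∧ Nonempty (G ≃ₜ* treeAut lev) := by
  have := hU.ultrametric
  have := hU.complete
  have := hU.secondCountable
  have htree := BallNode.isLTree he
  have hstar := BallNode.hasStar he hex
  obtain ⟨f⟩ := BallNode.nonempty_isometryEquiv_continuousMulEquiv he
  exact ⟨BallNode U e, inferInstance, BallNode.lev, htree, BallNode.countable he,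
    BallNode.isPruned he, htree.isSpecial hstar, hstar, ⟨g.trans f⟩⟩

theorem IsScale.exists_tree {U L : Type} [MetricSpace U] [LinearOrder L] [Countable L]
    {e : L → ℝ} (he : IsScale U e) (hU : IsPolishUltrametric U) (hex : IsExact U)
    (g : G ≃ₜ* (U ≃ᵢ U)) :
    ∃ (T : Type) (_ : LE T) (lev : T → L), IsLTree lev ∧ Countable T ∧ IsPruned lev ∧
      IsSpecial lev ∧ HasStar lev ∧ Nonempty (G ≃ₜ* treeAut lev) := by
  cases isEmpty_or_nonempty U
  · have : Subsingleton G := g.injective.subsingleton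
    obtain ⟨g'⟩ := nonempty_continuousMulEquiv_of_subsingleton G (Unit ≃ᵢ Unit)
    exact (he.of_subsingleton (V := Unit)).exists_tree_of_nonempty
      (isPolishUltrametric_of_subsingleton Unit) (isExact_of_subsingleton Unit) g'
  · exact he.exists_tree_of_nonempty hU hex g

theorem IsLTree.exists_wreath {T L : Type} [LE T] [LinearOrder L] [Countable T] {lev : T → L}
    (h : IsLTree lev) (hp : IsPruned lev) (hstar : HasStar lev) (g : G ≃ₜ* treeAut lev) :
    ∃ (Δ : Type) (_ : PartialOrder Δ) (N : Δ → ℕ∞), IsCountableTreeable N ∧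
      Nonempty (G ≃ₜ* wreath (domainLF N)) := by
  cases isEmpty_or_nonempty T
  · have : Subsingleton (treeAut lev) := ⟨fun _ _ => Subtype.ext (Equiv.ext isEmptyElim)⟩
    have : Subsingleton G := g.injective.subsingleton
    have hunit := isPolishUltrametric_of_subsingleton Unit
    obtain ⟨e, he⟩ := exists_ratScale hunit
    obtain ⟨g'⟩ := nonempty_continuousMulEquiv_of_subsingleton G (Unit ≃ᵢ Unit)
    obtain ⟨T', _, lev', htree, _, hpruned, -, hstar', ⟨f⟩⟩ :=
      he.exists_tree hunit (isExact_of_subsingleton Unit) g'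
    have : Nonempty T' := (htree.lev_surjective 0).nonempty
    obtain ⟨Δ, _, N, hN, ⟨f'⟩⟩ := exists_wreath_equiv htree hpruned hstar'
    exact ⟨Δ, _, N, hN, ⟨f.trans f'⟩⟩
  · obtain ⟨Δ, _, N, hN, ⟨f⟩⟩ := exists_wreath_equiv h hp hstar
    exact ⟨Δ, _, N, hN, ⟨g.trans f⟩⟩

variable {Δ : Type} [PartialOrder Δ] {N : Δ → ℕ∞}

theorem IsCountableTreeable.exists_localDomains (hN : IsCountableTreeable N)
    (g : G ≃ₜ* wreath (domainLF N)) :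
    ∃ D : LocalDomains N, D.IsCountable ∧ D.IsLocallyHomogeneous ∧ D.IsFull ∧ SubsetMax D.S ∧
      Nonempty (G ≃ₜ* localWreath D) := by
  have := hN.countable
  have := domainLF_separable hN.label_ne_zero
  have hS : (domainLF N).carrier.Nonempty := ⟨_, zeroSeq_mem_domainLF hN.label_ne_zero⟩
  obtain ⟨f⟩ := GlobalDomain.nonempty_localWreath_continuousMulEquiv (hS := hS)
    domainLF_isLocallyDetermined
  exact ⟨(domainLF N).localDomains hS, GlobalDomain.localDomains_isCountable hS,
    domainLF_isApproxHomogeneous.localDomains hS, GlobalDomain.localDomains_isFull hS,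
    subsetMax_localDomains_domainLF hS, ⟨g.trans f.symm⟩⟩

theorem GlobalDomain.exists_uniformlyDiscrete {S : GlobalDomain N}
    [TopologicalSpace.SeparableSpace S.carrier] (hN : IsCountableTreeable N)
    (hah : S.IsApproxHomogeneous) (hld : S.IsLocallyDetermined) (g : G ≃ₜ* wreath S) :
    ∃ (U : Type) (_ : MetricSpace U), IsPolishUltrametric U ∧ IsExact U ∧
      IsUniformlyDiscrete U ∧ Nonempty (G ≃ₜ* (U ≃ᵢ U)) := by
  have := hN.countable
  rcases S.carrier.eq_empty_or_nonempty with hempty | hS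
  · have : IsEmpty S.carrier := Set.isEmpty_coe_sort.2 hempty
    have : Subsingleton (wreath S) := ⟨fun _ _ => Subtype.ext (Equiv.ext isEmptyElim)⟩
    have : Subsingleton G := g.injective.subsingleton
    exact ⟨Unit, inferInstance, isPolishUltrametric_of_subsingleton Unit,
      isExact_of_subsingleton Unit, isUniformlyDiscrete_of_subsingleton Unit,
      nonempty_continuousMulEquiv_of_subsingleton _ _⟩
  · obtain ⟨f⟩ := GlobalDomain.nonempty_localWreath_continuousMulEquiv (hS := hS) hld
    obtain ⟨U, _, hU, hex, hd, ⟨f'⟩⟩ := UltraIso.exists_uniformlyDiscrete hN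
      (P := S.projections hS) (GlobalDomain.localDomains_isCountable hS) (hah.localDomains hS)
      (GlobalDomain.localDomains_isFull hS).toProjectionSystem
    exact ⟨U, _, hU, hex, hd, ⟨(g.trans f.symm).trans f'⟩⟩

end Representations

end UltraIso

open UltraIso in
theorem mainTheorem2 (G : Type*) [Group G] [TopologicalSpace G] [IsTopologicalGroup G] :
      List.TFAE [
        -- isometry groups of exact Polish ultrametric spaces
        ∃ (U : Type) (_ : MetricSpace U), IsPolishUltrametric U ∧ IsExact U ∧
          Nonempty (G ≃ₜ* (U ≃ᵢ U)),
        -- perfect locally compact spaces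
        ∃ (U : Type) (_ : MetricSpace U), IsPolishUltrametric U ∧ IsExact U ∧
          PerfectSpace U ∧ LocallyCompactSpace U ∧ Nonempty (G ≃ₜ* (U ≃ᵢ U)),
        -- uniformly discrete spaces
        ∃ (U : Type) (_ : MetricSpace U), IsPolishUltrametric U ∧ IsExact U ∧
          IsUniformlyDiscrete U ∧ Nonempty (G ≃ₜ* (U ≃ᵢ U)),
        -- automorphism groups of countable pruned `L`-trees with property (⋆)
        ∃ (L : Type) (_ : LinearOrder L) (T : Type) (_ : LE T) (lev : T → L),
          IsLTree lev ∧ Countable T ∧ IsPruned lev ∧ HasStar lev ∧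
            Nonempty (G ≃ₜ* treeAut lev),
        -- special `L`-trees, where `L` has a minimum
        ∃ (L : Type) (_ : LinearOrder L) (T : Type) (_ : LE T) (lev : T → L),
          (∃ ℓ₀ : L, ∀ ℓ, ℓ₀ ≤ ℓ) ∧
          IsLTree lev ∧ Countable T ∧ IsPruned lev ∧ IsSpecial lev ∧ HasStar lev ∧
            Nonempty (G ≃ₜ* treeAut lev),
        -- special `ℚ`-trees
        ∃ (T : Type) (_ : LE T) (lev : T → ℚ),
          IsLTree lev ∧ Countable T ∧ IsPruned lev ∧ IsSpecial lev ∧ HasStar lev ∧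
            Nonempty (G ≃ₜ* treeAut lev),
        -- wreath products with locally finite supports
        ∃ (Δ : Type) (_ : PartialOrder Δ) (N : Δ → ℕ∞), IsCountableTreeable N ∧
          Nonempty (G ≃ₜ* wreath (domainLF N)),
        -- Malicki's wreath products
        ∃ (Δ : Type) (_ : PartialOrder Δ) (N : Δ → ℕ∞), IsCountableTreeable N ∧
          Nonempty (G ≃ₜ* wreath (domainWsp N)),
        -- wreath products over global domains
        ∃ (Δ : Type) (_ : PartialOrder Δ) (N : Δ → ℕ∞) (S : GlobalDomain N),
          IsCountableTreeable N ∧ S.IsApproxHomogeneous ∧ IsClosed S.carrier ∧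
            S.IsLocallyDetermined ∧ TopologicalSpace.SeparableSpace S.carrier ∧
            Nonempty (G ≃ₜ* wreath S),
        -- wreath products over local domains
        ∃ (Δ : Type) (_ : PartialOrder Δ) (N : Δ → ℕ∞) (D : LocalDomains N),
          IsCountableTreeable N ∧ D.IsCountable ∧ D.IsLocallyHomogeneous ∧ D.IsFull ∧
            SubsetMax D.S ∧ Nonempty (G ≃ₜ* localWreath D),
        -- projective wreath products
        ∃ (Δ : Type) (_ : PartialOrder Δ) (N : Δ → ℕ∞) (P : ProjectionSystem N),
          IsCountableTreeable N ∧ P.IsCountable ∧ P.IsLocallyHomogeneous ∧ P.IsFull ∧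
            SubsetMax P.S ∧ Nonempty (G ≃ₜ* projWreath P)] ∧
    -- the two support conditions define the same domain over a countable treeable skeleton
    ∀ (Δ : Type) [PartialOrder Δ] (N : Δ → ℕ∞), IsCountableTreeable N →
      domainLF N = domainWsp N := by
  refine ⟨?_, fun Δ _ N hN => domainLF_eq_domainWsp hN⟩
  tfae_have 2 → 1 := fun ⟨U, _, hU, hex, _, _, hG⟩ => ⟨U, _, hU, hex, hG⟩
  tfae_have 1 → 6 := fun ⟨_, _, hU, hex, ⟨g⟩⟩ =>
    let ⟨_, he⟩ := exists_ratScale hU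
    he.exists_tree hU hex g
  tfae_have 6 → 4 := fun ⟨T, _, lev, h, hc, hp, _, hstar, hG⟩ =>
    ⟨ℚ, _, T, _, lev, h, hc, hp, hstar, hG⟩
  tfae_have 4 → 7 := fun ⟨_, _, _, _, _, h, _, hp, hstar, ⟨g⟩⟩ => h.exists_wreath hp hstar g
  tfae_have 7 → 8 := fun ⟨Δ, _, N, hN, hG⟩ => ⟨Δ, _, N, hN, domainLF_eq_domainWsp hN ▸ hG⟩
  tfae_have 8 → 9 := fun ⟨Δ, _, N, hN, hG⟩ =>
    have := hN.countable
    ⟨Δ, _, N, domainLF N, hN, domainLF_isApproxHomogeneous,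
      domainLF_isLocallyDetermined.isClosed, domainLF_isLocallyDetermined,
      domainLF_separable hN.label_ne_zero, domainLF_eq_domainWsp hN ▸ hG⟩
  tfae_have 9 → 3 := fun ⟨_, _, _, _, hN, hah, _, hld, _, ⟨g⟩⟩ =>
    GlobalDomain.exists_uniformlyDiscrete hN hah hld g
  tfae_have 3 → 5 := fun ⟨_, _, hU, hex, hd, ⟨g⟩⟩ =>
    let ⟨L, _, _, _, he, hmin⟩ := IsUniformlyDiscrete.exists_scale hd hU
    let ⟨T, _, lev, hT⟩ := he.exists_tree hU hex g
    ⟨L, _, T, _, lev, hmin, hT⟩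
  tfae_have 5 → 4 := fun ⟨L, _, T, _, lev, _, h, hc, hp, _, hstar, hG⟩ =>
    ⟨L, _, T, _, lev, h, hc, hp, hstar, hG⟩
  tfae_have 7 → 10 := fun ⟨Δ, _, N, hN, ⟨g⟩⟩ =>
    let ⟨D, hc, hhom, hfull, hmax, hG⟩ := hN.exists_localDomains g
    ⟨Δ, _, N, D, hN, hc, hhom, hfull, hmax, hG⟩
  tfae_have 10 → 11 := fun ⟨Δ, _, N, D, hN, hc, hhom, hfull, hmax, hG⟩ =>
    ⟨Δ, _, N, D.toProjectionSystem, hN, hc, hhom, hfull.toProjectionSystem, hmax, hG⟩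
  tfae_have 11 → 2 := fun ⟨_, _, _, _, hN, hc, hhom, hfull, _, ⟨g⟩⟩ =>
    let ⟨U, _, hU, hex, hperf, hlc, ⟨f⟩⟩ := exists_perfect_locallyCompact hN hc hhom hfull
    ⟨U, _, hU, hex, hperf, hlc, ⟨g.trans f⟩⟩
  tfae_finish
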